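/- **Packing is redundant in Sequence Datalog.** *Data.* Fix a countably infinite set $\mathbf{dom}$ of atomic values. A *value* is an atomic value or a packed value $\langle p\rangle$ with $p$ a path; a *path* is a finite (possibly empty) sequence of values. Relation names have arities, and there are infinitely many names of each arity. A *schema* is a finite set of relation names; it is *monadic* if all arities are $\le 1$. An *instance* of a schema $\Gamma$ is a finite set of facts $R(p_1,\dots,p_n)$ with $R\in\Gamma$ of arity $n$ and paths $p_i$; it is *flat* if no packed value occurs in it. *Programs.* *Path expressions* are built like paths from atomic values, atomic variables $@x$ (ranging over $\mathbf{dom}$) and path variables $\$x$ (ranging over paths), by sequencing and packing $\langle e\rangle$. An *atom* is a predicate $R(e_1,\dots,e_n)$ or an equation $e_1=e_2$; a *literal* is an atom or a negated atom. A *rule* $H\leftarrow B$ has a predicate $H$ as head and a finite set $B$ of literals as body. Its *limited* variables form the smallest set that contains all variables of positive body predicates and, whenever it contains all variables of one side of a positive body equation, also all variables of the other side; the rule is *safe* if all its variables are limited. A *program* is a finite sequence of strata (finite sets of safe rules) such that if $\neg R(\dots)$ occurs in a stratum, then $R$ is in no head of that stratum or of a later one. *IDB* names are those occurring in heads, *EDB*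 names are the other names occurring in the program; the program is *over* $\Gamma$ if its EDB names are in $\Gamma$ and its IDB names are not. The strata are applied one after the other: a stratum maps $I$ to the smallest (finite) instance that contains $I$, agrees with $I$ on the names not in its heads, and satisfies its rules. The program *terminates* on $I$ if all these instances exist; its result is then denoted $\mathbf P(I)$. *Features.* A program uses **A** if some predicate in it has arity $>1$; **E** if some equation occurs; **I** if it has at least two IDB names; **N** if some negated atom occurs; **P** (packing) if some $\langle e\rangle$ occurs; **R** if the dependency graph on its IDB names (with an edge from $R_1$ to $R_2$ if $R_2$ occurs in the body of a rule with head name $R_1$) has a cycle. A *fragment* is a set $F$ of features; a program belongs to $F$ if it uses only features from $F$. *Queries.* For a monadic schema $\Gamma$ and a name $S\notin\Gamma$ of arity $\le 1$, a *query* from $\Gamma$ to $S$ is a total map $Q$ from flat instances of $\Gamma$ to flat instances of $\{S\}$. A program $\mathbf P$ *computes* $Q$ if it is over $\Gamma$, $S$ is an IDB name of $\mathbf P$, and on every flat instance $I$ of $\Gamma$ the program terminates and $\mathbf P(I)(S)=Q(I)$. Write $F_1\le F_2$ if every query computed by a program in $F_1$ is computed by a program in $F_2$. **Theorem.** 1.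 For every fragment $F\not\subseteq\{\mathsf A,\mathsf P\}$ we have $F\le F\setminus\{\mathsf P\}$. 2. For every fragment $F$, every query that is computed by a program in $F$ and is not constantly empty is computed by a program in $F\setminus\{\mathsf P\}$. So packing is redundant in every fragment; the only exception, for $F=\{\mathsf P\}$ and $F=\{\mathsf A,\mathsf P\}$, is the query that returns the empty relation on every input. -/

import Mathlib

namespace SeqDatalog

universe u

/-! ### Data model -/

/-- Values over the universe `dom` of atomic values: an atomic value, or a packed path, a path being
a finite sequence of values. -/
inductive Value (dom : Type u) : Type u
  | atom : dom → Value dom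
  | pack : List (Value dom) → Value dom

/-- Paths: finite sequences of values. Concatenation is `++`. -/
abbrev Path (dom : Type u) : Type u := List (Value dom)

/-- A path without occurrences of packed values. Such an occurrence exists at some depth iff one of
the elements of the sequence is packed. -/
def IsFlatPath {dom : Type u} (p : Path dom) : Prop :=
  ∀ v ∈ p, ∃ a : dom, v = Value.atom a

/-- Relation names, each with an associated arity; every arity has infinitely many names. -/
structure RelName : Type where
  id : ℕ
  arity : ℕ

/-- Schemas: finite sets of relation names. -/
abbrev Schema : Type := Finset RelName

/-- A schema whose relation names have arity zero or one. -/
def Schema.Monadic (Γ : Schema) : Prop := ∀ R ∈ Γ, R.arity ≤ 1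

/-- Facts `R(p₁, …, pₙ)`. -/
structure Fact (dom : Type u) : Type u where
  rel : RelName
  args : Fin rel.arity → Path dom

/-- `I` is an instance of the schema `Γ`, viewed as a set of facts. As `Γ` is finite, the set of
facts is finite iff each of the relations is. -/
def IsInstance {dom : Type u} (Γ : Schema) (I : Set (Fact dom)) : Prop :=
  I.Finite ∧ ∀ f ∈ I, f.rel ∈ Γ

/-- No packed value occurs in `I`. -/
def IsFlat {dom : Type u} (I : Set (Fact dom)) : Prop :=
  ∀ f ∈ I, ∀ i, IsFlatPath (f.args i)

/-- Flat instances of the schema `Γ`. -/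
def FlatInstance (dom : Type u) (Γ : Schema) : Type u :=
  {I : Set (Fact dom) // IsInstance Γ I ∧ IsFlat I}

/-! ### Programs: what they are -/

/-- Variables: atomic variables `@x` and path variables `$x`. -/
inductive Var : Type
  | atomic : ℕ → Var
  | path : ℕ → Var

/-- The elements of path expressions: atomic values, variables, and packed path expressions. -/
inductive Item (dom : Type u) : Type u
  | const : dom → Item dom
  | var : Var → Item dom
  | pack : List (Item dom) → Item dom

/-- Path expressions: finite sequences of items (nested sequences are identified with their
concatenation, and an item with the sequence of length one). -/
abbrev PathExpr (dom : Type u) : Type u := List (Item dom)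

mutual
/-- Variables that occur in an item. -/
def Item.vars {dom : Type u} : Item dom → Set Var
  | .const _ => ∅
  | .var x => {x}
  | .pack e => PathExpr.vars e
/-- Variables that occur in a path expression. -/
def PathExpr.vars {dom : Type u} : List (Item dom) → Set Var
  | [] => ∅
  | i :: e => Item.vars i ∪ PathExpr.vars e
end

/-- Some `⟨e'⟩` occurs in `e`. This is so at some depth iff one of the elements of the sequence has
this form. -/
def PathExpr.HasPack {dom : Type u} (e : PathExpr dom) : Prop :=
  ∃ e' : PathExpr dom, Item.pack e' ∈ e

/-- Predicates `P(e₁, …, eₙ)`. -/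
structure Pred (dom : Type u) : Type u where
  rel : RelName
  args : Fin rel.arity → PathExpr dom

/-- Atoms: predicates and equations. -/
inductive Atom (dom : Type u) : Type u
  | pred : Pred dom → Atom dom
  | eq : PathExpr dom → PathExpr dom → Atom dom

/-- Literals: atoms and negated atoms. -/
inductive Literal (dom : Type u) : Type u
  | pos : Atom dom → Literal dom
  | neg : Atom dom → Literal dom

/-- The atom of a literal. -/
def Literal.atom {dom : Type u} : Literal dom → Atom dom
  | .pos A => A
  | .neg A => A

/-- Rules `H ← B`. The list `body` stands for the finite set of its members. -/
structure Rule (dom : Type u) : Type u where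
  head : Pred dom
  body : List (Literal dom)

/-- The path expressions that are a component of the predicate. -/
def Pred.exprs {dom : Type u} (P : Pred dom) : Set (PathExpr dom) := Set.range P.args

/-- The path expressions that are a component of the predicate or a side of the equation. -/
def Atom.exprs {dom : Type u} : Atom dom → Set (PathExpr dom)
  | .pred P => P.exprs
  | .eq e₁ e₂ => {e₁, e₂}

/-- The maximal path expressions that occur in a rule. -/
def Rule.exprs {dom : Type u} (r : Rule dom) : Set (PathExpr dom) :=
  {e | e ∈ r.head.exprs ∨ ∃ L ∈ r.body, e ∈ L.atom.exprs}

/-- The predicates that occur in a rule, in the head or, positively or negated, in the body. -/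
def Rule.preds {dom : Type u} (r : Rule dom) : Set (Pred dom) :=
  {P | P = r.head ∨ ∃ L ∈ r.body, L.atom = Atom.pred P}

/-- The limited variables of a rule. -/
inductive Rule.Limited {dom : Type u} (r : Rule dom) : Var → Prop
  | pred (P : Pred dom) (h : Literal.pos (Atom.pred P) ∈ r.body) (e : PathExpr dom)
      (he : e ∈ P.exprs) (x : Var) (hx : x ∈ PathExpr.vars e) : Rule.Limited r x
  | eq_right (e₁ e₂ : PathExpr dom) (h : Literal.pos (Atom.eq e₁ e₂) ∈ r.body)
      (h₁ : ∀ y ∈ PathExpr.vars e₁, Rule.Limited r y) (x : Var) (hx : x ∈ PathExpr.vars e₂) :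
      Rule.Limited r x
  | eq_left (e₁ e₂ : PathExpr dom) (h : Literal.pos (Atom.eq e₁ e₂) ∈ r.body)
      (h₂ : ∀ y ∈ PathExpr.vars e₂, Rule.Limited r y) (x : Var) (hx : x ∈ PathExpr.vars e₁) :
      Rule.Limited r x

/-- A rule is safe if all variables that occur in it are limited. -/
def Rule.Safe {dom : Type u} (r : Rule dom) : Prop :=
  ∀ e ∈ r.exprs, ∀ x ∈ PathExpr.vars e, r.Limited x

/-- Strata: finite sets of rules, given as lists. -/
abbrev Stratum (dom : Type u) : Type u := List (Rule dom)

/-- Stratified negation: if a negated predicate with relation name `R` occurs in some stratum, then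
no rule of that stratum or of a later one has `R` in its head. -/
def Stratified {dom : Type u} : List (Stratum dom) → Prop
  | [] => True
  | s :: ss =>
      (∀ r ∈ s, ∀ P : Pred dom, Literal.neg (Atom.pred P) ∈ r.body →
        ∀ s' ∈ s :: ss, ∀ r' ∈ s', r'.head.rel ≠ P.rel) ∧
      Stratified ss

/-- Programs: finite sequences of strata of safe rules with stratified negation. -/
structure Program (dom : Type u) : Type u where
  strata : List (Stratum dom)
  safe : ∀ s ∈ strata, ∀ r ∈ s, r.Safe
  stratified : Stratified strata

/-- The rules of a program. -/
def Program.rules {dom : Type u} (P : Program dom) : Set (Rule dom) :=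
  {r | ∃ s ∈ P.strata, r ∈ s}

/-- IDB relation names: those in the head of some rule. -/
def Program.idb {dom : Type u} (P : Program dom) : Set RelName :=
  {R | ∃ r ∈ P.rules, r.head.rel = R}

/-- EDB relation names: the others that occur in the program. -/
def Program.edb {dom : Type u} (P : Program dom) : Set RelName :=
  {R | (∃ r ∈ P.rules, ∃ A ∈ r.preds, A.rel = R) ∧ R ∉ P.idb}

/-- The program is over the schema `Γ`. -/
def Program.IsOver {dom : Type u} (P : Program dom) (Γ : Schema) : Prop :=
  (∀ R ∈ P.edb, R ∈ Γ) ∧ ∀ R ∈ P.idb, R ∉ Γ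

/-! ### Programs: what they mean -/

/-- Valuations, taken to be defined on all variables. -/
structure Valuation (dom : Type u) : Type u where
  atomic : ℕ → dom
  path : ℕ → Path dom

/-- The path that a valuation assigns to a variable. -/
def Valuation.val {dom : Type u} (ν : Valuation dom) : Var → Path dom
  | .atomic x => [Value.atom (ν.atomic x)]
  | .path x => ν.path x

mutual
/-- Application of a valuation to an item. -/
def Item.eval {dom : Type u} (ν : Valuation dom) : Item dom → Path dom
  | .const a => [Value.atom a]
  | .var x => ν.val x
  | .pack e => [Value.pack (PathExpr.eval ν e)]
/-- Application of a valuation to a path expression. -/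
def PathExpr.eval {dom : Type u} (ν : Valuation dom) : List (Item dom) → Path dom
  | [] => []
  | i :: e => Item.eval ν i ++ PathExpr.eval ν e
end

/-- Application of a valuation to a predicate. -/
def Pred.eval {dom : Type u} (ν : Valuation dom) (P : Pred dom) : Fact dom :=
  ⟨P.rel, fun i => PathExpr.eval ν (P.args i)⟩

/-- `I, ν` satisfies an atom. -/
def Atom.Sat {dom : Type u} (I : Set (Fact dom)) (ν : Valuation dom) : Atom dom → Prop
  | .pred P => P.eval ν ∈ I
  | .eq e₁ e₂ => PathExpr.eval ν e₁ = PathExpr.eval ν e₂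

/-- `I, ν` satisfies a literal. -/
def Literal.Sat {dom : Type u} (I : Set (Fact dom)) (ν : Valuation dom) : Literal dom → Prop
  | .pos A => A.Sat I ν
  | .neg A => ¬ A.Sat I ν

/-- The rule is satisfied in `I`. -/
def Rule.SatisfiedIn {dom : Type u} (r : Rule dom) (I : Set (Fact dom)) : Prop :=
  ∀ ν : Valuation dom, (∀ L ∈ r.body, L.Sat I ν) → r.head.eval ν ∈ I

/-- `J` is the result of applying the stratum `s` to `I`: the smallest (finite) instance that
contains `I`, agrees with `I` on the relation names that are not in the head of a rule of `s`, and
satisfies all rules of `s`. If there is no such `J`, the stratum does not terminate on `I`. -/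
def StratumResult {dom : Type u} (s : Stratum dom) (I J : Set (Fact dom)) : Prop :=
  IsLeast {K : Set (Fact dom) | K.Finite ∧ I ⊆ K ∧
    (∀ f ∈ K, (∀ r ∈ s, r.head.rel ≠ f.rel) → f ∈ I) ∧ ∀ r ∈ s, r.SatisfiedIn K} J

/-- `J` is the result of applying the strata, one after the other, to `I`. -/
def StrataResult {dom : Type u} : List (Stratum dom) → Set (Fact dom) → Set (Fact dom) → Prop
  | [], I, J => J = I
  | s :: ss, I, J => ∃ K, StratumResult s I K ∧ StrataResult ss K J

/-- `P` terminates on `I` with `P(I) = J`. -/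
def Program.Result {dom : Type u} (P : Program dom) (I J : Set (Fact dom)) : Prop :=
  StrataResult P.strata I J

/-! ### Features, fragments, queries -/

/-- The six features. -/
inductive Feature : Type
  | arity
  | equations
  | intermediate
  | negation
  | packing
  | recursion

/-- Edges of the dependency graph, whose nodes are the IDB relation names: `R₂` occurs in the body
of a rule with `R₁` in its head. -/
def Program.DependsOn {dom : Type u} (P : Program dom) (R₁ R₂ : RelName) : Prop :=
  R₁ ∈ P.idb ∧ R₂ ∈ P.idb ∧ ∃ r ∈ P.rules, r.head.rel = R₁ ∧
    ∃ L ∈ r.body, ∃ A : Pred dom, L.atom = Atom.pred A ∧ A.rel = R₂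

/-- The program uses the feature. -/
def Program.Uses {dom : Type u} (P : Program dom) : Feature → Prop
  | .arity => ∃ r ∈ P.rules, ∃ A ∈ r.preds, 1 < A.rel.arity
  | .equations => ∃ r ∈ P.rules, ∃ L ∈ r.body, ∃ e₁ e₂, L.atom = Atom.eq e₁ e₂
  | .intermediate => ∃ R₁ ∈ P.idb, ∃ R₂ ∈ P.idb, R₁ ≠ R₂
  | .negation => ∃ r ∈ P.rules, ∃ A, Literal.neg A ∈ r.body
  | .packing => ∃ r ∈ P.rules, ∃ e ∈ r.exprs, PathExpr.HasPack e
  | .recursion => ∃ R, Relation.TransGen P.DependsOn R R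

/-- Fragments: sets of features. -/
abbrev Fragment : Type := Set Feature

/-- The program uses only features from `F`. -/
def Program.BelongsTo {dom : Type u} (P : Program dom) (F : Fragment) : Prop :=
  ∀ X, P.Uses X → X ∈ F

/-- Queries from a monadic schema `Γ` to a relation name `S ∉ Γ` of arity at most one: total
mappings from flat instances over `Γ` to flat instances over `{S}`. -/
structure Query (dom : Type u) (Γ : Schema) (S : RelName) : Type u where
  monadic : Γ.Monadic
  not_mem : S ∉ Γ
  arity_le : S.arity ≤ 1
  map : FlatInstance dom Γ → FlatInstance dom {S}

/-- The query returns the empty relation on every flat instance. -/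
def Query.IsConstEmpty {dom : Type u} {Γ : Schema} {S : RelName} (Q : Query dom Γ S) : Prop :=
  ∀ I, (Q.map I).1 = ∅

/-- The program computes the query: it is over `Γ`, has `S` among its IDB relation names, and on
every flat instance `I` of `Γ` it terminates and its result assigns to `S` the relation `Q(I)`. -/
def Program.Computes {dom : Type u} {Γ : Schema} {S : RelName} (P : Program dom)
    (Q : Query dom Γ S) : Prop :=
  P.IsOver Γ ∧ S ∈ P.idb ∧
    ∀ I : FlatInstance dom Γ, ∃ J, P.Result I.1 J ∧ {f ∈ J | f.rel = S} = (Q.map I).1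

/-- The query is computable by a program in the fragment. -/
def ComputableIn {dom : Type u} {Γ : Schema} {S : RelName} (F : Fragment) (Q : Query dom Γ S) :
    Prop :=
  ∃ P : Program dom, P.BelongsTo F ∧ P.Computes Q

/-- `F₁ ≤ F₂`: every query computable by a program in `F₁` is computable by a program in `F₂`. -/
def Subsumed (dom : Type u) (F₁ F₂ : Fragment) : Prop :=
  ∀ (Γ : Schema) (S : RelName) (Q : Query dom Γ S), ComputableIn F₁ Q → ComputableIn F₂ Q

end SeqDatalog

namespace SeqDatalog

universe u

variable {dom : Type u}

/-! ### Induction on paths and path expressions -/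

theorem Path.induct {motive : Path dom → Prop} (nil : motive [])
    (atom : ∀ a t, motive t → motive (Value.atom a :: t))
    (pack : ∀ p t, motive p → motive t → motive (Value.pack p :: t)) : ∀ p, motive p
  | [] => nil
  | .atom a :: t => atom a t (Path.induct nil atom pack t)
  | .pack p :: t => pack p t (Path.induct nil atom pack p) (Path.induct nil atom pack t)

theorem PathExpr.induct {motive : PathExpr dom → Prop} (nil : motive [])
    (const : ∀ a t, motive t → motive (Item.const a :: t))
    (var : ∀ x t, motive t → motive (Item.var x :: t))
    (pack : ∀ p t, motive p → motive t → motive (Item.pack p :: t)) : ∀ p, motive p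
  | [] => nil
  | .const a :: t => const a t (PathExpr.induct nil const var pack t)
  | .var a :: t => var a t (PathExpr.induct nil const var pack t)
  | .pack p :: t =>
      pack p t (PathExpr.induct nil const var pack p) (PathExpr.induct nil const var pack t)

@[simp] theorem PathExpr.eval_nil (ν : Valuation dom) : PathExpr.eval ν [] = [] := by
  simp [PathExpr.eval]

@[simp] theorem PathExpr.eval_cons (ν : Valuation dom) (i : Item dom) (e : PathExpr dom) :
    PathExpr.eval ν (i :: e) = Item.eval ν i ++ PathExpr.eval ν e := by
  simp [PathExpr.eval]

@[simp] theorem Item.eval_const (ν : Valuation dom) (a : dom) :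
    Item.eval ν (.const a) = [Value.atom a] := by simp [Item.eval]

@[simp] theorem Item.eval_var (ν : Valuation dom) (x : Var) :
    Item.eval ν (.var x) = ν.val x := by simp [Item.eval]

@[simp] theorem Item.eval_pack (ν : Valuation dom) (e : PathExpr dom) :
    Item.eval ν (.pack e) = [Value.pack (PathExpr.eval ν e)] := by simp [Item.eval]

@[simp] theorem PathExpr.eval_append (ν : Valuation dom) (e e' : PathExpr dom) :
    PathExpr.eval ν (e ++ e') = PathExpr.eval ν e ++ PathExpr.eval ν e' := by
  induction e with
  | nil => simp
  | cons i e ih => simp [ih]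

@[simp] theorem PathExpr.vars_nil : PathExpr.vars ([] : PathExpr dom) = ∅ := by
  simp [PathExpr.vars]

@[simp] theorem PathExpr.vars_cons (i : Item dom) (e : PathExpr dom) :
    PathExpr.vars (i :: e) = Item.vars i ∪ PathExpr.vars e := by
  simp [PathExpr.vars]

@[simp] theorem Item.vars_const (a : dom) : Item.vars (.const a : Item dom) = ∅ := by
  simp [Item.vars]

@[simp] theorem Item.vars_var (x : Var) : Item.vars (.var x : Item dom) = {x} := by
  simp [Item.vars]

@[simp] theorem Item.vars_pack (e : PathExpr dom) :
    Item.vars (.pack e : Item dom) = PathExpr.vars e := by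
  simp [Item.vars]

@[simp] theorem PathExpr.vars_append (e e' : PathExpr dom) :
    PathExpr.vars (e ++ e') = PathExpr.vars e ∪ PathExpr.vars e' := by
  induction e with
  | nil => simp
  | cons i e ih => simp [ih, Set.union_assoc]

theorem PathExpr.finite_vars (e : PathExpr dom) : (PathExpr.vars e).Finite := by
  induction e using PathExpr.induct with
  | nil => simp
  | const a t ih => simpa using ih
  | var x t ih => simpa using ih
  | pack p t ihp iht => simpa using ⟨ihp, iht⟩

theorem PathExpr.mem_vars_of_mem {e : PathExpr dom} {i : Item dom} (hi : i ∈ e) :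
    Item.vars i ⊆ PathExpr.vars e := by
  induction e with
  | nil => simp at hi
  | cons j e ih =>
    rcases List.mem_cons.1 hi with rfl | h
    · simp
    · simpa using (ih h).trans Set.subset_union_right

/-! ### Coding tuples of sequences as one sequence -/

/-- The pair coding `s a t a s b t`, which is injective when `a ≠ b`. -/
def pairCode {α : Type*} (a b : α) (s t : List α) : List α :=
  (s ++ a :: t) ++ a :: (s ++ b :: t)

/-- The iterated pair coding of a list of sequences. -/
def tupleCode {α : Type*} (a b : α) : List (List α) → List α
  | [] => []
  | s :: l => pairCode a b s (tupleCode a b l)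

/-- The two halves `s a t` and `s b t` have equal length and differ exactly at position `|s|`, which
reveals where `s` ends. No letter has to be absent from `s` and `t`, which matters because the input
may use every atomic value. -/
theorem pairCode_inj {α : Type*} {a b : α} (hab : a ≠ b) {s t s' t' : List α}
    (h : pairCode a b s t = pairCode a b s' t') : s = s' ∧ t = t' := by
  -- The total length is `2 * (|s| + |t| + 1) + 1`, so it fixes the position of the middle
  -- separator.
  have hlen := congrArg List.length h
  simp only [pairCode, List.length_append, List.length_cons] at hlen
  obtain ⟨h₁, h₂⟩ := List.append_inj h (by simp; omega)
  have h₂ := (List.cons.inj h₂).2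
  -- If `|s| < |s'|`, then at position `|s|` both primed halves show the same letter of `s'`, while
  -- the unprimed ones show `a` and `b`.
  have key : s.length = s'.length := by
    rcases lt_trichotomy s.length s'.length with hl | hl | hl
    · exfalso
      have e₁ := congrArg (fun l => l[s.length]?) h₁
      have e₂ := congrArg (fun l => l[s.length]?) h₂
      simp only [List.getElem?_append_left hl] at e₁ e₂
      rw [← e₂] at e₁
      simp at e₁
      exact hab e₁
    · exact hl
    · exfalso
      have e₁ := congrArg (fun l => l[s'.length]?) h₁
      have e₂ := congrArg (fun l => l[s'.length]?) h₂
      simp only [List.getElem?_append_left hl] at e₁ e₂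
      rw [e₂] at e₁
      simp at e₁
      exact hab e₁.symm
  obtain ⟨rfl, h₃⟩ := List.append_inj h₁ key
  exact ⟨rfl, (List.cons.inj h₃).2⟩

/-- Equal lengths must be assumed, since the code does not record where the nesting stops. In the
applications the length is known from the shape or from the arity. -/
theorem tupleCode_inj {α : Type*} {a b : α} (hab : a ≠ b) :
    ∀ {l l' : List (List α)}, l.length = l'.length → tupleCode a b l = tupleCode a b l' → l = l'
  | [], [], _, _ => rfl
  | [], _ :: _, h, _ => by simp at h
  | _ :: _, [], h, _ => by simp at h
  | s :: l, s' :: l', hl, h => by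
    obtain ⟨rfl, h₂⟩ := pairCode_inj hab h
    rw [tupleCode_inj hab (by simpa using hl) h₂]

/-- The tuple coding at the level of path expressions. -/
abbrev tupleExpr (a b : dom) (l : List (PathExpr dom)) : PathExpr dom :=
  tupleCode (Item.const a) (Item.const b) l

/-- The tuple coding of paths. -/
abbrev tuplePath (a b : dom) (l : List (Path dom)) : Path dom :=
  tupleCode (Value.atom a) (Value.atom b) l

theorem eval_tupleExpr (a b : dom) (ν : Valuation dom) (l : List (PathExpr dom)) :
    PathExpr.eval ν (tupleExpr a b l) = tuplePath a b (l.map (PathExpr.eval ν)) := by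
  induction l with
  | nil => simp [tupleCode]
  | cons s l ih => simp [tupleCode, pairCode, ih]

theorem mem_vars_tupleExpr (a b : dom) (x : Var) (l : List (PathExpr dom)) :
    x ∈ PathExpr.vars (tupleExpr a b l) ↔ ∃ e ∈ l, x ∈ PathExpr.vars e := by
  induction l with
  | nil => simp [tupleCode]
  | cons s l ih => simp [tupleCode, pairCode, ih]; tauto

theorem mem_tupleCode {α : Type*} {a b y : α} {l : List (List α)} (h : y ∈ tupleCode a b l) :
    y = a ∨ y = b ∨ ∃ s ∈ l, y ∈ s := by
  induction l with
  | nil => simp [tupleCode] at h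
  | cons s l ih =>
    simp only [tupleCode, pairCode, List.mem_append, List.mem_cons] at h
    have : y ∈ tupleCode a b l → y = a ∨ y = b ∨ ∃ s' ∈ s :: l, y ∈ s' := fun h => by
      rcases ih h with h | h | ⟨s', hs', h⟩
      · exact .inl h
      · exact .inr (.inl h)
      · exact .inr (.inr ⟨s', by simp [hs'], h⟩)
    have hs : y ∈ s → y = a ∨ y = b ∨ ∃ s' ∈ s :: l, y ∈ s' := fun h =>
      .inr (.inr ⟨s, by simp, h⟩)
    tauto

theorem not_hasPack_tupleExpr (a b : dom) {l : List (PathExpr dom)}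
    (h : ∀ e ∈ l, ¬ PathExpr.HasPack e) : ¬ PathExpr.HasPack (tupleExpr a b l) := by
  rintro ⟨e', he'⟩
  rcases mem_tupleCode he' with h' | h' | ⟨s, hs, h'⟩
  · cases h'
  · cases h'
  · exact h s hs ⟨e', h'⟩

theorem isFlatPath_tuplePath (a b : dom) {l : List (Path dom)}
    (h : ∀ p ∈ l, IsFlatPath p) : IsFlatPath (tuplePath a b l) := by
  intro v hv
  rcases mem_tupleCode hv with h' | h' | ⟨s, hs, h'⟩
  · exact ⟨a, h'⟩
  · exact ⟨b, h'⟩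
  · exact h s hs v h'

/-! ### Paths as words with brackets -/

section Brackets

variable {α β : Type*}

/-- The sequence of brackets in a word. -/
def brackets (t : List (α ⊕ Bool)) : List Bool := t.filterMap Sum.getRight?

/-- The letters of a word that are not brackets. -/
def letters (t : List (α ⊕ Bool)) : List α := t.filterMap Sum.getLeft?

/-- The bracket-free blocks into which the brackets divide a word. -/
def blocks : List (α ⊕ Bool) → List (List α)
  | [] => [[]]
  | .inl x :: t => (blocks t).modifyHead (x :: ·)
  | .inr _ :: t => [] :: blocks t

/-- The word with given brackets and blocks. -/
def interleave : List Bool → List (List α) → List (α ⊕ Bool)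
  | _, [] => []
  | [], c :: _ => c.map .inl
  | b :: bs, c :: cs => c.map .inl ++ .inr b :: interleave bs cs

@[simp] theorem brackets_nil : brackets ([] : List (α ⊕ Bool)) = [] := rfl
@[simp] theorem brackets_inl (x : α) (t) : brackets (.inl x :: t) = brackets t := rfl
@[simp] theorem brackets_inr (b : Bool) (t : List (α ⊕ Bool)) :
    brackets (.inr b :: t) = b :: brackets t := rfl
@[simp] theorem brackets_append (t t' : List (α ⊕ Bool)) :
    brackets (t ++ t') = brackets t ++ brackets t' := by simp [brackets]
@[simp] theorem brackets_map_inl (c : List α) : brackets (c.map Sum.inl) = [] := by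
  induction c with
  | nil => rfl
  | cons x c ih => simpa using ih

@[simp] theorem letters_nil : letters ([] : List (α ⊕ Bool)) = [] := rfl
@[simp] theorem letters_inl (x : α) (t) : letters (.inl x :: t) = x :: letters t := rfl
@[simp] theorem letters_inr (b : Bool) (t : List (α ⊕ Bool)) :
    letters (.inr b :: t) = letters t := rfl
@[simp] theorem letters_append (t t' : List (α ⊕ Bool)) :
    letters (t ++ t') = letters t ++ letters t' := by simp [letters]
@[simp] theorem letters_map_inl (c : List α) : letters (c.map Sum.inl) = c := by
  induction c with
  | nil => rfl
  | cons x c ih => simpa using ih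

theorem mem_letters {x : α} {t : List (α ⊕ Bool)} : x ∈ letters t ↔ .inl x ∈ t := by
  simp [letters]

@[simp] theorem length_blocks (t : List (α ⊕ Bool)) :
    (blocks t).length = (brackets t).length + 1 := by
  induction t with
  | nil => rfl
  | cons x t ih => cases x <;> simp [blocks, ih]

/-- Shape and blocks together lose nothing; this is what permits storing the shape in a relation
name and only the blocks in its argument. -/
theorem interleave_blocks (t : List (α ⊕ Bool)) : interleave (brackets t) (blocks t) = t := by
  induction t with
  | nil => rfl
  | cons x t ih =>
    cases x with
    | inl x =>
      have hl := length_blocks t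
      cases hb : blocks t with
      | nil => simp [hb] at hl
      | cons c cs =>
        rw [hb] at ih
        cases hbr : brackets t <;> simp_all [blocks, interleave]
    | inr b => simp [blocks, interleave, ih]

theorem brackets_interleave : ∀ (bs : List Bool) (cs : List (List α)),
    cs.length = bs.length + 1 → brackets (interleave bs cs) = bs
  | _, [], h => by simp at h
  | [], c :: _, _ => by simp [interleave]
  | b :: bs, c :: cs, h => by
    simp [interleave, brackets_interleave bs cs (by simpa using h)]

theorem blocks_map_inl_append (c : List α) (t : List (α ⊕ Bool)) :
    blocks (c.map .inl ++ t) = (blocks t).modifyHead (c ++ ·) := by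
  induction c with
  | nil =>
    cases h : blocks t <;> simp [h]
  | cons x c ih =>
    simp only [List.map_cons, List.cons_append, blocks, ih]
    cases h : blocks t <;> simp

theorem mem_blocks {x : α} {t : List (α ⊕ Bool)} :
    (∃ c ∈ blocks t, x ∈ c) ↔ .inl x ∈ t := by
  induction t with
  | nil => simp [blocks]
  | cons y t ih =>
    cases y with
    | inl y =>
      have hl := length_blocks t
      cases hb : blocks t with
      | nil => simp [hb] at hl
      | cons c cs =>
        rw [hb] at ih
        simp [blocks, hb, ← ih, or_assoc]
    | inr b => simp [blocks, ih]

theorem mem_interleave {y : α} : ∀ {bs : List Bool} {cs : List (List α)},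
    .inl y ∈ interleave bs cs → ∃ c ∈ cs, y ∈ c
  | _, [], h => by simp [interleave] at h
  | [], c :: _, h => ⟨c, by simp, by simpa [interleave] using h⟩
  | b :: bs, c :: cs, h => by
    simp only [interleave, List.mem_append, List.mem_map, Sum.inl.injEq, exists_eq_right,
      List.mem_cons, reduceCtorEq, false_or] at h
    rcases h with h | h
    · exact ⟨c, by simp, h⟩
    · obtain ⟨c', hc', h'⟩ := mem_interleave h
      exact ⟨c', by simp [hc'], h'⟩

/-- Substitution of sequences for the letters of a word. -/
def substLetters (f : α → List β) (t : List (α ⊕ Bool)) : List (β ⊕ Bool) :=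
  t.flatMap fun
    | .inl x => (f x).map .inl
    | .inr b => [.inr b]

@[simp] theorem substLetters_nil (f : α → List β) : substLetters f [] = [] := rfl
@[simp] theorem substLetters_inl (f : α → List β) (x : α) (t) :
    substLetters f (.inl x :: t) = (f x).map .inl ++ substLetters f t := by simp [substLetters]
@[simp] theorem substLetters_inr (f : α → List β) (b : Bool) (t) :
    substLetters f (.inr b :: t) = .inr b :: substLetters f t := by simp [substLetters]
@[simp] theorem substLetters_append (f : α → List β) (t t') :
    substLetters f (t ++ t') = substLetters f t ++ substLetters f t' := by simp [substLetters]
theorem substLetters_map_inl (f : α → List β) (c : List α) :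
    substLetters f (c.map .inl) = (c.flatMap f).map .inl := by
  induction c with
  | nil => rfl
  | cons x c ih => simp [ih]

@[simp] theorem brackets_substLetters (f : α → List β) (t) :
    brackets (substLetters f t) = brackets t := by
  induction t with
  | nil => rfl
  | cons x t ih => cases x <;> simp [ih]

theorem letters_substLetters (f : α → List β) (t) :
    letters (substLetters f t) = (letters t).flatMap f := by
  induction t with
  | nil => rfl
  | cons x t ih => cases x <;> simp [ih]

/-- Substituted sequences contain no brackets, so substitution acts inside each block and never
moves a block boundary. -/
theorem blocks_substLetters (f : α → List β) (t) :
    blocks (substLetters f t) = (blocks t).map (·.flatMap f) := by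
  induction t with
  | nil => rfl
  | cons x t ih =>
    cases x with
    | inl x =>
      simp only [substLetters_inl, blocks_map_inl_append, ih, blocks]
      cases blocks t <;> simp
    | inr b => simp [blocks, ih]

theorem substLetters_interleave (f : α → List β) : ∀ (bs : List Bool) (cs : List (List α)),
    substLetters f (interleave bs cs) = interleave bs (cs.map (·.flatMap f))
  | _, [] => by simp [interleave]
  | [], c :: _ => by simp [interleave, substLetters_map_inl]
  | b :: bs, c :: cs => by
    simp [interleave, substLetters_map_inl, substLetters_interleave f bs cs]

end Brackets

/-- A path as a word with brackets. -/
def Path.word : Path dom → List (Value dom ⊕ Bool)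
  | [] => []
  | .atom a :: t => .inl (.atom a) :: Path.word t
  | .pack p :: t => .inr true :: (Path.word p ++ .inr false :: Path.word t)

@[simp] theorem Path.word_nil : Path.word ([] : Path dom) = [] := by simp [Path.word]
@[simp] theorem Path.word_atom (a : dom) (t) :
    Path.word (Value.atom a :: t) = .inl (.atom a) :: Path.word t := by simp [Path.word]
@[simp] theorem Path.word_pack (p t : Path dom) :
    Path.word (Value.pack p :: t) = .inr true :: (Path.word p ++ .inr false :: Path.word t) := by
  simp [Path.word]

@[simp] theorem Path.word_append (p q : Path dom) :
    Path.word (p ++ q) = Path.word p ++ Path.word q := by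
  induction p using Path.induct with
  | nil => simp
  | atom a t ih => simp [ih]
  | pack p t _ ih => simp [ih]

/-- Unique parsing: the word of a path never continues with an unmatched closing bracket, so such a
bracket, or the end of the word, marks where the path stops. Allowing tails is what makes the
induction pass through a packed value. -/
theorem Path.word_append_inj (p : Path dom) : ∀ (q : Path dom) (t t' : List (Value dom ⊕ Bool)),
    (∀ x, t.head? = some x → x = .inr false) → (∀ x, t'.head? = some x → x = .inr false) →
    Path.word p ++ t = Path.word q ++ t' → p = q ∧ t = t' := by
  induction p using Path.induct with
  | nil =>
    rintro (_ | ⟨_ | _, q⟩) t t' ht ht' h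
    · exact ⟨rfl, by simpa using h⟩
    · simp at h
      exact absurd (ht _ (by rw [h]; rfl)) (by simp)
    · simp at h
      exact absurd (ht _ (by rw [h]; rfl)) (by simp)
  | atom a p ih =>
    rintro (_ | ⟨_ | _, q⟩) t t' ht ht' h
    · simp at h
      exact absurd (ht' _ (by rw [← h]; rfl)) (by simp)
    · simp at h
      obtain ⟨rfl, rfl⟩ := ih q t t' ht ht' h.2
      simp [h.1]
    · simp at h
  | pack p r ihp ihr =>
    rintro (_ | ⟨_ | q, q'⟩) t t' ht ht' h
    · simp at h
      exact absurd (ht' _ (by rw [← h]; rfl)) (by simp)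
    · simp at h
    · simp only [word_pack, List.cons_append, List.append_assoc, List.cons.injEq, true_and] at h
      obtain ⟨rfl, h₂⟩ := ihp q _ _ (by simp) (by simp) h
      obtain ⟨rfl, rfl⟩ := ihr q' t t' ht ht' (List.cons.inj h₂).2
      simp

theorem Path.word_injective : Function.Injective (Path.word (dom := dom)) := fun p q h =>
  (Path.word_append_inj p q [] [] (by simp) (by simp) (by simpa using h)).1

theorem Path.word_of_isFlatPath {p : Path dom} (hp : IsFlatPath p) :
    Path.word p = p.map .inl := by
  induction p with
  | nil => simp
  | cons v p ih =>
    obtain ⟨a, rfl⟩ := hp v (by simp)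
    simp [ih fun v hv => hp v (by simp [hv])]

theorem Path.isFlatPath_iff (p : Path dom) : IsFlatPath p ↔ brackets (Path.word p) = [] := by
  refine ⟨fun h => by simp [Path.word_of_isFlatPath h], fun h => ?_⟩
  induction p with
  | nil => intro v hv; simp at hv
  | cons v p ih =>
    cases v with
    | atom a =>
      intro w hw
      rcases List.mem_cons.1 hw with rfl | hw
      · exact ⟨a, rfl⟩
      · exact ih (by simpa using h) w hw
    | pack q => simp at h

theorem Path.atom_of_mem_word (p : Path dom) : ∀ v, .inl v ∈ Path.word p → ∃ a, v = .atom a := by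
  induction p using Path.induct with
  | nil => simp
  | atom a t ih =>
    intro v hv
    simp only [word_atom, List.mem_cons, Sum.inl.injEq] at hv
    rcases hv with rfl | hv
    · exact ⟨a, rfl⟩
    · exact ih v hv
  | pack p t ihp iht =>
    intro v hv
    simp only [word_pack, List.mem_cons, reduceCtorEq, List.mem_append, false_or] at hv
    exact hv.elim (ihp v) (iht v)

-- Which bracketed words come from paths

/-- The brackets close `n` open brackets and are balanced otherwise. -/
def Balanced : ℕ → List Bool → Prop
  | n, [] => n = 0
  | n, true :: bs => Balanced (n + 1) bs
  | 0, false :: _ => False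
  | n + 1, false :: bs => Balanced n bs

theorem balanced_word_append (p : Path dom) : ∀ (n : ℕ) (bs : List Bool),
    Balanced n (brackets (Path.word p) ++ bs) ↔ Balanced n bs := by
  induction p using Path.induct with
  | nil => simp
  | atom a t ih => simpa using ih
  | pack p t ihp iht => intro n bs; simp [Balanced, ihp, iht]

theorem balanced_word (p : Path dom) : Balanced 0 (brackets (Path.word p)) := by
  simpa [Balanced] using (balanced_word_append p 0 [])

/-- A word that closes `n` brackets opened earlier is a path followed by `n` times a closing bracket
and a path. Reading one more opening bracket on the left merges the first two paths into a packed
value followed by the second. -/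
theorem exists_words_of_balanced (t : List (Value dom ⊕ Bool)) :
    ∀ n, (∀ v, .inl v ∈ t → ∃ a, v = .atom a) → Balanced n (brackets t) →
    ∃ (p : Path dom) (ps : List (Path dom)), ps.length = n ∧
      t = Path.word p ++ ps.flatMap fun q => .inr false :: Path.word q := by
  induction t with
  | nil =>
    intro n _ h
    exact ⟨[], [], by simpa [Balanced] using h.symm, by simp⟩
  | cons x t ih =>
    intro n hat h
    have hat' : ∀ v, .inl v ∈ t → ∃ a, v = .atom a := fun v hv => hat v (by simp [hv])
    rcases x with v | _ | _
    · obtain ⟨p, ps, hl, rfl⟩ := ih n hat' h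
      obtain ⟨a, rfl⟩ := hat v (by simp)
      exact ⟨.atom a :: p, ps, hl, by simp⟩
    · cases n with
      | zero => simp [Balanced] at h
      | succ n =>
        obtain ⟨p, ps, hl, rfl⟩ := ih n hat' (by simpa [Balanced] using h)
        exact ⟨[], p :: ps, by simp [hl], by simp⟩
    · obtain ⟨p, ps, hl, rfl⟩ := ih (n + 1) hat' (by simpa [Balanced] using h)
      cases ps with
      | nil => simp at hl
      | cons q ps => exact ⟨.pack p :: q, ps, by simpa using hl, by simp⟩

theorem exists_word_of_balanced {t : List (Value dom ⊕ Bool)}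
    (ht : ∀ v, .inl v ∈ t → ∃ a, v = .atom a) (h : Balanced 0 (brackets t)) :
    ∃ p : Path dom, Path.word p = t := by
  obtain ⟨p, ps, hl, rfl⟩ := exists_words_of_balanced t 0 ht h
  obtain rfl := List.length_eq_zero_iff.1 hl
  exact ⟨p, by simp⟩

/-- The number of brackets in a path. -/
def Path.bracketCount (p : Path dom) : ℕ := (brackets (Path.word p)).length

/-! ### Limited variables -/

theorem Rule.mem_exprs_of_mem_body {r : Rule dom} {L : Literal dom} (hL : L ∈ r.body)
    {e : PathExpr dom} (he : e ∈ L.atom.exprs) : e ∈ r.exprs := .inr ⟨L, hL, he⟩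

/-- A notion of smallness of sets of paths that passes from path expressions to their variables and
back passes from the components of the positive body predicates to the limited variables. -/
theorem Rule.Limited.small {r : Rule dom} {N : Set (Valuation dom)} {Small : Set (Path dom) → Prop}
    (hpred : ∀ P, Literal.pos (Atom.pred P) ∈ r.body → ∀ e ∈ P.exprs,
      Small ((fun ν => PathExpr.eval ν e) '' N))
    (heq : ∀ e₁ e₂, Literal.pos (Atom.eq e₁ e₂) ∈ r.body → ∀ ν ∈ N,
      PathExpr.eval ν e₁ = PathExpr.eval ν e₂)
    (hvar : ∀ e ∈ r.exprs, ∀ x ∈ PathExpr.vars e, Small ((fun ν => PathExpr.eval ν e) '' N) →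
      Small ((fun ν => ν.val x) '' N))
    (heval : ∀ e ∈ r.exprs, (∀ x ∈ PathExpr.vars e, Small ((fun ν => ν.val x) '' N)) →
      Small ((fun ν => PathExpr.eval ν e) '' N))
    {x : Var} (hx : r.Limited x) : Small ((fun ν => ν.val x) '' N) := by
  induction hx with
  | pred P h e he x hx =>
    exact hvar e (Rule.mem_exprs_of_mem_body h he) x hx (hpred P h e he)
  | eq_right e₁ e₂ h _ x hx ih =>
    refine hvar e₂ (Rule.mem_exprs_of_mem_body h (by simp [Literal.atom, Atom.exprs])) x hx ?_
    rw [← Set.image_congr (heq e₁ e₂ h)]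
    exact heval e₁ (Rule.mem_exprs_of_mem_body h (by simp [Literal.atom, Atom.exprs])) ih
  | eq_left e₁ e₂ h _ x hx ih =>
    refine hvar e₁ (Rule.mem_exprs_of_mem_body h (by simp [Literal.atom, Atom.exprs])) x hx ?_
    rw [Set.image_congr (heq e₁ e₂ h)]
    exact heval e₂ (Rule.mem_exprs_of_mem_body h (by simp [Literal.atom, Atom.exprs])) ih

/-- Without packing, evaluation is concatenation at top level, so values of variables are contiguous
pieces. Finiteness and flatness then pass from expressions to their variables. -/
theorem val_isInfix_eval {e : PathExpr dom} (he : ¬ PathExpr.HasPack e) {x : Var}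
    (hx : x ∈ PathExpr.vars e) (ν : Valuation dom) : ν.val x <:+: PathExpr.eval ν e := by
  induction e with
  | nil => simp at hx
  | cons i e ih =>
    have he' : ¬ PathExpr.HasPack e := fun ⟨e', h⟩ => he ⟨e', by simp [h]⟩
    rw [PathExpr.vars_cons] at hx
    rcases hx with hx | hx
    · cases i with
      | const a => simp at hx
      | var y =>
        obtain rfl : x = y := by simpa using hx
        exact ⟨[], PathExpr.eval ν e, by simp⟩
      | pack e' => exact absurd ⟨e', by simp⟩ he
    · obtain ⟨s, t, h⟩ := ih he' hx
      exact ⟨Item.eval ν i ++ s, t, by simp [← h]⟩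

theorem finite_image_eval {e : PathExpr dom} (he : ¬ PathExpr.HasPack e) {N : Set (Valuation dom)}
    (h : ∀ x ∈ PathExpr.vars e, ((fun ν => ν.val x) '' N).Finite) :
    ((fun ν => PathExpr.eval ν e) '' N).Finite := by
  induction e with
  | nil => exact (Set.finite_singleton []).subset (by rintro _ ⟨ν, _, rfl⟩; simp)
  | cons i e ih =>
    have he' : ¬ PathExpr.HasPack e := fun ⟨e', h⟩ => he ⟨e', by simp [h]⟩
    have hi : ((fun ν => Item.eval ν i) '' N).Finite := by
      cases i with
      | const a =>
        exact (Set.finite_singleton [Value.atom a]).subset (by rintro _ ⟨ν, _, rfl⟩; simp)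
      | var y => simpa using h y (by simp)
      | pack e' => exact absurd ⟨e', by simp⟩ he
    refine (Set.Finite.image2 (· ++ ·) hi (ih he' fun x hx => h x (by simp [hx]))).subset ?_
    rintro _ ⟨ν, hν, rfl⟩
    exact ⟨_, ⟨ν, hν, rfl⟩, _, ⟨ν, hν, rfl⟩, by simp⟩

theorem finite_setOf_isInfix {α : Type*} (l : List α) : {s | s <:+: l}.Finite := by
  refine (List.finite_toSet (l.tails.flatMap List.inits)).subset fun s hs => ?_
  obtain ⟨t, h₁, h₂⟩ := List.infix_iff_prefix_suffix.1 hs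
  simp only [List.mem_flatMap, List.mem_tails, List.mem_inits, Set.mem_ofPred_eq]
  exact ⟨t, h₂, h₁⟩

/-- Over a finite instance, the limited variables of a rule without packing have finitely many
values. -/
theorem Rule.Limited.finite {r : Rule dom} (hr : ∀ e ∈ r.exprs, ¬ PathExpr.HasPack e)
    {K : Set (Fact dom)} (hK : K.Finite) {x : Var} (hx : r.Limited x) :
    {p | ∃ ν : Valuation dom, (∀ L ∈ r.body, L.Sat K ν) ∧ p = ν.val x}.Finite := by
  have := Rule.Limited.small (r := r) (N := {ν | ∀ L ∈ r.body, L.Sat K ν}) (Small := Set.Finite)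
    ?_ ?_ ?_ ?_ hx
  · refine this.subset ?_
    rintro _ ⟨ν, hν, rfl⟩
    exact ⟨ν, hν, rfl⟩
  · rintro P hP _ ⟨i, rfl⟩
    refine (hK.image fun f => (List.ofFn f.args).getD i []).subset ?_
    rintro _ ⟨ν, hν, rfl⟩
    refine ⟨P.eval ν, hν _ hP, ?_⟩
    simp [Pred.eval]
  · intro e₁ e₂ h ν hν
    exact hν _ h
  · intro e he x hx h
    refine (h.biUnion fun l _ => finite_setOf_isInfix l).subset ?_
    rintro _ ⟨ν, hν, rfl⟩
    simp only [Set.mem_iUnion]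
    exact ⟨_, ⟨ν, hν, rfl⟩, val_isInfix_eval (hr e he) hx ν⟩
  · intro e he h
    exact finite_image_eval (hr e he) h

theorem IsFlatPath.append {p q : Path dom} (hp : IsFlatPath p) (hq : IsFlatPath q) :
    IsFlatPath (p ++ q) := fun v hv =>
  (List.mem_append.1 hv).elim (hp v) (hq v)

theorem isFlatPath_eval {e : PathExpr dom} (he : ¬ PathExpr.HasPack e) {ν : Valuation dom}
    (h : ∀ x ∈ PathExpr.vars e, IsFlatPath (ν.val x)) : IsFlatPath (PathExpr.eval ν e) := by
  induction e with
  | nil => intro v hv; simp at hv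
  | cons i e ih =>
    have he' : ¬ PathExpr.HasPack e := fun ⟨e', h⟩ => he ⟨e', by simp [h]⟩
    rw [PathExpr.eval_cons]
    refine IsFlatPath.append ?_ (ih he' fun x hx => h x (by simp [hx]))
    cases i with
    | const a => intro v hv; exact ⟨a, by simpa using hv⟩
    | var y => simpa using h y (by simp)
    | pack e' => exact absurd ⟨e', by simp⟩ he

/-- Over a flat instance, the limited variables of a rule without packing have flat values. -/
theorem Rule.Limited.isFlatPath {r : Rule dom} (hr : ∀ e ∈ r.exprs, ¬ PathExpr.HasPack e)
    {K : Set (Fact dom)} (hK : IsFlat K) {ν : Valuation dom} (hν : ∀ L ∈ r.body, L.Sat K ν)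
    {x : Var} (hx : r.Limited x) : IsFlatPath (ν.val x) := by
  have := Rule.Limited.small (r := r) (N := {ν}) (Small := fun A => ∀ p ∈ A, IsFlatPath p)
    ?_ ?_ ?_ ?_ hx
  · simpa using this
  · rintro P hP _ ⟨i, rfl⟩
    simp only [Set.image_singleton, Set.mem_singleton_iff, forall_eq]
    exact hK _ (hν _ hP) i
  · rintro e₁ e₂ h _ rfl
    exact hν _ h
  · intro e he x hx h
    simp only [Set.image_singleton, Set.mem_singleton_iff, forall_eq] at h ⊢
    exact fun v hv => h v ((val_isInfix_eval (hr e he) hx ν).subset hv)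
  · intro e he h
    simp only [Set.image_singleton, Set.mem_singleton_iff, forall_eq] at h ⊢
    exact isFlatPath_eval (hr e he) h

theorem Path.bracketCount_append (p q : Path dom) :
    Path.bracketCount (p ++ q) = Path.bracketCount p + Path.bracketCount q := by
  simp [Path.bracketCount]

theorem Path.bracketCount_pack (p : Path dom) :
    Path.bracketCount [Value.pack p] = Path.bracketCount p + 2 := by
  simp [Path.bracketCount]

/-- In contrast to being an infix, the number of brackets is also controlled when the variable
occurs below packing: packing only adds brackets. -/
theorem bracketCount_val_le {e : PathExpr dom} {x : Var} (hx : x ∈ PathExpr.vars e)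
    (ν : Valuation dom) : Path.bracketCount (ν.val x) ≤ Path.bracketCount (PathExpr.eval ν e) := by
  induction e using PathExpr.induct with
  | nil => simp at hx
  | const a t ih =>
    have := ih (by simpa using hx)
    rw [PathExpr.eval_cons, Path.bracketCount_append]; omega
  | var y t ih =>
    rw [PathExpr.eval_cons, Path.bracketCount_append]
    rw [PathExpr.vars_cons] at hx
    rcases hx with hx | hx
    · obtain rfl : x = y := by simpa using hx
      simp
    · have := ih hx; omega
  | pack p t ihp iht =>
    rw [PathExpr.eval_cons, Path.bracketCount_append, Item.eval_pack, Path.bracketCount_pack]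
    rw [PathExpr.vars_cons] at hx
    rcases hx with hx | hx
    · have := ihp (by simpa using hx); omega
    · have := iht hx; omega

theorem exists_bracketCount_eval_le {e : PathExpr dom} {N : Set (Valuation dom)}
    (h : ∀ x ∈ PathExpr.vars e, ∃ b, ∀ ν ∈ N, Path.bracketCount (ν.val x) ≤ b) :
    ∃ b, ∀ ν ∈ N, Path.bracketCount (PathExpr.eval ν e) ≤ b := by
  induction e using PathExpr.induct with
  | nil => exact ⟨0, fun ν _ => by simp [Path.bracketCount]⟩
  | const a t ih =>
    obtain ⟨b, hb⟩ := ih fun x hx => h x (by simp [hx])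
    exact ⟨b, fun ν hν => by simpa [Path.bracketCount] using hb ν hν⟩
  | var y t ih =>
    obtain ⟨b, hb⟩ := ih fun x hx => h x (by simp [hx])
    obtain ⟨b', hb'⟩ := h y (by simp)
    refine ⟨b' + b, fun ν hν => ?_⟩
    rw [PathExpr.eval_cons, Path.bracketCount_append]
    exact Nat.add_le_add (by simpa using hb' ν hν) (hb ν hν)
  | pack p t ihp iht =>
    obtain ⟨b, hb⟩ := ihp fun x hx => h x (by simp [hx])
    obtain ⟨b', hb'⟩ := iht fun x hx => h x (by simp [hx])
    refine ⟨b + 2 + b', fun ν hν => ?_⟩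
    rw [PathExpr.eval_cons, Path.bracketCount_append, Item.eval_pack, Path.bracketCount_pack]
    have := hb ν hν
    have := hb' ν hν
    omega

/-- If the facts that match the positive body predicates have a bounded number of brackets, then so
do the values of the limited variables. -/
theorem Rule.Limited.exists_bracketCount_le {r : Rule dom} {N : Set (Valuation dom)}
    (hpred : ∀ P, Literal.pos (Atom.pred P) ∈ r.body → ∀ i, ∃ b, ∀ ν ∈ N,
      Path.bracketCount (PathExpr.eval ν (P.args i)) ≤ b)
    (heq : ∀ e₁ e₂, Literal.pos (Atom.eq e₁ e₂) ∈ r.body → ∀ ν ∈ N,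
      PathExpr.eval ν e₁ = PathExpr.eval ν e₂) {x : Var} (hx : r.Limited x) :
    ∃ b, ∀ ν ∈ N, Path.bracketCount (ν.val x) ≤ b := by
  have := Rule.Limited.small (r := r) (N := N)
    (Small := fun A => ∃ b, ∀ p ∈ A, Path.bracketCount p ≤ b) ?_ heq ?_ ?_ hx
  · simpa using this
  · rintro P hP _ ⟨i, rfl⟩
    simpa using hpred P hP i
  · rintro e _ x hx ⟨b, hb⟩
    refine ⟨b, ?_⟩
    rintro _ ⟨ν, hν, rfl⟩
    exact (bracketCount_val_le hx ν).trans (hb _ ⟨ν, hν, rfl⟩)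
  · intro e _ h
    simpa using exists_bracketCount_eval_le (N := N) (e := e) (by simpa using h)

/-! ### Strata -/

/-- No name that is negated in the stratum is in the head of one of its rules. -/
def Stratum.NegDisjoint (s : Stratum dom) : Prop :=
  ∀ r ∈ s, ∀ P : Pred dom, Literal.neg (Atom.pred P) ∈ r.body → ∀ r' ∈ s, r'.head.rel ≠ P.rel

theorem Stratified.negDisjoint {ss : List (Stratum dom)} (h : Stratified ss) :
    ∀ s ∈ ss, Stratum.NegDisjoint s := by
  induction ss with
  | nil => simp
  | cons s ss ih =>
    intro s' hs'
    rcases List.mem_cons.1 hs' with rfl | hs'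
    · exact fun r hr P hP r' hr' => h.1 r hr P hP s' (by simp) r' hr'
    · exact ih h.2 s' hs'

theorem Pred.eval_rel (P : Pred dom) (ν : Valuation dom) : (P.eval ν).rel = P.rel := rfl

/-- Satisfaction of a body passes to larger instances that differ only on names in heads. -/
theorem Stratum.NegDisjoint.sat_mono {s : Stratum dom} (hs : s.NegDisjoint) {K J : Set (Fact dom)}
    (hKJ : K ⊆ J) (hJ : ∀ f ∈ J, (∀ r ∈ s, r.head.rel ≠ f.rel) → f ∈ K) {r : Rule dom}
    (hr : r ∈ s) {ν : Valuation dom} {L : Literal dom} (hL : L ∈ r.body) (h : L.Sat K ν) :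
    L.Sat J ν := by
  rcases L with (P | ⟨e₁, e₂⟩) | (P | ⟨e₁, e₂⟩)
  · exact hKJ h
  · exact h
  · exact fun h' => h (hJ _ h' fun r' hr' => hs r hr P hL r' hr')
  · exact h

/-- By minimality: a new fact that no rule instance derives could be removed from the result. -/
theorem StratumResult.supported {s : Stratum dom} (hs : s.NegDisjoint) {I J : Set (Fact dom)}
    (h : StratumResult s I J) {f : Fact dom} (hf : f ∈ J) (hfI : f ∉ I) :
    ∃ r ∈ s, ∃ ν : Valuation dom, (∀ L ∈ r.body, L.Sat J ν) ∧ r.head.eval ν = f := by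
  by_contra hcon
  push Not at hcon
  obtain ⟨⟨hfin, hIJ, hag, hsat⟩, hleast⟩ := h
  -- A new fact has a head name, and head names are not negated in the stratum; so bodies that hold
  -- after the removal of `f` already hold in `J`.
  have : J ⊆ J \ {f} := hleast ⟨hfin.sdiff, fun g hg => ⟨hIJ hg, by rintro rfl; exact hfI hg⟩,
    fun g hg => hag g hg.1, fun r hr ν hν => ?_⟩
  · exact (this hf).2 rfl
  · have hν' : ∀ L ∈ r.body, L.Sat J ν := fun L hL =>
      hs.sat_mono Set.sdiff_subset (fun g hg hg' => ⟨hg, by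
        rintro rfl
        exact hfI (hag g hg hg')⟩) hr hL (hν L hL)
    exact ⟨hsat r hr ν hν', hcon r hr ν hν'⟩

theorem StrataResult.subset {ss : List (Stratum dom)} : ∀ {I J : Set (Fact dom)},
    StrataResult ss I J → I ⊆ J := by
  induction ss with
  | nil => rintro I J rfl; exact subset_rfl
  | cons s ss ih => rintro I J ⟨K, hK, hJ⟩; exact hK.1.2.1.trans (ih hJ)

/-- Only the positive literals are recorded: they persist as later strata add facts, and they alone
limit variables. -/
theorem StrataResult.supported {ss : List (Stratum dom)} (hss : Stratified ss) :
    ∀ {I J : Set (Fact dom)}, StrataResult ss I J → ∀ f ∈ J, f ∈ I ∨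
      ∃ s ∈ ss, ∃ r ∈ s, ∃ ν : Valuation dom,
        (∀ A, Literal.pos A ∈ r.body → A.Sat J ν) ∧ r.head.eval ν = f := by
  induction ss with
  | nil => rintro I J rfl f hf; exact .inl hf
  | cons s ss ih =>
    rintro I J ⟨K, hK, hJ⟩ f hf
    rcases ih hss.2 hJ f hf with hfK | ⟨s', hs', h⟩
    · by_cases hfI : f ∈ I
      · exact .inl hfI
      · obtain ⟨r, hr, ν, hν, rfl⟩ := hK.supported (hss.negDisjoint s (by simp)) hfK hfI
        refine .inr ⟨s, by simp, r, hr, ν, fun A hA => ?_, rfl⟩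
        have := hν _ hA
        rcases A with P | ⟨e₁, e₂⟩
        · exact hJ.subset this
        · exact this
    · exact .inr ⟨s', by simp [hs'], h⟩

theorem StrataResult.rel_mem {ss : List (Stratum dom)} : ∀ {I J : Set (Fact dom)},
    StrataResult ss I J → ∀ f ∈ J, f ∈ I ∨ ∃ s ∈ ss, ∃ r ∈ s, r.head.rel = f.rel := by
  induction ss with
  | nil => rintro I J rfl f hf; exact .inl hf
  | cons s ss ih =>
    rintro I J ⟨K, hK, hJ⟩ f hf
    rcases ih hJ f hf with hfK | ⟨s', hs', h⟩
    · by_cases hfI : ∃ r ∈ s, r.head.rel = f.rel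
      · exact .inr ⟨s, by simp, hfI⟩
      · push Not at hfI
        exact .inl (hK.1.2.2.1 f hfK hfI)
    · exact .inr ⟨s', by simp [hs'], h⟩

theorem Program.Result.rel_mem {P : Program dom} {I J : Set (Fact dom)} (h : P.Result I J)
    {f : Fact dom} (hf : f ∈ J) : f ∈ I ∨ f.rel ∈ P.idb := by
  rcases StrataResult.rel_mem h f hf with h | ⟨s, hs, r, hr, h⟩
  · exact .inl h
  · exact .inr ⟨r, ⟨s, hs, hr⟩, h⟩

theorem Program.finite_rules (P : Program dom) : P.rules.Finite := by
  refine (List.finite_toSet P.strata.flatten).subset ?_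
  rintro r ⟨s, hs, hr⟩
  exact List.mem_flatten.2 ⟨s, hs, hr⟩

theorem Program.finite_idb (P : Program dom) : P.idb.Finite := by
  refine (P.finite_rules.image fun r => r.head.rel).subset ?_
  rintro R ⟨r, hr, rfl⟩
  exact ⟨r, hr, rfl⟩

theorem Program.safe_rule (P : Program dom) {r : Rule dom} (hr : r ∈ P.rules) : r.Safe := by
  obtain ⟨s, hs, hr⟩ := hr
  exact P.safe s hs r hr

/-! ### Facts and rules -/

theorem Fact.ext_getElem {f g : Fact dom} (h : f.rel = g.rel)
    (h' : ∀ k (hk : k < f.rel.arity) (hk' : k < g.rel.arity), f.args ⟨k, hk⟩ = g.args ⟨k, hk'⟩) :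
    f = g := by
  obtain ⟨R, x⟩ := f
  obtain ⟨R', x'⟩ := g
  obtain rfl : R = R' := h
  congr
  funext i
  exact h' i.1 i.2 i.2

theorem Fact.args_congr {f g : Fact dom} (h : f = g) (k : ℕ) (hk : k < f.rel.arity)
    (hk' : k < g.rel.arity) : f.args ⟨k, hk⟩ = g.args ⟨k, hk'⟩ := by
  subst h; rfl

/-- The variables of a rule. -/
def Rule.vars (r : Rule dom) : Set Var := {x | ∃ e ∈ r.exprs, x ∈ PathExpr.vars e}

theorem PathExpr.eval_eq_flatMap (ν : Valuation dom) (e : PathExpr dom) :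
    PathExpr.eval ν e = e.flatMap (Item.eval ν) := by
  induction e with
  | nil => simp
  | cons i e ih => simp [ih]

/-! ### Path expressions with variables of prescribed shape -/

/-- The word for a path variable whose value has the brackets `σ x`: its blocks are new path
variables. -/
def varTokens (σ : ℕ → List Bool) (x : ℕ) : List (Item dom ⊕ Bool) :=
  interleave (σ x)
    ((List.range ((σ x).length + 1)).map fun i => [Item.var (.path (Nat.pair x i))])

/-- The word for a path expression whose path variables `x` have values with brackets `σ x`. -/
def tokens (σ : ℕ → List Bool) : PathExpr dom → List (Item dom ⊕ Bool)
  | [] => []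
  | .const a :: t => .inl (.const a) :: tokens σ t
  | .var (.atomic x) :: t => .inl (.var (.atomic x)) :: tokens σ t
  | .var (.path x) :: t => varTokens σ x ++ tokens σ t
  | .pack p :: t => .inr true :: (tokens σ p ++ .inr false :: tokens σ t)

section Tokens

variable (σ : ℕ → List Bool)

@[simp] theorem tokens_nil : tokens σ ([] : PathExpr dom) = [] := by simp [tokens]
@[simp] theorem tokens_const (a : dom) (t) :
    tokens σ (.const a :: t) = .inl (.const a) :: tokens σ t := by simp [tokens]
@[simp] theorem tokens_atomic (x : ℕ) (t : PathExpr dom) :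
    tokens σ (.var (.atomic x) :: t) = .inl (.var (.atomic x)) :: tokens σ t := by simp [tokens]
@[simp] theorem tokens_path (x : ℕ) (t : PathExpr dom) :
    tokens σ (.var (.path x) :: t) = varTokens σ x ++ tokens σ t := by simp [tokens]
@[simp] theorem tokens_pack (p t : PathExpr dom) :
    tokens σ (.pack p :: t) = .inr true :: (tokens σ p ++ .inr false :: tokens σ t) := by
  simp [tokens]

theorem mem_varTokens {x : ℕ} {i : Item dom} (h : .inl i ∈ varTokens σ x) :
    ∃ k, i = .var (.path (Nat.pair x k)) := by
  obtain ⟨c, hc, hi⟩ := mem_interleave h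
  simp only [List.mem_map, List.mem_range] at hc
  obtain ⟨k, _, rfl⟩ := hc
  exact ⟨k, by simpa using hi⟩

theorem not_pack_of_mem_tokens (e : PathExpr dom) (e' : PathExpr dom) :
    Sum.inl (Item.pack e') ∉ tokens σ e := by
  induction e using PathExpr.induct with
  | nil => simp
  | const a t ih => simpa using ih
  | var x t ih =>
    cases x with
    | atomic x => simpa using ih
    | path x =>
      simp only [tokens_path, List.mem_append, not_or]
      refine ⟨fun h => ?_, ih⟩
      obtain ⟨k, hk⟩ := mem_varTokens σ h
      cases hk
  | pack p t ihp iht => simp [ihp, iht]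

theorem exists_var_of_mem_tokens {e : PathExpr dom} {x' : Var}
    (h : Sum.inl (Item.var x') ∈ tokens σ e) : ∃ x ∈ PathExpr.vars e,
      Sum.inl (Item.var x' : Item dom) ∈ tokens σ [Item.var x] := by
  induction e using PathExpr.induct with
  | nil => simp at h
  | const a t ih => simpa using ih (by simpa using h)
  | var x t ih =>
    have hx : tokens σ (Item.var x :: t) = tokens σ [Item.var x] ++ tokens σ t := by
      cases x <;> simp
    rw [hx] at h
    rcases List.mem_append.1 h with h | h
    · exact ⟨x, by simp, h⟩
    · obtain ⟨y, hy, h⟩ := ih h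
      exact ⟨y, by simp [hy], h⟩
  | pack p t ihp iht =>
    simp only [tokens_pack, List.mem_cons, reduceCtorEq, List.mem_append, false_or] at h
    rcases h with h | h
    · obtain ⟨y, hy, h⟩ := ihp h
      exact ⟨y, by simp [hy], h⟩
    · obtain ⟨y, hy, h⟩ := iht h
      exact ⟨y, by simp [hy], h⟩

theorem mem_tokens_of_mem_vars {e : PathExpr dom} {x x' : Var} (hx : x ∈ PathExpr.vars e)
    (h : Sum.inl (Item.var x' : Item dom) ∈ tokens σ [Item.var x]) :
    Sum.inl (Item.var x') ∈ tokens σ e := by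
  induction e using PathExpr.induct with
  | nil => simp at hx
  | const a t ih => simpa using ih (by simpa using hx)
  | var y t ih =>
    have hy : tokens σ (Item.var y :: t) = tokens σ [Item.var y] ++ tokens σ t := by
      cases y <;> simp
    rw [hy]
    rw [PathExpr.vars_cons] at hx
    rcases hx with hx | hx
    · obtain rfl : x = y := by simpa using hx
      exact List.mem_append_left _ h
    · exact List.mem_append_right _ (ih hx)
  | pack p t ihp iht =>
    rw [PathExpr.vars_cons] at hx
    rcases hx with hx | hx
    · simp [ihp (by simpa using hx)]
    · simp [iht hx]

theorem mem_vars_iff_of_not_hasPack {e : PathExpr dom} (he : ¬ PathExpr.HasPack e) {x : Var} :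
    x ∈ PathExpr.vars e ↔ Item.var x ∈ e := by
  refine ⟨fun h => ?_, fun h => PathExpr.mem_vars_of_mem h (by simp)⟩
  induction e with
  | nil => simp at h
  | cons i e ih =>
    have he' : ¬ PathExpr.HasPack e := fun ⟨e', h⟩ => he ⟨e', by simp [h]⟩
    rw [PathExpr.vars_cons] at h
    rcases h with h | h
    · cases i with
      | const a => simp at h
      | var y =>
        obtain rfl : x = y := by simpa using h
        simp
      | pack e' => exact absurd ⟨e', by simp⟩ he
    · exact List.mem_cons_of_mem _ (ih he' h)

theorem not_hasPack_of_mem_blocks {e c : PathExpr dom} (hc : c ∈ blocks (tokens σ e)) :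
    ¬ PathExpr.HasPack c := fun ⟨e', h⟩ =>
  not_pack_of_mem_tokens σ e e' (mem_blocks.1 ⟨c, hc, h⟩)

theorem not_hasPack_letters (e : PathExpr dom) :
    ¬ PathExpr.HasPack (letters (tokens σ e)) := fun ⟨e', h⟩ =>
  not_pack_of_mem_tokens σ e e' (mem_letters.1 h)

theorem mem_vars_letters {e : PathExpr dom} {x : Var} :
    x ∈ PathExpr.vars (letters (tokens σ e)) ↔ Sum.inl (Item.var x) ∈ tokens σ e := by
  rw [mem_vars_iff_of_not_hasPack (not_hasPack_letters σ e), mem_letters]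

/-- The blocks of a path expression, coded as one path expression. -/
def blocksExpr (a b : dom) (e : PathExpr dom) : PathExpr dom :=
  tupleExpr a b (blocks (tokens σ e))

theorem mem_vars_blocksExpr (a b : dom) {e : PathExpr dom} {x : Var} :
    x ∈ PathExpr.vars (blocksExpr σ a b e) ↔ Sum.inl (Item.var x) ∈ tokens σ e := by
  rw [blocksExpr, mem_vars_tupleExpr, ← mem_blocks]
  exact exists_congr fun c => and_congr_right fun hc =>
    mem_vars_iff_of_not_hasPack (not_hasPack_of_mem_blocks σ hc)

theorem not_hasPack_blocksExpr (a b : dom) (e : PathExpr dom) :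
    ¬ PathExpr.HasPack (blocksExpr σ a b e) :=
  not_hasPack_tupleExpr a b fun _ hc => not_hasPack_of_mem_blocks σ hc

/-- On the variables in `X`, the valuation `ν'` assigns to the new variables the blocks of the
values of the old ones under `ν`, and the brackets of these values are given by `σ`. -/
def Matches (X : Set Var) (ν ν' : Valuation dom) : Prop :=
  ν.atomic = ν'.atomic ∧ ∀ x, Var.path x ∈ X →
    Path.word (ν.path x) = substLetters (Item.eval ν') (varTokens σ x)

variable {σ}

/-- Packing in the expression has become fixed bracket tokens, which substitution leaves alone; all
that depends on the valuation is the content of the blocks. -/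
theorem Matches.word_eval {X : Set Var} {ν ν' : Valuation dom} (h : Matches σ X ν ν')
    {e : PathExpr dom} (he : PathExpr.vars e ⊆ X) :
    Path.word (PathExpr.eval ν e) = substLetters (Item.eval ν') (tokens σ e) := by
  induction e using PathExpr.induct with
  | nil => simp
  | const a t ih => simpa using ih (by simpa using he)
  | var x t ih =>
    rw [PathExpr.vars_cons, Set.union_subset_iff] at he
    cases x with
    | atomic x => simp [ih he.2, Valuation.val, h.1]
    | path x => simp [ih he.2, Valuation.val, h.2 x (he.1 (by simp))]
  | pack p t ihp iht =>
    rw [PathExpr.vars_cons, Set.union_subset_iff] at he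
    simp [ihp (by simpa using he.1), iht he.2]

/-- The new variable `Nat.pair x i` receives block number `i` of the value of `x`. The default `[]`
is only used for indices beyond the last block, which do not occur in `varTokens`. -/
theorem exists_matches (X : Set Var) (ν : Valuation dom)
    (hσ : ∀ x, Var.path x ∈ X → σ x = brackets (Path.word (ν.path x))) :
    ∃ ν', Matches σ X ν ν' := by
  refine ⟨⟨ν.atomic, fun n =>
    (blocks (Path.word (ν.path n.unpair.1))).getD n.unpair.2 []⟩, rfl, fun x hx => ?_⟩
  rw [varTokens, substLetters_interleave]
  conv_lhs => rw [← interleave_blocks (Path.word (ν.path x)), ← hσ x hx]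
  congr 1
  apply List.ext_getElem
  · simp [hσ x hx]
  · intro i h₁ h₂
    simp [Valuation.val, List.getElem?_eq_getElem h₁]

/-- Filling a balanced shape with flat blocks gives the word of a path. Balance is imposed when a
rule is selected; flatness of the blocks will come from limitedness over a flat instance. -/
theorem exists_matches_symm {X : Set Var} {ν' : Valuation dom}
    (hσ : ∀ x, Var.path x ∈ X → Balanced 0 (σ x))
    (hν : ∀ x, Var.path x ∈ X → ∀ i : Item dom, .inl i ∈ varTokens σ x →
      IsFlatPath (Item.eval ν' i)) :
    ∃ ν, Matches σ X ν ν' := by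
  have key : ∀ x, ∃ p : Path dom, Var.path x ∈ X →
      Path.word p = substLetters (Item.eval ν') (varTokens σ x) := fun x => by
    by_cases hx : Var.path x ∈ X
    · obtain ⟨p, hp⟩ := exists_word_of_balanced (dom := dom)
        (t := substLetters (Item.eval ν') (varTokens σ x)) (fun v hv => by
          simp only [substLetters, List.mem_flatMap] at hv
          obtain ⟨i | b, hi, h⟩ := hv
          · exact hν x hx i hi v (by simpa using h)
          · simp at h) (by
          rw [brackets_substLetters, varTokens, brackets_interleave _ _ (by simp)]
          exact hσ x hx)
      exact ⟨p, fun _ => hp⟩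
    · exact ⟨[], fun h => absurd h hx⟩
  choose p hp using key
  exact ⟨⟨ν'.atomic, p⟩, rfl, fun x hx => hp x hx⟩

end Tokens

/-! ### Translation by shapes -/

/-- The data of the translation: two distinct atomic values for coding tuples, the monadic relation
names that are kept for flat facts, a bound on their identifiers, the shapes of facts that are taken
into account, and the assignments of shapes to variables that are taken into account. -/
structure ShapeContext (dom : Type u) where
  a : dom
  b : dom
  ne : a ≠ b
  keep : Schema
  monadic : keep.Monadic
  bound : ℕ
  lt_bound : ∀ R ∈ keep, R.id < bound
  avail : Set (RelName × List (List Bool))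
  assignments : Set (ℕ → List Bool)
  finite_assignments : assignments.Finite

namespace ShapeContext

variable (c : ShapeContext dom)

/-- The name is kept for the given shapes. -/
def Kept (R : RelName) (bs : List (List Bool)) : Prop := R ∈ c.keep ∧ ∀ β ∈ bs, β = []

open Classical in
/-- The name for facts with relation name `R` and shapes `bs`. -/
noncomputable def name (R : RelName) (bs : List (List Bool)) : RelName :=
  if c.Kept R bs then R else ⟨c.bound + Encodable.encode (R.id, R.arity, bs), 1⟩

open Classical in
/-- The arguments of translated facts and predicates. -/
noncomputable def args {α : Type*} (A B : α) (R : RelName) (ts : Fin R.arity → List (α ⊕ Bool))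
    (k : ℕ) : List α :=
  if c.Kept R (List.ofFn fun i => brackets (ts i)) then
    if h : k < R.arity then letters (ts ⟨k, h⟩) else []
  else tupleCode A B (List.ofFn fun i => tupleCode A B (blocks (ts i)))

/-- The shapes of the arguments of a fact. -/
def factShape (f : Fact dom) : List (List Bool) :=
  List.ofFn fun i => brackets (Path.word (f.args i))

/-- The shapes of the arguments of a predicate. -/
def predShape (σ : ℕ → List Bool) (P : Pred dom) : List (List Bool) :=
  List.ofFn fun i => brackets (tokens σ (P.args i))

/-- Translation of facts. -/
noncomputable def fact (f : Fact dom) : Fact dom :=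
  ⟨c.name f.rel (factShape f), fun i =>
    c.args (Value.atom c.a) (Value.atom c.b) f.rel (fun j => Path.word (f.args j)) i⟩

/-- Translation of predicates. -/
noncomputable def pred (σ : ℕ → List Bool) (P : Pred dom) : Pred dom :=
  ⟨c.name P.rel (predShape σ P), fun i =>
    c.args (Item.const c.a) (Item.const c.b) P.rel (fun j => tokens σ (P.args j)) i⟩

/-- The shape of the fact is taken into account. -/
def Avail (f : Fact dom) : Prop := (f.rel, factShape f) ∈ c.avail

/-- The literal can be satisfied by valuations of shape `σ`. -/
def LitOk (σ : ℕ → List Bool) : Literal dom → Prop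
  | .pos (.pred P) => (P.rel, predShape σ P) ∈ c.avail
  | .pos (.eq e₁ e₂) => brackets (tokens σ e₁) = brackets (tokens σ e₂)
  | .neg _ => True

open Classical in
/-- Translation of literals. -/
noncomputable def lits (σ : ℕ → List Bool) : Literal dom → List (Literal dom)
  | .pos (.pred P) => [.pos (.pred (c.pred σ P))]
  | .pos (.eq e₁ e₂) => [.pos (.eq (blocksExpr σ c.a c.b e₁) (blocksExpr σ c.a c.b e₂))]
  | .neg (.pred P) =>
      if (P.rel, predShape σ P) ∈ c.avail then [.neg (.pred (c.pred σ P))] else []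
  | .neg (.eq e₁ e₂) =>
      if brackets (tokens σ e₁) = brackets (tokens σ e₂) then
        [.neg (.eq (blocksExpr σ c.a c.b e₁) (blocksExpr σ c.a c.b e₂))] else []

/-- Translation of rules. -/
noncomputable def rule (σ : ℕ → List Bool) (r : Rule dom) : Rule dom :=
  ⟨c.pred σ r.head, r.body.flatMap (c.lits σ)⟩

/-- The rule can be applied with valuations of shape `σ`. -/
def RuleOk (σ : ℕ → List Bool) (r : Rule dom) : Prop :=
  (∀ x, Var.path x ∈ r.vars → Balanced 0 (σ x)) ∧ (r.head.rel, predShape σ r.head) ∈ c.avail ∧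
    ∀ L ∈ r.body, c.LitOk σ L

theorem finite_rules (s : Stratum dom) :
    {r' | ∃ r ∈ s, ∃ σ ∈ c.assignments, c.RuleOk σ r ∧ c.rule σ r = r'}.Finite := by
  refine (Set.Finite.image2 (fun r σ => c.rule σ r) (List.finite_toSet s)
    c.finite_assignments).subset ?_
  rintro _ ⟨r, hr, σ, hσ, _, rfl⟩
  exact ⟨r, hr, σ, hσ, rfl⟩

/-- Translation of strata. -/
noncomputable def stratum (s : Stratum dom) : Stratum dom := (c.finite_rules s).toFinset.toList

theorem mem_stratum {s : Stratum dom} {r' : Rule dom} : r' ∈ c.stratum s ↔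
    ∃ r ∈ s, ∃ σ ∈ c.assignments, c.RuleOk σ r ∧ c.rule σ r = r' := by
  simp [stratum]

-- Injectivity and flatness of the shape translation of facts

theorem length_factShape (f : Fact dom) : (factShape f).length = f.rel.arity := by
  simp [factShape]

theorem length_predShape (σ) (P : Pred dom) : (predShape σ P).length = P.rel.arity := by
  simp [predShape]

/-- Kept names have identifiers below the bound, all others from the bound on, and the latter encode
name and shape injectively. For a kept name all shapes are empty, so only their number remains,
which the arity supplies. -/
theorem name_inj {R R' : RelName} {bs bs' : List (List Bool)} (h : c.name R bs = c.name R' bs')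
    (hl : bs.length = R.arity) (hl' : bs'.length = R'.arity) : R = R' ∧ bs = bs' := by
  unfold name at h
  split_ifs at h with h₁ h₂ h₂
  · subst h
    refine ⟨rfl, ?_⟩
    rw [List.eq_replicate_of_mem h₁.2, List.eq_replicate_of_mem h₂.2, hl, hl']
  · have := c.lt_bound _ h₁.1
    rw [h] at this
    simp at this
  · have := c.lt_bound _ h₂.1
    rw [← h] at this
    simp at this
  · have := congrArg RelName.id h
    simp only [Nat.add_left_cancel_iff, Encodable.encode_inj, Prod.mk.injEq] at this
    obtain ⟨R, n⟩ := R
    obtain ⟨R', n'⟩ := R'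
    simp_all

theorem arity_name (R : RelName) (bs : List (List Bool)) : (c.name R bs).arity ≤ 1 := by
  unfold name
  split_ifs with h
  · exact c.monadic R h.1
  · simp

/-- The name returns relation and shape; with the shape known, the tuple codes have known lengths
and can be decoded to the blocks, hence to the words of the arguments. -/
theorem fact_injective : Function.Injective c.fact := by
  intro f g h
  have hn : c.name f.rel (factShape f) = c.name g.rel (factShape g) := congrArg Fact.rel h
  obtain ⟨hR, hs⟩ := c.name_inj hn (length_factShape f) (length_factShape g)
  obtain ⟨R, x⟩ := f
  obtain ⟨R', y⟩ := g
  obtain rfl : R = R' := hR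
  have hs' : ∀ i, brackets (Path.word (x i)) = brackets (Path.word (y i)) :=
    fun i => congrFun (List.ofFn_injective hs) i
  congr
  funext i
  apply Path.word_injective
  have ha := Fact.args_congr h
  simp only [fact, args] at ha
  by_cases hk : c.Kept R (factShape ⟨R, x⟩)
  · have hk' := hk
    rw [hs] at hk'
    have := ha i (by simp [name, hk]) (by simp [name, hk'])
    simp only [factShape] at hk hk'
    simp only [hk, hk', if_true, i.2, dif_pos] at this
    have h₁ : brackets (Path.word (x i)) = [] := hk.2 _ (by simp)
    have h₂ : brackets (Path.word (y i)) = [] := hk'.2 _ (by simp)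
    rw [← Path.isFlatPath_iff] at h₁ h₂
    rw [Path.word_of_isFlatPath h₁, Path.word_of_isFlatPath h₂, letters_map_inl,
      letters_map_inl] at this
    rw [this]
  · have hk' := hk
    rw [hs] at hk'
    have := ha 0 (by simp [name, hk]) (by simp [name, hk'])
    simp only [factShape] at hk hk'
    simp only [hk, hk', if_false] at this
    have hne : Value.atom c.a ≠ Value.atom c.b := fun h => c.ne (Value.atom.inj h)
    have := congrFun (List.ofFn_injective (tupleCode_inj hne (by simp) this)) i
    have := tupleCode_inj hne (by simp [hs' i]) this
    rw [← interleave_blocks (Path.word (x i)), this, hs', interleave_blocks]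

/-- Input and output facts are flat with kept names, so the translation fixes them and no coding or
decoding of the interface is needed. -/
theorem fact_of_kept {f : Fact dom} (h : f.rel ∈ c.keep) (hf : ∀ i, IsFlatPath (f.args i)) :
    c.fact f = f := by
  have hk : c.Kept f.rel (factShape f) := by
    refine ⟨h, ?_⟩
    simp only [factShape, List.mem_ofFn, forall_exists_index, forall_apply_eq_imp_iff]
    exact fun i => (Path.isFlatPath_iff _).1 (hf i)
  refine Fact.ext_getElem (by simp [fact, name, hk]) fun k hk₁ hk₂ => ?_
  simp only [factShape] at hk
  simp only [fact, args, hk, if_true, hk₂, dif_pos]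
  rw [Path.word_of_isFlatPath (hf _), letters_map_inl]

theorem isFlatPath_fact (f : Fact dom) (i) : IsFlatPath ((c.fact f).args i) := by
  simp only [fact, args]
  split_ifs with h₁ h₂
  · intro v hv
    exact Path.atom_of_mem_word _ v (mem_letters.1 hv)
  · intro v hv
    simp at hv
  · refine isFlatPath_tuplePath _ _ fun p hp => ?_
    simp only [List.mem_ofFn] at hp
    obtain ⟨j, rfl⟩ := hp
    refine isFlatPath_tuplePath _ _ fun q hq v hv => ?_
    exact Path.atom_of_mem_word _ v (mem_blocks.1 ⟨q, hq, hv⟩)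

-- Predicates, literals and rules under matching valuations

variable {σ : ℕ → List Bool} {X : Set Var} {ν ν' : Valuation dom}

theorem factShape_eval (h : Matches σ X ν ν') {P : Pred dom}
    (hP : ∀ i, PathExpr.vars (P.args i) ⊆ X) : factShape (P.eval ν) = predShape σ P := by
  simp only [factShape, predShape]
  congr 1
  funext i
  exact (congrArg brackets (h.word_eval (hP i))).trans (brackets_substLetters _ _)

theorem eval_blocksExpr (a b : dom) (e : PathExpr dom) :
    PathExpr.eval ν' (blocksExpr σ a b e) =
      tuplePath a b (blocks (substLetters (Item.eval ν') (tokens σ e))) := by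
  rw [blocksExpr, eval_tupleExpr, blocks_substLetters]
  congr 1
  exact List.map_congr_left fun e _ => PathExpr.eval_eq_flatMap ν' e

theorem eval_pred (h : Matches σ X ν ν') {P : Pred dom}
    (hP : ∀ i, PathExpr.vars (P.args i) ⊆ X) : (c.pred σ P).eval ν' = c.fact (P.eval ν) := by
  have hs := factShape_eval h hP
  refine Fact.ext_getElem (by simp [Pred.eval_rel, fact, pred, hs]) fun k hk₁ hk₂ => ?_
  have hw : ∀ i, Path.word ((P.eval ν).args i) = _ := fun i => h.word_eval (hP i)
  simp only [Pred.eval, pred, fact, args]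
  by_cases hk : c.Kept P.rel (predShape σ P)
  · have hk' : c.Kept (P.eval ν).rel (factShape (P.eval ν)) := by rw [hs]; exact hk
    have hk₃ : k < P.rel.arity := by
      simp only [fact, name, hk', if_true] at hk₂
      exact hk₂
    simp only [factShape, predShape] at hk hk'
    simp only [Pred.eval] at hk'
    simp only [hk, hk', if_true, hk₃, dif_pos]
    rw [PathExpr.eval_eq_flatMap, ← letters_substLetters]
    exact congrArg letters (hw _).symm
  · have hk' : ¬ c.Kept (P.eval ν).rel (factShape (P.eval ν)) := by rw [hs]; exact hk
    simp only [factShape, predShape] at hk hk'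
    simp only [Pred.eval] at hk'
    simp only [hk, hk', if_false]
    rw [eval_tupleExpr, List.map_ofFn]
    congr 2
    funext i
    exact (eval_blocksExpr c.a c.b (P.args i)).trans
      (congrArg (fun t => tuplePath c.a c.b (blocks t)) (hw i).symm)

/-- Comparing the coded tuples of blocks replaces a conjunction of block equations by one equation.
Therefore a negated equation does not turn into a disjunction. -/
theorem eval_blocksExpr_inj (h : Matches σ X ν ν') {e₁ e₂ : PathExpr dom}
    (h₁ : PathExpr.vars e₁ ⊆ X) (h₂ : PathExpr.vars e₂ ⊆ X) :
    PathExpr.eval ν e₁ = PathExpr.eval ν e₂ ↔ brackets (tokens σ e₁) = brackets (tokens σ e₂) ∧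
      PathExpr.eval ν' (blocksExpr σ c.a c.b e₁) = PathExpr.eval ν' (blocksExpr σ c.a c.b e₂) := by
  rw [eval_blocksExpr, eval_blocksExpr, ← Path.word_injective.eq_iff, h.word_eval h₁,
    h.word_eval h₂]
  have hne : Value.atom c.a ≠ Value.atom c.b := fun h => c.ne (Value.atom.inj h)
  constructor
  · intro h'
    refine ⟨?_, by rw [h']⟩
    simpa using congrArg brackets h'
  · rintro ⟨h₃, h₄⟩
    have := tupleCode_inj hne (by simp [h₃]) h₄
    rw [← interleave_blocks (substLetters _ (tokens σ e₁)), this, brackets_substLetters, h₃,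
      ← brackets_substLetters (Item.eval ν'), interleave_blocks]

/-- The variables of an atom are in `X`. -/
def VarsIn (X : Set Var) (A : Atom dom) : Prop := ∀ e ∈ A.exprs, PathExpr.vars e ⊆ X

/-- A positive literal of impossible shape disqualifies the copy of the rule through `LitOk`,
whereas a negated one is automatically true and is dropped by `lits`. -/
theorem sat_iff (h : Matches σ X ν ν') {K K' : Set (Fact dom)} {L : Literal dom}
    (hL : VarsIn X L.atom)
    (hK : ∀ P, L.atom = .pred P → (P.eval ν ∈ K ↔ c.Avail (P.eval ν) ∧ c.fact (P.eval ν) ∈ K')) :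
    L.Sat K ν ↔ c.LitOk σ L ∧ ∀ L' ∈ c.lits σ L, L'.Sat K' ν' := by
  rcases L with (P | ⟨e₁, e₂⟩) | (P | ⟨e₁, e₂⟩)
  · have hP : ∀ i, PathExpr.vars (P.args i) ⊆ X := fun i => hL _ ⟨i, rfl⟩
    have := hK P rfl
    rw [Avail, factShape_eval h hP, ← c.eval_pred h hP, Pred.eval_rel] at this
    simpa [LitOk, lits, Literal.Sat, Atom.Sat] using this
  · have := c.eval_blocksExpr_inj h (hL e₁ (by simp [Literal.atom, Atom.exprs]))
      (hL e₂ (by simp [Literal.atom, Atom.exprs]))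
    simpa [LitOk, lits, Literal.Sat, Atom.Sat] using this
  · have hP : ∀ i, PathExpr.vars (P.args i) ⊆ X := fun i => hL _ ⟨i, rfl⟩
    have := hK P rfl
    rw [Avail, factShape_eval h hP, ← c.eval_pred h hP, Pred.eval_rel] at this
    by_cases h' : (P.rel, predShape σ P) ∈ c.avail <;>
      simp [LitOk, lits, Literal.Sat, Atom.Sat, this, h']
  · have := c.eval_blocksExpr_inj h (hL e₁ (by simp [Literal.atom, Atom.exprs]))
      (hL e₂ (by simp [Literal.atom, Atom.exprs]))
    by_cases h' : brackets (tokens σ e₁) = brackets (tokens σ e₂) <;>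
      simp [LitOk, lits, Literal.Sat, Atom.Sat, this, h']

theorem mem_vars_pred_exprs {P : Pred dom} {x : Var} :
    (∃ e ∈ (c.pred σ P).exprs, x ∈ PathExpr.vars e) ↔
      ∃ e ∈ P.exprs, Sum.inl (Item.var x) ∈ tokens σ e := by
  have hblock : x ∈ PathExpr.vars (tupleExpr c.a c.b
      (List.ofFn fun i => blocksExpr σ c.a c.b (P.args i))) ↔
      ∃ e ∈ P.exprs, Sum.inl (Item.var x) ∈ tokens σ e := by
    simp [mem_vars_tupleExpr, mem_vars_blocksExpr, Pred.exprs]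
  by_cases hk : c.Kept P.rel (predShape σ P)
  · have har : (c.pred σ P).rel.arity = P.rel.arity := by simp [pred, name, hk]
    simp only [predShape] at hk
    constructor
    · rintro ⟨_, ⟨i, rfl⟩, hx⟩
      simp only [pred, args, hk, if_true] at hx
      rw [dif_pos (i.2.trans_eq har)] at hx
      exact ⟨_, ⟨_, rfl⟩, (mem_vars_letters σ).1 hx⟩
    · rintro ⟨_, ⟨i, rfl⟩, hx⟩
      refine ⟨_, ⟨⟨i, i.2.trans_eq har.symm⟩, rfl⟩, ?_⟩
      simp only [pred, args, hk, if_true]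
      rw [dif_pos i.2]
      exact (mem_vars_letters σ).2 hx
  · have har : (c.pred σ P).rel.arity = 1 := by simp [pred, name, hk]
    simp only [predShape] at hk
    rw [← hblock]
    constructor
    · rintro ⟨_, ⟨i, rfl⟩, hx⟩
      simp only [pred, args, hk, if_false] at hx
      exact hx
    · intro hx
      refine ⟨_, ⟨⟨0, by rw [har]; omega⟩, rfl⟩, ?_⟩
      simp only [pred, args, hk, if_false]
      exact hx

theorem not_hasPack_pred {P : Pred dom} : ∀ e ∈ (c.pred σ P).exprs, ¬ PathExpr.HasPack e := by
  rintro _ ⟨i, rfl⟩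
  simp only [pred, args]
  split_ifs with h₁ h₂
  · exact not_hasPack_letters σ _
  · rintro ⟨e', h⟩; simp at h
  · refine not_hasPack_tupleExpr _ _ fun e he => ?_
    simp only [List.mem_ofFn] at he
    obtain ⟨j, rfl⟩ := he
    exact not_hasPack_blocksExpr σ c.a c.b _

theorem mem_lits {L L' : Literal dom} (h : L' ∈ c.lits σ L) :
    (∃ P, L = .pos (.pred P) ∧ (L' = .pos (.pred (c.pred σ P)))) ∨
    (∃ e₁ e₂, L = .pos (.eq e₁ e₂) ∧
      L' = .pos (.eq (blocksExpr σ c.a c.b e₁) (blocksExpr σ c.a c.b e₂))) ∨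
    (∃ P, L = .neg (.pred P) ∧ (P.rel, predShape σ P) ∈ c.avail ∧
      (L' = .neg (.pred (c.pred σ P)))) ∨
    (∃ e₁ e₂, L = .neg (.eq e₁ e₂) ∧
      L' = .neg (.eq (blocksExpr σ c.a c.b e₁) (blocksExpr σ c.a c.b e₂))) := by
  rcases L with (P | ⟨e₁, e₂⟩) | (P | ⟨e₁, e₂⟩)
  · simpa [lits] using h
  · simpa [lits] using h
  · simp only [lits] at h
    split_ifs at h with h'
    · simp_all
    · simp at h
  · simp only [lits] at h
    split_ifs at h with h'
    · simp_all
    · simp at h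

theorem rule_exprs {r : Rule dom} {e' : PathExpr dom} (he' : e' ∈ (c.rule σ r).exprs) :
    ¬ PathExpr.HasPack e' ∧ ∀ x ∈ PathExpr.vars e', ∃ e ∈ r.exprs,
      Sum.inl (Item.var x) ∈ tokens σ e := by
  rcases he' with he' | ⟨L', hL', he'⟩
  · refine ⟨c.not_hasPack_pred e' he', fun x hx => ?_⟩
    obtain ⟨e, he, h⟩ := c.mem_vars_pred_exprs.1 ⟨e', he', hx⟩
    exact ⟨e, .inl he, h⟩
  · obtain ⟨L, hL, h⟩ := List.mem_flatMap.1 hL'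
    have heq : ∀ e₁ e₂, L.atom = .eq e₁ e₂ →
        L'.atom = .eq (blocksExpr σ c.a c.b e₁) (blocksExpr σ c.a c.b e₂) →
        ¬ PathExpr.HasPack e' ∧ ∀ x ∈ PathExpr.vars e', ∃ e ∈ r.exprs,
          Sum.inl (Item.var x) ∈ tokens σ e := by
      intro e₁ e₂ h₁ h₂
      simp only [h₂, Atom.exprs, Set.mem_insert_iff, Set.mem_singleton_iff] at he'
      rcases he' with rfl | rfl
      · exact ⟨not_hasPack_blocksExpr σ _ _ _, fun x hx =>
          ⟨e₁, .inr ⟨L, hL, by simp [h₁, Atom.exprs]⟩, (mem_vars_blocksExpr σ _ _).1 hx⟩⟩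
      · exact ⟨not_hasPack_blocksExpr σ _ _ _, fun x hx =>
          ⟨e₂, .inr ⟨L, hL, by simp [h₁, Atom.exprs]⟩, (mem_vars_blocksExpr σ _ _).1 hx⟩⟩
    have hpred : ∀ P, L.atom = .pred P → L'.atom = .pred (c.pred σ P) →
        ¬ PathExpr.HasPack e' ∧ ∀ x ∈ PathExpr.vars e', ∃ e ∈ r.exprs,
          Sum.inl (Item.var x) ∈ tokens σ e := by
      intro P h₁ h₂
      simp only [h₂, Atom.exprs] at he'
      refine ⟨c.not_hasPack_pred e' he', fun x hx => ?_⟩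
      obtain ⟨e, he, h⟩ := c.mem_vars_pred_exprs.1 ⟨e', he', hx⟩
      exact ⟨e, .inr ⟨L, hL, by simpa [h₁, Atom.exprs] using he⟩, h⟩
    rcases c.mem_lits h with ⟨P, rfl, rfl⟩ | ⟨e₁, e₂, rfl, rfl⟩ | ⟨P, rfl, _, rfl⟩ |
      ⟨e₁, e₂, rfl, rfl⟩
    · exact hpred P rfl rfl
    · exact heq e₁ e₂ rfl rfl
    · exact hpred P rfl rfl
    · exact heq e₁ e₂ rfl rfl

/-- All positive literals survive the translation and mention the same variables, split into blocks.
A derivation of limitedness can thus be repeated for all block variables at once. -/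
theorem limited_rule {r : Rule dom} {x : Var} (hx : r.Limited x) :
    ∀ x', Sum.inl (Item.var x' : Item dom) ∈ tokens σ [Item.var x] → (c.rule σ r).Limited x' := by
  induction hx with
  | pred P h e he x hx =>
    intro x' hx'
    obtain ⟨e', he', h'⟩ := c.mem_vars_pred_exprs.2 ⟨e, he, mem_tokens_of_mem_vars σ hx hx'⟩
    exact .pred (c.pred σ P) (List.mem_flatMap.2 ⟨_, h, by simp [lits]⟩) e' he' x' h'
  | eq_right e₁ e₂ h _ x hx ih =>
    intro x' hx'
    refine .eq_right _ _ (List.mem_flatMap.2 ⟨_, h, by simp only [lits, List.mem_singleton]; rfl⟩)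
      (fun y hy => ?_) x' ((mem_vars_blocksExpr σ _ _).2 (mem_tokens_of_mem_vars σ hx hx'))
    obtain ⟨z, hz, h'⟩ := exists_var_of_mem_tokens σ ((mem_vars_blocksExpr σ _ _).1 hy)
    exact ih z hz y h'
  | eq_left e₁ e₂ h _ x hx ih =>
    intro x' hx'
    refine .eq_left _ _ (List.mem_flatMap.2 ⟨_, h, by simp only [lits, List.mem_singleton]; rfl⟩)
      (fun y hy => ?_) x' ((mem_vars_blocksExpr σ _ _).2 (mem_tokens_of_mem_vars σ hx hx'))
    obtain ⟨z, hz, h'⟩ := exists_var_of_mem_tokens σ ((mem_vars_blocksExpr σ _ _).1 hy)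
    exact ih z hz y h'

theorem safe_rule {r : Rule dom} (hr : r.Safe) : (c.rule σ r).Safe := by
  intro e' he' x' hx'
  obtain ⟨e, he, h⟩ := (c.rule_exprs he').2 x' hx'
  obtain ⟨x, hx, h'⟩ := exists_var_of_mem_tokens σ h
  exact c.limited_rule (hr e he x hx) x' h'

theorem head_rel_of_mem_stratum {s : Stratum dom} {r' : Rule dom} (h : r' ∈ c.stratum s) :
    ∃ r ∈ s, ∃ bs, bs.length = r.head.rel.arity ∧ r'.head.rel = c.name r.head.rel bs := by
  obtain ⟨r, hr, σ, _, _, rfl⟩ := c.mem_stratum.1 h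
  exact ⟨r, hr, _, length_predShape σ r.head, rfl⟩

theorem varsIn_of_mem_body {r : Rule dom} {L : Literal dom} (hL : L ∈ r.body) :
    VarsIn r.vars L.atom := fun e he _ hx => ⟨e, Rule.mem_exprs_of_mem_body hL he, hx⟩

-- Correctness of the shape translation on strata and programs

/-- The translated stratum computes the translation of the result. -/
theorem stratumResult {s : Stratum dom} {I J : Set (Fact dom)} (hs : s.NegDisjoint)
    (hsafe : ∀ r ∈ s, r.Safe) (h : StratumResult s I J) (hJ : ∀ f ∈ J, c.Avail f)
    (hσ : ∀ r ∈ s, ∀ ν : Valuation dom, (∀ L ∈ r.body, L.Sat J ν) →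
      ∃ σ ∈ c.assignments, ∀ x, Var.path x ∈ r.vars → σ x = brackets (Path.word (ν.path x))) :
    StratumResult (c.stratum s) (c.fact '' I) (c.fact '' J) := by
  have hsupp := fun f hf hfI => h.supported hs (f := f) hf hfI
  obtain ⟨⟨hfin, hIJ, hag, hsat⟩, hleast⟩ := h
  have hvars : ∀ (r : Rule dom) i, PathExpr.vars (r.head.args i) ⊆ r.vars :=
    fun r i x hx => ⟨_, .inl ⟨i, rfl⟩, hx⟩
  -- Every valuation that fires a rule in `J` has an admitted shape, so it is simulated by one of
  -- the copies of that rule.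
  have hfwd : ∀ r ∈ s, ∀ ν : Valuation dom, (∀ L ∈ r.body, L.Sat J ν) → ∃ σ ∈ c.assignments,
      ∃ ν', Matches σ r.vars ν ν' ∧ (∀ x, Var.path x ∈ r.vars → Balanced 0 (σ x)) ∧
      (r.head.rel, predShape σ r.head) ∈ c.avail := by
    intro r hr ν hν
    obtain ⟨σ, hσ, hx⟩ := hσ r hr ν hν
    obtain ⟨ν', hm⟩ := exists_matches r.vars ν hx
    refine ⟨σ, hσ, ν', hm, fun x h => hx x h ▸ balanced_word _, ?_⟩
    rw [← factShape_eval hm (hvars r)]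
    exact hJ _ (hsat r hr ν hν)
  have hiff : ∀ P : Pred dom, ∀ ν : Valuation dom, (P.eval ν ∈ J ↔
      c.Avail (P.eval ν) ∧ c.fact (P.eval ν) ∈ c.fact '' J) := fun P ν =>
    ⟨fun h => ⟨hJ _ h, _, h, rfl⟩, fun ⟨_, h⟩ => (c.fact_injective.mem_set_image).1 h⟩
  refine ⟨⟨hfin.image _, Set.image_mono hIJ, ?_, ?_⟩, ?_⟩
  · rintro _ ⟨f, hf, rfl⟩ hhead
    by_contra hcon
    have hfI : f ∉ I := fun h => hcon ⟨f, h, rfl⟩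
    obtain ⟨r, hr, ν, hν, rfl⟩ := hsupp f hf hfI
    obtain ⟨σ, hσ, ν', hm, hbal, hav⟩ := hfwd r hr ν hν
    refine hhead (c.rule σ r) (c.mem_stratum.2 ⟨r, hr, σ, hσ, ⟨hbal, hav, fun L hL => ?_⟩, rfl⟩) ?_
    · exact ((c.sat_iff hm (varsIn_of_mem_body hL) fun P _ => hiff P ν).1 (hν L hL)).1
    · rw [← c.eval_pred hm (hvars r)]
      rfl
  · intro r' hr' ν' hν'
    obtain ⟨r, hr, σ, _, hok, rfl⟩ := c.mem_stratum.1 hr'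
    -- Going back to a valuation of the original rule needs flat blocks. Translated facts are flat
    -- and translated rules contain no packing, so limited variables take flat values.
    have hflat : IsFlat (c.fact '' J) := by
      rintro _ ⟨f, _, rfl⟩ i
      exact c.isFlatPath_fact f i
    have hflat' := fun x => Rule.Limited.isFlatPath (x := x) (fun e he => (c.rule_exprs he).1)
      hflat hν'
    obtain ⟨ν, hm⟩ := exists_matches_symm (X := r.vars) (ν' := ν') hok.1 (fun x hx i hi => by
      obtain ⟨k, rfl⟩ := mem_varTokens σ hi
      obtain ⟨e, he, hx⟩ := hx
      rw [Item.eval_var]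
      exact hflat' _ (c.limited_rule (hsafe r hr e he _ hx) _ (by simpa using hi)))
    have hν : ∀ L ∈ r.body, L.Sat J ν := fun L hL =>
      (c.sat_iff hm (varsIn_of_mem_body hL) fun P _ => hiff P ν).2
        ⟨hok.2.2 L hL, fun L' hL' => hν' L' (List.mem_flatMap.2 ⟨L, hL, hL'⟩)⟩
    exact ⟨_, hsat r hr ν hν, (c.eval_pred hm (hvars r)).symm⟩
  · rintro K' ⟨_, hIK, hagK, hsatK⟩
    -- Leastness of `J` is applied to the facts of `J` whose translations lie in the competing model
    -- `K'`.
    have hJK : J ⊆ {f ∈ J | c.fact f ∈ K'} := by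
      refine hleast ⟨hfin.subset (Set.sep_subset _ _), fun f hf => ⟨hIJ hf, hIK ⟨f, hf, rfl⟩⟩,
        fun f hf => hag f hf.1, fun r hr ν hν => ?_⟩
      have hνJ : ∀ L ∈ r.body, L.Sat J ν := fun L hL =>
        hs.sat_mono (Set.sep_subset _ _) (fun f hf hf' =>
          ⟨hf, hIK ⟨f, hag f hf hf', rfl⟩⟩) hr hL (hν L hL)
      obtain ⟨σ, hσ, ν', hm, hbal, hav⟩ := hfwd r hr ν hνJ
      have hall : ∀ L ∈ r.body, c.LitOk σ L ∧ ∀ L' ∈ c.lits σ L, L'.Sat K' ν' := fun L hL => by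
        refine (c.sat_iff hm (varsIn_of_mem_body hL) fun P hP => ?_).1 (hν L hL)
        refine ⟨fun h => ⟨hJ _ h.1, h.2⟩, fun h => ?_⟩
        rcases L with L | L
        · obtain rfl : L = .pred P := hP
          exact hν _ hL
        · obtain rfl : L = .pred P := hP
          -- A negated name is in no head, also after translation, so its facts in `K'` can only
          -- come from the input of the stratum.
          have : c.fact (P.eval ν) ∈ c.fact '' I := by
            refine hagK _ h.2 fun r' hr' heq => ?_
            obtain ⟨r₁, hr₁, bs, hbs, hname⟩ := c.head_rel_of_mem_stratum hr'
            rw [hname] at heq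
            exact hs r hr P hL r₁ hr₁ (c.name_inj heq hbs (length_factShape _)).1
          exact ⟨hIJ (c.fact_injective.mem_set_image.1 this), hIK this⟩
      refine ⟨hsat r hr ν hνJ, ?_⟩
      rw [← c.eval_pred hm (hvars r)]
      refine hsatK (c.rule σ r)
        (c.mem_stratum.2 ⟨r, hr, σ, hσ, ⟨hbal, hav, fun L hL => (hall L hL).1⟩, rfl⟩) ν' ?_
      intro L' hL'
      obtain ⟨L, hL, hL'⟩ := List.mem_flatMap.1 hL'
      exact (hall L hL).2 L' hL'
    rintro _ ⟨f, hf, rfl⟩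
    exact (hJK hf).2

/-- The assumptions refer to the final result only: intermediate results are contained in it, and
satisfaction of positive literals is monotone. -/
theorem strataResult : ∀ {ss : List (Stratum dom)} {I J : Set (Fact dom)}, Stratified ss →
    (∀ s ∈ ss, ∀ r ∈ s, r.Safe) → StrataResult ss I J → (∀ f ∈ J, c.Avail f) →
    (∀ s ∈ ss, ∀ r ∈ s, ∀ ν : Valuation dom, (∀ A, Literal.pos A ∈ r.body → A.Sat J ν) →
      ∃ σ ∈ c.assignments, ∀ x, Var.path x ∈ r.vars → σ x = brackets (Path.word (ν.path x))) →
    StrataResult (ss.map c.stratum) (c.fact '' I) (c.fact '' J)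
  | [], I, J, _, _, h, _, _ => by
    obtain rfl : J = I := h
    rfl
  | s :: ss, I, J, hss, hsafe, ⟨K, hK, hKJ⟩, hJ, hσ => by
    have hsub := hKJ.subset
    refine ⟨c.fact '' K, ?_, strataResult hss.2 (fun s hs => hsafe s (by simp [hs])) hKJ hJ
      fun s hs => hσ s (by simp [hs])⟩
    refine c.stratumResult (hss.negDisjoint s (by simp)) (hsafe s (by simp)) hK
      (fun f hf => hJ f (hsub hf)) fun r hr ν hν => hσ s (by simp) r hr ν fun A hA => ?_
    have := hν _ hA
    rcases A with P | ⟨e₁, e₂⟩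
    · exact hsub this
    · exact this

theorem stratified : ∀ {ss : List (Stratum dom)}, Stratified ss → Stratified (ss.map c.stratum)
  | [], _ => trivial
  | s :: ss, h => by
    refine ⟨fun r' hr' P' hP' s₁ hs₁ r₁ hr₁ heq => ?_, stratified h.2⟩
    obtain ⟨r, hr, σ, _, _, rfl⟩ := c.mem_stratum.1 hr'
    obtain ⟨L, hL, hL'⟩ := List.mem_flatMap.1 hP'
    rcases c.mem_lits hL' with ⟨_, _, h'⟩ | ⟨_, _, _, h'⟩ | ⟨P, rfl, _, h'⟩ | ⟨_, _, _, h'⟩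
    · cases h'
    · cases h'
    · obtain rfl : P' = c.pred σ P := by cases h'; rfl
      rw [← List.map_cons, List.mem_map] at hs₁
      obtain ⟨s₂, hs₂, rfl⟩ := hs₁
      obtain ⟨r₂, hr₂, bs, hbs, hname⟩ := c.head_rel_of_mem_stratum hr₁
      rw [hname] at heq
      exact h.1 r hr P hL s₂ hs₂ r₂ hr₂ (c.name_inj heq hbs (length_predShape σ P)).1
    · cases h'

/-- Translation of programs. -/
noncomputable def program (P : Program dom) : Program dom where
  strata := P.strata.map c.stratum
  safe := by
    intro s' hs' r' hr'
    obtain ⟨s, hs, rfl⟩ := List.mem_map.1 hs'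
    obtain ⟨r, hr, σ, _, _, rfl⟩ := c.mem_stratum.1 hr'
    exact c.safe_rule (P.safe s hs r hr)
  stratified := c.stratified P.stratified

theorem mem_program_rules {P : Program dom} {r' : Rule dom} : r' ∈ (c.program P).rules ↔
    ∃ r ∈ P.rules, ∃ σ ∈ c.assignments, c.RuleOk σ r ∧ c.rule σ r = r' := by
  constructor
  · rintro ⟨s', hs', hr'⟩
    obtain ⟨s, hs, rfl⟩ := List.mem_map.1 hs'
    obtain ⟨r, hr, h⟩ := c.mem_stratum.1 hr'
    exact ⟨r, ⟨s, hs, hr⟩, h⟩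
  · rintro ⟨r, ⟨s, hs, hr⟩, h⟩
    exact ⟨c.stratum s, List.mem_map.2 ⟨s, hs, rfl⟩, c.mem_stratum.2 ⟨r, hr, h⟩⟩

end ShapeContext

-- Uniform bounds, and elimination of packing when finitely many shapes occur

theorem exists_uniform_bound {α : Type*} {T : Set α} (hT : T.Finite) {p : α → ℕ → Prop}
    (hp : ∀ t b b', b ≤ b' → p t b → p t b') (h : ∀ t ∈ T, ∃ b, p t b) : ∃ b, ∀ t ∈ T, p t b := by
  induction T, hT using Set.Finite.induction_on with
  | empty => exact ⟨0, by simp⟩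
  | @insert t T _ _ ih =>
    obtain ⟨b, hb⟩ := ih fun t ht => h t (by simp [ht])
    obtain ⟨b', hb'⟩ := h t (by simp)
    refine ⟨max b b', fun t' ht' => ?_⟩
    rcases Set.mem_insert_iff.1 ht' with rfl | ht'
    · exact hp _ _ _ (le_max_right b b') hb'
    · exact hp _ _ _ (le_max_left b b') (hb t' ht')

theorem Rule.finite_exprs (r : Rule dom) : r.exprs.Finite := by
  have hpred : ∀ P : Pred dom, P.exprs.Finite := fun P => Set.finite_range _
  have hatom : ∀ A : Atom dom, A.exprs.Finite := fun A => by
    cases A with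
    | pred P => exact hpred P
    | eq e₁ e₂ => simp [Atom.exprs]
  refine ((hpred r.head).union
    ((List.finite_toSet r.body).biUnion fun L _ => hatom L.atom)).subset ?_
  rintro e (he | ⟨L, hL, he⟩)
  · exact .inl he
  · exact .inr (by simp only [Set.mem_iUnion]; exact ⟨L, hL, he⟩)

theorem Rule.finite_vars (r : Rule dom) : r.vars.Finite := by
  refine (r.finite_exprs.biUnion fun e _ => e.finite_vars).subset ?_
  rintro x ⟨e, he, hx⟩
  simp only [Set.mem_iUnion]
  exact ⟨e, he, hx⟩

/-- Such an assignment is determined by its values below `m`. Finiteness is needed because a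
translated stratum contains one copy of a rule per admitted assignment. -/
theorem finite_boundedAssignments (m b : ℕ) :
    {σ : ℕ → List Bool | ∀ x, (σ x).length ≤ b ∧ (m ≤ x → σ x = [])}.Finite := by
  have : {g : Fin m → List Bool | ∀ i, g i ∈ {l : List Bool | l.length ≤ b}}.Finite :=
    Set.Finite.pi' fun _ => List.finite_length_le Bool b
  refine (this.image fun g x => if h : x < m then g ⟨x, h⟩ else []).subset ?_
  intro σ hσ
  refine ⟨fun i => σ i, fun i => (hσ i).1, ?_⟩
  funext x
  by_cases h : x < m
  · simp [h]
  · simp [h, (hσ x).2 (by omega)]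

theorem bracketCount_le_of_factShape {f : Fact dom} {b : ℕ}
    (h : (ShapeContext.factShape f).flatten.length ≤ b) (i) : Path.bracketCount (f.args i) ≤ b := by
  refine le_trans ?_ h
  have : brackets (Path.word (f.args i)) ∈ ShapeContext.factShape f := List.mem_ofFn.2 ⟨i, rfl⟩
  exact (List.sublist_flatten_of_mem this).length_le

/-- If a program computes a query, and the facts in its results on flat instances have finitely many
shapes, then packing can be eliminated. -/
theorem computableIn_of_finite_shapes [Infinite dom] {Γ : Schema} {S : RelName}
    {Q : Query dom Γ S} {F : Fragment} {P : Program dom} (hPF : P.BelongsTo F)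
    (hover : P.IsOver Γ) {J : FlatInstance dom Γ → Set (Fact dom)}
    (hJ : ∀ I, P.Result I.1 (J I)) (hQ : ∀ I, {f ∈ J I | f.rel = S} = (Q.map I).1)
    (hne : ¬ Q.IsConstEmpty)
    (hfin : {y | ∃ I, ∃ f ∈ J I, y = (f.rel, ShapeContext.factShape f)}.Finite)
    (hI : Feature.intermediate ∈ F ∨ P.idb ⊆ {S}) :
    ComputableIn (F \ {Feature.packing}) Q := by
  classical
  obtain ⟨a, b, hab⟩ := exists_pair_ne dom
  set avail := {y | ∃ I, ∃ f ∈ J I, y = (f.rel, ShapeContext.factShape f)} with havail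
  obtain ⟨N, hN⟩ : ∃ N, ∀ I, ∀ f ∈ J I, ∀ i, Path.bracketCount (f.args i) ≤ N := by
    obtain ⟨N, hN⟩ := exists_uniform_bound hfin (p := fun y b => y.2.flatten.length ≤ b)
      (fun _ _ _ h h' => h'.trans h) fun y _ => ⟨_, le_rfl⟩
    exact ⟨N, fun I f hf => bracketCount_le_of_factShape (hN _ ⟨I, f, hf, rfl⟩)⟩
  -- The bound must not depend on the input, as one program has to serve all inputs; the valuations
  -- are therefore pooled over all `I`.
  obtain ⟨B, hB⟩ : ∃ B, ∀ r ∈ P.rules, ∀ x ∈ r.vars, ∀ ν : Valuation dom,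
      (∃ I, ∀ A, Literal.pos A ∈ r.body → A.Sat (J I) ν) → Path.bracketCount (ν.val x) ≤ B := by
    refine exists_uniform_bound P.finite_rules
      (fun r b b' h h' x hx ν hν => (h' x hx ν hν).trans h) fun r hr => ?_
    refine exists_uniform_bound r.finite_vars
      (fun x b b' h h' ν hν => (h' ν hν).trans h) fun x hx => ?_
    obtain ⟨e, he, hx⟩ := hx
    refine Rule.Limited.exists_bracketCount_le
      (N := {ν | ∃ I, ∀ A, Literal.pos A ∈ r.body → A.Sat (J I) ν}) ?_ ?_
      (P.safe_rule hr e he x hx)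
    · rintro A hA i
      refine ⟨N, ?_⟩
      rintro ν ⟨I, hν⟩
      exact hN I _ (hν _ hA) i
    · rintro e₁ e₂ h ν ⟨I, hν⟩
      exact hν _ h
  obtain ⟨m, hm⟩ : ∃ m, ∀ r ∈ P.rules, ∀ x ∈ r.vars, ∀ n, x = Var.path n → n < m := by
    refine exists_uniform_bound P.finite_rules
      (fun r b b' h h' x hx n hn => (h' x hx n hn).trans_le h) fun r hr => ?_
    refine exists_uniform_bound r.finite_vars
      (fun x b b' h h' n hn => (h' n hn).trans_le h) fun x _ => ?_
    cases x with
    | atomic n => exact ⟨0, fun _ h => by cases h⟩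
    | path n => exact ⟨n + 1, fun _ h => by cases h; omega⟩
  obtain ⟨M, hM⟩ : ∃ M, ∀ R ∈ insert S Γ, R.id < M := by
    obtain ⟨M, hM⟩ := exists_uniform_bound (insert S Γ : Finset RelName).finite_toSet
      (p := fun R b => R.id < b) (fun _ _ _ h h' => h'.trans_le h)
      fun R _ => ⟨R.id + 1, by omega⟩
    exact ⟨M, fun R hR => hM R (by exact_mod_cast hR)⟩
  let c : ShapeContext dom :=
    { a := a, b := b, ne := hab, keep := insert S Γ
      monadic := by
        intro R hR
        rcases Finset.mem_insert.1 hR with rfl | hR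
        · exact Q.arity_le
        · exact Q.monadic R hR
      bound := M, lt_bound := hM, avail := avail
      assignments := _
      finite_assignments := finite_boundedAssignments m B }
  have hIflat : ∀ I : FlatInstance dom Γ, ∀ f ∈ I.1, c.fact f = f := fun I f hf =>
    c.fact_of_kept (Finset.mem_insert_of_mem (I.2.1.2 f hf)) (I.2.2 f hf)
  have hres : ∀ I, (c.program P).Result I.1 (c.fact '' J I) := by
    intro I
    have himg : c.fact '' I.1 = I.1 := by
      rw [Set.image_congr (hIflat I), Set.image_id']
    rw [← himg]
    refine c.strataResult P.stratified P.safe (hJ I) (fun f hf => ⟨I, f, hf, rfl⟩) ?_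
    intro s hs r hr ν hν
    -- The actual shapes on the variables of the rule, and empty elsewhere so that the assignment
    -- stays in the finite set.
    refine ⟨fun x => if Var.path x ∈ r.vars then brackets (Path.word (ν.path x)) else [],
      fun x => ?_, fun x hx => by simp [hx]⟩
    by_cases hx : Var.path x ∈ r.vars
    · simp only [hx, if_true]
      refine ⟨hB r ⟨s, hs, hr⟩ _ hx ν ⟨I, hν⟩, fun hmx => ?_⟩
      exact absurd (hm r ⟨s, hs, hr⟩ _ hx x rfl) (by omega)
    · simp [hx]
  have hSflat : ∀ I, ∀ f ∈ J I, f.rel = S → c.fact f = f := fun I f hf hfS => by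
    have : f ∈ (Q.map I).1 := by rw [← hQ]; exact ⟨hf, hfS⟩
    exact c.fact_of_kept (by rw [hfS]; exact Finset.mem_insert_self _ _) ((Q.map I).2.2 f this)
  have hidb : ∀ R' ∈ (c.program P).idb, ∃ R ∈ P.idb, ∃ bs, bs.length = R.arity ∧
      (R, bs) ∈ avail ∧ R' = c.name R bs := by
    rintro _ ⟨r', hr', rfl⟩
    obtain ⟨r, hr, σ, _, hok, rfl⟩ := c.mem_program_rules.1 hr'
    exact ⟨r.head.rel, ⟨r, hr, rfl⟩, _, ShapeContext.length_predShape σ _, hok.2.1, rfl⟩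
  -- Available shapes are realized by some result, and a realized fact is an input fact or has the
  -- head name of a translated rule. This prevents body names from becoming EDB names outside `Γ`.
  have hname : ∀ R bs, (R, bs) ∈ avail → c.name R bs ∈ Γ ∨ c.name R bs ∈ (c.program P).idb := by
    rintro R bs ⟨I, f, hf, h⟩
    obtain ⟨rfl, rfl⟩ := Prod.mk.inj h
    rcases (hres I).rel_mem ⟨f, hf, rfl⟩ with h | h
    · exact .inl (I.2.1.2 _ h)
    · exact .inr h
  refine ⟨c.program P, ?_, ⟨?_, ?_⟩, ?_, fun I => ⟨_, hres I, ?_⟩⟩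
  · intro X hX
    have hXP : X ≠ Feature.packing := by
      rintro rfl
      obtain ⟨r', hr', e, he, h⟩ := hX
      obtain ⟨r, hr, σ, _, _, rfl⟩ := c.mem_program_rules.1 hr'
      exact (c.rule_exprs he).1 h
    refine ⟨?_, hXP⟩
    cases X with
    | arity =>
      obtain ⟨r', hr', A, hA, h⟩ := hX
      obtain ⟨r, hr, σ, _, _, rfl⟩ := c.mem_program_rules.1 hr'
      exfalso
      rcases hA with rfl | ⟨L', hL', hA⟩
      · exact absurd (c.arity_name _ _) (not_le.2 h)
      · obtain ⟨L, _, hL'⟩ := List.mem_flatMap.1 hL'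
        rcases c.mem_lits hL' with ⟨_, _, rfl⟩ | ⟨_, _, _, rfl⟩ | ⟨_, _, _, rfl⟩ |
          ⟨_, _, _, rfl⟩ <;> cases hA
        · exact absurd (c.arity_name _ _) (not_le.2 h)
        · exact absurd (c.arity_name _ _) (not_le.2 h)
    | equations =>
      obtain ⟨r', hr', L', hL', e₁, e₂, h⟩ := hX
      obtain ⟨r, hr, σ, _, _, rfl⟩ := c.mem_program_rules.1 hr'
      obtain ⟨L, hL, hL'⟩ := List.mem_flatMap.1 hL'
      apply hPF Feature.equations
      rcases c.mem_lits hL' with ⟨_, _, rfl⟩ | ⟨e₁, e₂, rfl, rfl⟩ | ⟨_, _, _, rfl⟩ |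
        ⟨e₁, e₂, rfl, rfl⟩
      · cases h
      · exact ⟨r, hr, _, hL, e₁, e₂, rfl⟩
      · cases h
      · exact ⟨r, hr, _, hL, e₁, e₂, rfl⟩
    | intermediate =>
      rcases hI with hI | hI
      · exact hI
      · exfalso
        -- With `S` as the only original IDB name, each head shape is realized by an output fact;
        -- such facts are flat, so the name `S` is kept.
        have : ∀ R' ∈ (c.program P).idb, R' = S := by
          intro R' hR'
          obtain ⟨R, hR, bs, _, ⟨I, f, hf, h⟩, rfl⟩ := hidb R' hR'
          obtain rfl : R = S := hI hR
          obtain ⟨h₁, rfl⟩ := Prod.mk.inj h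
          have := congrArg Fact.rel (hSflat I f hf h₁.symm)
          rw [← h₁] at this
          conv_rhs => rw [← this]
          rw [h₁]
          rfl
        obtain ⟨R₁, h₁, R₂, h₂, hne⟩ := hX
        exact hne ((this R₁ h₁).trans (this R₂ h₂).symm)
    | negation =>
      obtain ⟨r', hr', A, hA⟩ := hX
      obtain ⟨r, hr, σ, _, _, rfl⟩ := c.mem_program_rules.1 hr'
      obtain ⟨L, hL, hL'⟩ := List.mem_flatMap.1 hA
      apply hPF Feature.negation
      rcases c.mem_lits hL' with ⟨_, _, h⟩ | ⟨e₁, e₂, rfl, h⟩ | ⟨_, rfl, _, h⟩ |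
        ⟨e₁, e₂, rfl, h⟩
      · cases h
      · cases h
      · exact ⟨r, hr, _, hL⟩
      · exact ⟨r, hr, _, hL⟩
    | packing => exact absurd rfl hXP
    | recursion =>
      apply hPF Feature.recursion
      -- Forgetting shapes projects the new dependency graph onto the old one, so a new cycle yields
      -- an old one.
      have hstep : ∀ X Y, (c.program P).DependsOn X Y → ∃ R₁ bs₁ R₂ bs₂,
          bs₁.length = R₁.arity ∧ bs₂.length = R₂.arity ∧ X = c.name R₁ bs₁ ∧ Y = c.name R₂ bs₂ ∧
          P.DependsOn R₁ R₂ := by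
        rintro _ Y ⟨_, hY, r', hr', rfl, L', hL', A, hA, hAY⟩
        obtain ⟨r, hr, σ, _, _, rfl⟩ := c.mem_program_rules.1 hr'
        obtain ⟨L, hL, hL'⟩ := List.mem_flatMap.1 hL'
        obtain ⟨A', hA', rfl⟩ : ∃ A', L.atom = .pred A' ∧ A = c.pred σ A' := by
          rcases c.mem_lits hL' with ⟨A', rfl, rfl⟩ | ⟨_, _, rfl, rfl⟩ | ⟨A', rfl, _, rfl⟩ |
            ⟨_, _, rfl, rfl⟩
          · exact ⟨A', rfl, by cases hA; rfl⟩
          · cases hA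
          · exact ⟨A', rfl, by cases hA; rfl⟩
          · cases hA
        obtain ⟨R, hR, bs, hbs, _, hYR⟩ := hidb Y hY
        have hAR : A'.rel = R :=
          (c.name_inj (hAY.trans hYR) (ShapeContext.length_predShape σ A') hbs).1
        exact ⟨r.head.rel, _, A'.rel, _, ShapeContext.length_predShape σ r.head,
          ShapeContext.length_predShape σ A', rfl, hAY.symm, ⟨r, hr, rfl⟩, hAR ▸ hR, r, hr, rfl,
          L, hL, A', hA', rfl⟩
      have htrans : ∀ X Y, Relation.TransGen (c.program P).DependsOn X Y → ∃ R₁ bs₁ R₂ bs₂,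
          bs₁.length = R₁.arity ∧ bs₂.length = R₂.arity ∧ X = c.name R₁ bs₁ ∧ Y = c.name R₂ bs₂ ∧
          Relation.TransGen P.DependsOn R₁ R₂ := by
        intro X Y h
        induction h with
        | single h =>
          obtain ⟨R₁, bs₁, R₂, bs₂, h₁, h₂, h₃, h₄, h⟩ := hstep _ _ h
          exact ⟨R₁, bs₁, R₂, bs₂, h₁, h₂, h₃, h₄, .single h⟩
        | tail _ h ih =>
          obtain ⟨R₁, bs₁, R₂, bs₂, h₁, h₂, h₃, h₄, ht⟩ := ih
          obtain ⟨R₃, bs₃, R₄, bs₄, k₁, k₂, k₃, k₄, k⟩ := hstep _ _ h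
          obtain ⟨rfl, _⟩ := c.name_inj (h₄.symm.trans k₃) h₂ k₁
          exact ⟨R₁, bs₁, R₄, bs₄, h₁, k₂, h₃, k₄, ht.tail k⟩
      obtain ⟨X, hX⟩ := hX
      obtain ⟨R₁, bs₁, R₂, bs₂, h₁, h₂, h₃, h₄, ht⟩ := htrans X X hX
      obtain ⟨rfl, _⟩ := c.name_inj (h₃.symm.trans h₄) h₁ h₂
      exact ⟨R₁, ht⟩
  · rintro R' ⟨⟨r', hr', A, hA, rfl⟩, hR'⟩
    obtain ⟨r, hr, σ, _, hok, rfl⟩ := c.mem_program_rules.1 hr'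
    rcases hA with rfl | ⟨L', hL', hA⟩
    · exact absurd ⟨_, hr', rfl⟩ hR'
    · obtain ⟨L, hL, hL'⟩ := List.mem_flatMap.1 hL'
      rcases c.mem_lits hL' with ⟨A', rfl, rfl⟩ | ⟨_, _, _, rfl⟩ | ⟨A', rfl, hav, rfl⟩ |
        ⟨_, _, _, rfl⟩ <;> cases hA
      · exact (hname _ _ (hok.2.2 _ hL)).resolve_right hR'
      · exact (hname _ _ hav).resolve_right hR'
  · intro R' hR' hΓ
    obtain ⟨R, hR, bs, _, _, rfl⟩ := hidb R' hR'
    unfold ShapeContext.name at hΓ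
    split_ifs at hΓ with hk
    · exact hover.2 R hR hΓ
    · have := hM _ (Finset.mem_insert_of_mem hΓ)
      simp [c] at this
  -- This is where nonemptiness is used: some output fact exists, and it can only stem from a
  -- translated rule with head name `S`.
  · unfold Query.IsConstEmpty at hne
    push Not at hne
    obtain ⟨I, f, hf⟩ := hne
    rw [← hQ] at hf
    rcases (hres I).rel_mem ⟨f, hf.1, rfl⟩ with h | h
    · have := I.2.1.2 _ h
      rw [hSflat I f hf.1 hf.2, hf.2] at this
      exact absurd this Q.not_mem
    · rw [hSflat I f hf.1 hf.2, hf.2] at h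
      exact h
  · rw [← hQ I]
    ext g
    constructor
    · rintro ⟨⟨f, hf, rfl⟩, hfS⟩
      have hname : c.name f.rel (ShapeContext.factShape f) = S := hfS
      have : f.rel = S := by
        unfold ShapeContext.name at hname
        split_ifs at hname
        · exact hname
        · have := hM S (Finset.mem_insert_self _ _)
          rw [← hname] at this
          simp [c] at this
      rw [hSflat I f hf this]
      exact ⟨hf, this⟩
    · rintro ⟨hg, hgS⟩
      exact ⟨⟨g, hg, hSflat I g hg hgS⟩, hgS⟩

/-- Without intermediate names, all facts in the results are flat. -/
theorem finite_shapes_of_idb_subset {Γ : Schema} {S : RelName} {Q : Query dom Γ S}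
    {P : Program dom} {J : FlatInstance dom Γ → Set (Fact dom)}
    (hJ : ∀ I, P.Result I.1 (J I)) (hQ : ∀ I, {f ∈ J I | f.rel = S} = (Q.map I).1)
    (hI : P.idb ⊆ {S}) :
    {y | ∃ I, ∃ f ∈ J I, y = (f.rel, ShapeContext.factShape f)}.Finite := by
  classical
  refine ((insert S Γ : Finset RelName).finite_toSet.image
    fun R => (R, List.replicate R.arity ([] : List Bool))).subset ?_
  rintro _ ⟨I, f, hf, rfl⟩
  have hflat : f.rel ∈ insert S Γ ∧ ∀ i, IsFlatPath (f.args i) := by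
    rcases (hJ I).rel_mem hf with h | h
    · exact ⟨Finset.mem_insert_of_mem (I.2.1.2 f h), I.2.2 f h⟩
    · have hS : f.rel = S := hI h
      have : f ∈ (Q.map I).1 := by rw [← hQ]; exact ⟨hf, hS⟩
      exact ⟨by rw [hS]; exact Finset.mem_insert_self _ _, (Q.map I).2.2 f this⟩
  refine ⟨f.rel, by exact_mod_cast hflat.1, ?_⟩
  have : ShapeContext.factShape f = List.replicate f.rel.arity [] := by
    rw [List.eq_replicate_iff]
    refine ⟨ShapeContext.length_factShape f, ?_⟩
    simp only [ShapeContext.factShape, List.mem_ofFn, forall_exists_index,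
      forall_apply_eq_imp_iff]
    exact fun i => (Path.isFlatPath_iff _).1 (hflat.2 i)
  rw [this]

/-- Without recursion, the facts in the results have finitely many shapes. -/
theorem finite_shapes_of_not_recursion {Γ : Schema} {P : Program dom} (hover : P.IsOver Γ)
    {J : FlatInstance dom Γ → Set (Fact dom)} (hJ : ∀ I, P.Result I.1 (J I))
    (hR : ¬ P.Uses Feature.recursion) :
    {y | ∃ I, ∃ f ∈ J I, y = (f.rel, ShapeContext.factShape f)}.Finite := by
  classical
  -- One bound for all inputs `I` simultaneously.
  let bounded : RelName → Prop := fun R =>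
    ∃ b, ∀ I, ∀ f ∈ J I, f.rel = R → ∀ i, Path.bracketCount (f.args i) ≤ b
  have hedb : ∀ R ∉ P.idb, bounded R := by
    refine fun R hR => ⟨0, ?_⟩
    rintro I f hf rfl i
    rcases (hJ I).rel_mem hf with h | h
    · have := (Path.isFlatPath_iff _).1 (I.2.2 f h i)
      simp [Path.bracketCount, this]
    · exact absurd h hR
  -- Acyclicity makes this a strict order, which is well-founded on the finite set of IDB names.
  let below : RelName → RelName → Prop := fun R₂ R₁ => Relation.TransGen P.DependsOn R₁ R₂
  have : IsStrictOrder RelName below :=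
    { irrefl := fun R h => hR ⟨R, h⟩, trans := fun _ _ _ h₁ h₂ => Relation.TransGen.trans h₂ h₁ }
  have hwf : P.idb.WellFoundedOn below := P.finite_idb.wellFoundedOn
  have hidb : ∀ R ∈ P.idb, bounded R := by
    intro R hR
    refine hwf.induction (P := bounded) hR fun R hR ih => ?_
    obtain ⟨B, hB⟩ : ∃ B, ∀ r ∈ P.rules, r.head.rel = R → ∀ i, ∀ ν : Valuation dom,
        (∃ I, ∀ A, Literal.pos A ∈ r.body → A.Sat (J I) ν) →
        Path.bracketCount (PathExpr.eval ν (r.head.args i)) ≤ B := by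
      refine exists_uniform_bound P.finite_rules
        (fun r b b' h h' e i ν hν => (h' e i ν hν).trans h) fun r hr => ?_
      by_cases hrR : r.head.rel = R
      swap
      · exact ⟨0, fun h => absurd h hrR⟩
      obtain ⟨b, hb⟩ := exists_uniform_bound
        (Set.finite_univ (α := Fin r.head.rel.arity))
        (p := fun i b => ∀ ν ∈ {ν | ∃ I, ∀ A, Literal.pos A ∈ r.body → A.Sat (J I) ν},
          Path.bracketCount (PathExpr.eval ν (r.head.args i)) ≤ b)
        (fun i b b' h h' ν hν => (h' ν hν).trans h) fun i _ => by
          refine exists_bracketCount_eval_le fun x hx => ?_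
          refine Rule.Limited.exists_bracketCount_le ?_ ?_
            (P.safe_rule hr _ (.inl ⟨i, rfl⟩) x hx)
          · intro A hA j
            have hbA : bounded A.rel := by
              by_cases hA' : A.rel ∈ P.idb
              · exact ih _ hA' (.single ⟨hR, hA', r, hr, hrR, _, hA, A, rfl, rfl⟩)
              · exact hedb _ hA'
            obtain ⟨b, hb⟩ := hbA
            refine ⟨b, ?_⟩
            rintro ν ⟨I, hν⟩
            exact hb I _ (hν _ hA) rfl j
          · rintro e₁ e₂ h ν ⟨I, hν⟩
            exact hν _ h
      exact ⟨b, fun _ i ν hν => hb i trivial ν hν⟩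
    refine ⟨B, ?_⟩
    intro I f hf hfR i
    -- An IDB fact is not an input fact, so a rule derives it from facts with EDB names or names
    -- already bounded.
    rcases StrataResult.supported P.stratified (hJ I) f hf with h | ⟨s, hs, r, hr, ν, hν, rfl⟩
    · exact absurd (I.2.1.2 f h) (hover.2 _ (hfR ▸ hR))
    · exact hB r ⟨s, hs, hr⟩ hfR i ν ⟨I, hν⟩
  obtain ⟨B, hB⟩ := exists_uniform_bound (P.finite_idb.union Γ.finite_toSet)
    (p := fun R b => ∀ I, ∀ f ∈ J I, f.rel = R → ∀ i, Path.bracketCount (f.args i) ≤ b)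
    (fun R b b' h h' I f hf hR i => (h' I f hf hR i).trans h) fun R _ => by
      by_cases hR : R ∈ P.idb
      · exact hidb R hR
      · exact hedb R hR
  refine Set.Finite.subset ((P.finite_idb.union Γ.finite_toSet).biUnion fun R _ =>
    (Set.Finite.pi' (ι := Fin R.arity) fun _ => List.finite_length_le Bool B).image
      fun g => (R, List.ofFn g)) ?_
  rintro _ ⟨I, f, hf, rfl⟩
  have hrel : f.rel ∈ P.idb ∪ (Γ : Set RelName) := by
    rcases (hJ I).rel_mem hf with h | h
    · exact .inr (I.2.1.2 f h)
    · exact .inl h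
  simp only [Set.mem_iUnion]
  exact ⟨f.rel, hrel, _, fun i => hB f.rel hrel I f hf rfl i, rfl⟩

/-! ### Coding words with brackets as words without brackets -/

/-- The code of a word with brackets, by blocks of length two. -/
def letterCode {α : Type*} (A B : α) : List (α ⊕ Bool) → List α
  | [] => []
  | .inl x :: t => A :: x :: letterCode A B t
  | .inr true :: t => B :: A :: letterCode A B t
  | .inr false :: t => B :: B :: letterCode A B t

theorem letterCode_append {α : Type*} (A B : α) : ∀ t t' : List (α ⊕ Bool),
    letterCode A B (t ++ t') = letterCode A B t ++ letterCode A B t'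
  | [], _ => rfl
  | .inl _ :: t, t' => by simp [letterCode, letterCode_append A B t t']
  | .inr true :: t, t' => by simp [letterCode, letterCode_append A B t t']
  | .inr false :: t, t' => by simp [letterCode, letterCode_append A B t t']

/-- Blocks have length two and the first entry tells a letter from a bracket, so it does no harm if
`A` or `B` also occurs as a letter. -/
theorem letterCode_injective {α : Type*} {A B : α} (h : A ≠ B) :
    Function.Injective (letterCode A B) := by
  intro t
  induction t with
  | nil =>
    rintro (_ | ⟨_ | _ | _, t'⟩) ht
    · rfl
    all_goals simp [letterCode] at ht
  | cons x t ih =>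
    rintro (_ | ⟨x', t'⟩) ht
    · rcases x with x | _ | _ <;> simp [letterCode] at ht
    · rcases x with x | _ | _ <;> rcases x' with x' | _ | _ <;>
        simp only [letterCode, List.cons.injEq] at ht
      · rw [ht.2.1, ih ht.2.2]
      · exact absurd ht.1 h
      · exact absurd ht.1 h
      · exact absurd ht.1.symm h
      · rw [ih ht.2.2]
      · exact absurd ht.2.1.symm h
      · exact absurd ht.1.symm h
      · exact absurd ht.2.1 h
      · rw [ih ht.2.2]

-- Unary facts and predicates

/-- The unary fact `R(p)`. -/
def unaryFact (R : RelName) (p : Path dom) : Fact dom := ⟨R, fun _ => p⟩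

/-- The unary predicate `R(e)`. -/
def unaryPred (R : RelName) (e : PathExpr dom) : Pred dom := ⟨R, fun _ => e⟩

theorem unaryPred_eval (R : RelName) (e : PathExpr dom) (ν : Valuation dom) :
    (unaryPred R e).eval ν = unaryFact R (PathExpr.eval ν e) := rfl

theorem unaryFact_inj {R : RelName} (hR : R.arity = 1) {p q : Path dom}
    (h : unaryFact R p = unaryFact R q) : p = q :=
  Fact.args_congr h 0 (by simp [unaryFact, hR]) (by simp [unaryFact, hR])

theorem eq_of_mem_exprs_unaryPred {R : RelName} {e e' : PathExpr dom} (h : e' ∈ (unaryPred R e).exprs) :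
    e' = e := by
  obtain ⟨i, rfl⟩ := h
  rfl

theorem mem_exprs_unaryPred {R : RelName} (hR : R.arity = 1) (e : PathExpr dom) :
    e ∈ (unaryPred R e).exprs := ⟨⟨0, by simp [unaryPred, hR]⟩, rfl⟩

/-- Path variable number `n` as an item. -/
abbrev pv (n : ℕ) : Item dom := .var (.path n)

/-- Atomic variable number `n` as an item. -/
abbrev av (n : ℕ) : Item dom := .var (.atomic n)

-- Coding paths, facts and rules by flat paths

/-- The data of the translation by codes: two distinct atomic values and a number from which on
identifiers of relation names are taken as fresh. -/
structure CodeContext (dom : Type u) where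
  a : dom
  b : dom
  ne : a ≠ b
  fresh : ℕ

namespace CodeContext

variable (c : CodeContext dom)

/-- The code of a path by a flat path. -/
def enc (p : Path dom) : Path dom := letterCode (Value.atom c.a) (Value.atom c.b) (Path.word p)

theorem value_ne : Value.atom c.a ≠ Value.atom c.b := fun h => c.ne (Value.atom.inj h)

@[simp] theorem enc_nil : c.enc [] = [] := by simp [enc, letterCode]

@[simp] theorem enc_append (p q : Path dom) : c.enc (p ++ q) = c.enc p ++ c.enc q := by
  simp [enc, letterCode_append]

@[simp] theorem enc_atom (x : dom) (t : Path dom) :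
    c.enc (.atom x :: t) = .atom c.a :: .atom x :: c.enc t := by
  simp [enc, letterCode]

@[simp] theorem enc_pack (p t : Path dom) : c.enc (.pack p :: t) =
    .atom c.b :: .atom c.a :: (c.enc p ++ .atom c.b :: .atom c.b :: c.enc t) := by
  simp [enc, letterCode, letterCode_append]

theorem enc_injective : Function.Injective c.enc :=
  (letterCode_injective c.value_ne).comp Path.word_injective

/-- The code of a flat path consists of blocks `a x` only. Hence a code that is a prefix of it
cannot start a bracket and must be the code of a prefix; decoding relies on this. -/
theorem eq_append_of_enc {p : Path dom} : ∀ {q t : Path dom}, IsFlatPath q →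
    c.enc p ++ t = c.enc q → ∃ t', q = p ++ t' ∧ t = c.enc t' := by
  induction p with
  | nil => intro q t _ h; exact ⟨q, rfl, by simpa using h⟩
  | cons v p ih =>
    intro q t hq h
    cases q with
    | nil => cases v <;> simp at h
    | cons w q =>
      obtain ⟨y, rfl⟩ := hq w (by simp)
      cases v with
      | atom x =>
        simp only [enc_atom, List.cons_append, List.cons.injEq, Value.atom.injEq, true_and] at h
        obtain ⟨t', rfl, rfl⟩ := ih (fun v hv => hq v (by simp [hv])) h.2
        exact ⟨t', by simp [h.1], rfl⟩
      | pack x =>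
        simp only [enc_atom, enc_pack, List.cons_append, List.cons.injEq] at h
        exact absurd h.1.symm c.value_ne

/-- The code of a path expression. -/
def expr : PathExpr dom → PathExpr dom
  | [] => []
  | .const x :: t => .const c.a :: .const x :: expr t
  | .var (.atomic x) :: t => .const c.a :: av x :: expr t
  | .var (.path x) :: t => pv x :: expr t
  | .pack p :: t => .const c.b :: .const c.a :: (expr p ++ .const c.b :: .const c.b :: expr t)

@[simp] theorem expr_nil : c.expr [] = [] := by simp [expr]
@[simp] theorem expr_const (x : dom) (t) :
    c.expr (.const x :: t) = .const c.a :: .const x :: c.expr t := by simp [expr]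
@[simp] theorem expr_atomic (x : ℕ) (t) :
    c.expr (.var (.atomic x) :: t) = .const c.a :: av x :: c.expr t := by simp [expr]
@[simp] theorem expr_path (x : ℕ) (t) :
    c.expr (.var (.path x) :: t) = pv x :: c.expr t := by simp [expr]
@[simp] theorem expr_pack (p t : PathExpr dom) : c.expr (.pack p :: t) =
    .const c.b :: .const c.a :: (c.expr p ++ .const c.b :: .const c.b :: c.expr t) := by
  simp [expr]

theorem vars_expr (e : PathExpr dom) : PathExpr.vars (c.expr e) = PathExpr.vars e := by
  induction e using PathExpr.induct with
  | nil => simp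
  | const a t ih => simpa using ih
  | var x t ih => cases x <;> simp [ih]
  | pack p t ihp iht => simp [ihp, iht]

theorem not_hasPack_expr (e : PathExpr dom) : ¬ PathExpr.HasPack (c.expr e) := by
  rintro ⟨e', h⟩
  induction e using PathExpr.induct with
  | nil => simp at h
  | const a t ih => exact ih (by simpa using h)
  | var x t ih => cases x <;> exact ih (by simpa using h)
  | pack p t ihp iht =>
    simp only [expr_pack, List.mem_cons, reduceCtorEq, List.mem_append, false_or] at h
    exact h.elim ihp iht

/-- On `X`, the valuation `ν'` assigns to variables the codes of their values under `ν`. -/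
def Matches (X : Set Var) (ν ν' : Valuation dom) : Prop :=
  ν.atomic = ν'.atomic ∧ ∀ x, Var.path x ∈ X → ν'.path x = c.enc (ν.path x)

variable {X : Set Var} {ν ν' : Valuation dom}

variable {c} in
theorem Matches.eval_expr (h : c.Matches X ν ν') {e : PathExpr dom} (he : PathExpr.vars e ⊆ X) :
    PathExpr.eval ν' (c.expr e) = c.enc (PathExpr.eval ν e) := by
  induction e using PathExpr.induct with
  | nil => simp
  | const a t ih => simpa using ih (by simpa using he)
  | var x t ih =>
    rw [PathExpr.vars_cons, Set.union_subset_iff] at he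
    cases x with
    | atomic x => simp [ih he.2, Valuation.val, h.1]
    | path x => simp [ih he.2, Valuation.val, h.2 x (he.1 (by simp))]
  | pack p t ihp iht =>
    rw [PathExpr.vars_cons, Set.union_subset_iff] at he
    simp [ihp (by simpa using he.1), iht he.2]

/-- The name for subpaths of codes. -/
def sub : RelName := ⟨c.fresh, 1⟩
/-- The name for codes. -/
def wf : RelName := ⟨c.fresh + 1, 1⟩
/-- The name for pairs of a path and its code. -/
def en : RelName := ⟨c.fresh + 2, 1⟩
/-- The name for the codes of facts. -/
def name (R : RelName) : RelName := ⟨c.fresh + 3 + Nat.pair R.id R.arity, 1⟩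

theorem name_injective : Function.Injective c.name := by
  rintro ⟨i, n⟩ ⟨i', n'⟩ h
  have := congrArg RelName.id h
  simp only [name, Nat.add_left_cancel_iff, Nat.pair_eq_pair] at this
  rw [this.1, this.2]

@[simp] theorem name_ne_sub (R : RelName) : c.name R ≠ c.sub := fun h => by
  have := congrArg RelName.id h; simp [name, sub] at this; omega
@[simp] theorem name_ne_wf (R : RelName) : c.name R ≠ c.wf := fun h => by
  have := congrArg RelName.id h; simp [name, wf] at this; omega
@[simp] theorem name_ne_en (R : RelName) : c.name R ≠ c.en := fun h => by
  have := congrArg RelName.id h; simp [name, en] at this; omega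
@[simp] theorem sub_ne_wf : c.sub ≠ c.wf := fun h => by
  have := congrArg RelName.id h; simp [sub, wf] at this
@[simp] theorem sub_ne_en : c.sub ≠ c.en := fun h => by
  have := congrArg RelName.id h; simp [sub, en] at this
@[simp] theorem wf_ne_en : c.wf ≠ c.en := fun h => by
  have := congrArg RelName.id h; simp [wf, en] at this

/-- Translation of facts. -/
def fact (f : Fact dom) : Fact dom :=
  unaryFact (c.name f.rel) (tuplePath c.a c.b (List.ofFn fun i => c.enc (f.args i)))

/-- Translation of predicates. -/
def pred (P : Pred dom) : Pred dom :=
  unaryPred (c.name P.rel) (tupleExpr c.a c.b (List.ofFn fun i => c.expr (P.args i)))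

theorem fact_rel (f : Fact dom) : (c.fact f).rel = c.name f.rel := rfl

theorem fact_injective : Function.Injective c.fact := by
  intro f g h
  have hR : f.rel = g.rel := c.name_injective (congrArg Fact.rel h)
  obtain ⟨R, x⟩ := f
  obtain ⟨R', y⟩ := g
  obtain rfl : R = R' := hR
  have := tupleCode_inj c.value_ne (by simp) (unaryFact_inj rfl h)
  have := List.ofFn_injective this
  congr
  funext i
  exact c.enc_injective (congrFun this i)

theorem eval_pred (h : c.Matches X ν ν') {P : Pred dom}
    (hP : ∀ i, PathExpr.vars (P.args i) ⊆ X) : (c.pred P).eval ν' = c.fact (P.eval ν) := by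
  rw [pred, unaryPred_eval, eval_tupleExpr, List.map_ofFn]
  have : (PathExpr.eval ν' ∘ fun i => c.expr (P.args i)) =
      fun i => c.enc (PathExpr.eval ν (P.args i)) := funext fun i => h.eval_expr (hP i)
  rw [this]
  rfl

/-- Translation of atoms. -/
def atom : Atom dom → Atom dom
  | .pred P => .pred (c.pred P)
  | .eq e₁ e₂ => .eq (c.expr e₁) (c.expr e₂)

/-- Translation of literals. -/
def lit : Literal dom → Literal dom
  | .pos A => .pos (c.atom A)
  | .neg A => .neg (c.atom A)

theorem lit_atom (L : Literal dom) : (c.lit L).atom = c.atom L.atom := by cases L <;> rfl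

theorem lit_sat (h : c.Matches X ν ν') {K K' : Set (Fact dom)} {L : Literal dom}
    (hL : ∀ e ∈ L.atom.exprs, PathExpr.vars e ⊆ X)
    (hK : ∀ P, L.atom = .pred P → (P.eval ν ∈ K ↔ c.fact (P.eval ν) ∈ K')) :
    L.Sat K ν ↔ (c.lit L).Sat K' ν' := by
  have key : L.atom.Sat K ν ↔ (c.atom L.atom).Sat K' ν' := by
    cases hA : L.atom with
    | pred P =>
      rw [hA] at hL
      simp only [Atom.Sat, atom, c.eval_pred h fun i => hL _ ⟨i, rfl⟩]
      exact hK P hA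
    | eq e₁ e₂ =>
      rw [hA] at hL
      simp only [Atom.Sat, atom]
      rw [h.eval_expr (hL _ (by simp [Atom.exprs])), h.eval_expr (hL _ (by simp [Atom.exprs])),
        c.enc_injective.eq_iff]
  cases L with
  | pos A => exact key
  | neg A => exact not_congr key

/-- For one and the same valuation, whose values need not be codes: this serves the rules that
collect values before any of them is recognized. -/
theorem lit_sat_congr {K K' : Set (Fact dom)} {L : Literal dom}
    (hK : ∀ P, L.atom = .pred P → ((c.pred P).eval ν ∈ K ↔ (c.pred P).eval ν ∈ K')) :
    (c.lit L).Sat K ν ↔ (c.lit L).Sat K' ν := by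
  have key : (c.atom L.atom).Sat K ν ↔ (c.atom L.atom).Sat K' ν := by
    cases hA : L.atom with
    | pred P => exact hK P hA
    | eq e₁ e₂ => exact Iff.rfl
  cases L with
  | pos A => exact key
  | neg A => exact not_congr key

theorem exprs_atom {A : Atom dom} {e' : PathExpr dom} (he' : e' ∈ (c.atom A).exprs) :
    ¬ PathExpr.HasPack e' ∧ ∀ x ∈ PathExpr.vars e', ∃ e ∈ A.exprs, x ∈ PathExpr.vars e := by
  cases A with
  | pred P =>
    obtain rfl := eq_of_mem_exprs_unaryPred he'
    refine ⟨not_hasPack_tupleExpr _ _ fun e he => ?_, fun x hx => ?_⟩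
    · obtain ⟨i, rfl⟩ := List.mem_ofFn.1 he
      exact c.not_hasPack_expr _
    · obtain ⟨e, he, hx⟩ := (mem_vars_tupleExpr _ _ _ _).1 hx
      obtain ⟨i, rfl⟩ := List.mem_ofFn.1 he
      rw [vars_expr] at hx
      exact ⟨_, ⟨i, rfl⟩, hx⟩
  | eq e₁ e₂ =>
    simp only [atom, Atom.exprs, Set.mem_insert_iff, Set.mem_singleton_iff] at he'
    rcases he' with rfl | rfl
    · exact ⟨c.not_hasPack_expr _, fun x hx => ⟨e₁, by simp [Atom.exprs], c.vars_expr e₁ ▸ hx⟩⟩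
    · exact ⟨c.not_hasPack_expr _, fun x hx => ⟨e₂, by simp [Atom.exprs], c.vars_expr e₂ ▸ hx⟩⟩

/-- Coding changes no variables, so the translated positive literals limit whatever the original
ones do, with or without the additional guards. -/
theorem limited_of_lit_mem {r r' : Rule dom} (h : ∀ L ∈ r.body, c.lit L ∈ r'.body) {x : Var}
    (hx : r.Limited x) : r'.Limited x := by
  induction hx with
  | pred P hP e he x hx =>
    obtain ⟨i, rfl⟩ := he
    refine .pred (c.pred P) (h _ hP) _ (mem_exprs_unaryPred rfl _) x ?_
    exact (mem_vars_tupleExpr _ _ _ _).2 ⟨_, List.mem_ofFn.2 ⟨i, rfl⟩, by rwa [vars_expr]⟩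
  | eq_right e₁ e₂ he _ x hx ih =>
    refine .eq_right (c.expr e₁) (c.expr e₂) (h _ he) ?_ x ?_
    · rwa [vars_expr]
    · rwa [vars_expr]
  | eq_left e₁ e₂ he _ x hx ih =>
    refine .eq_left (c.expr e₁) (c.expr e₂) (h _ he) ?_ x ?_
    · rwa [vars_expr]
    · rwa [vars_expr]

/-! ### Translation of strata -/

theorem finite_pathVars (r : Rule dom) : {x | Var.path x ∈ r.vars}.Finite :=
  r.finite_vars.preimage fun _ _ _ _ h => Var.path.inj h

/-- The path variables of a rule. -/
noncomputable def pathVars (r : Rule dom) : List ℕ := (finite_pathVars r).toFinset.toList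

theorem mem_pathVars {r : Rule dom} {x : ℕ} : x ∈ pathVars r ↔ Var.path x ∈ r.vars := by
  simp [pathVars]

/-- A positive unary body literal. -/
def ulit (R : RelName) (e : PathExpr dom) : Literal dom := .pos (.pred (unaryPred R e))

theorem ulit_sat {R : RelName} {e : PathExpr dom} {K : Set (Fact dom)} :
    (ulit R e).Sat K ν ↔ unaryFact R (PathExpr.eval ν e) ∈ K := Iff.rfl

/-- The translation of a rule. -/
noncomputable def rule (r : Rule dom) : Rule dom :=
  ⟨c.pred r.head, r.body.map c.lit ++ (pathVars r).map fun x => ulit c.wf [pv x]⟩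

/-- The rule that collects values of a path variable. -/
def valueRule (r : Rule dom) (x : ℕ) : Rule dom :=
  ⟨unaryPred c.sub [pv x], r.body.map c.lit⟩

/-- The rules that recognize codes among subpaths of codes. -/
def structRules : List (Rule dom) :=
  [⟨unaryPred c.sub [pv 1], [ulit c.sub [pv 0, pv 1, pv 2]]⟩,
   ⟨unaryPred c.wf [], [ulit c.sub []]⟩,
   ⟨unaryPred c.wf [.const c.a, av 0, pv 0],
     [ulit c.wf [pv 0], ulit c.sub [.const c.a, av 0, pv 0]]⟩,
   ⟨unaryPred c.wf [.const c.b, .const c.a, pv 0, .const c.b, .const c.b, pv 1],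
     [ulit c.wf [pv 0], ulit c.wf [pv 1],
      ulit c.sub [.const c.b, .const c.a, pv 0, .const c.b, .const c.b, pv 1]]⟩]

/-- Translation of strata. -/
noncomputable def stratum (s : Stratum dom) : Stratum dom :=
  c.structRules ++ s.map c.rule ++ s.flatMap fun r => (pathVars r).map (c.valueRule r)

theorem mem_stratum {s : Stratum dom} {r' : Rule dom} : r' ∈ c.stratum s ↔
    r' ∈ c.structRules ∨ (∃ r ∈ s, c.rule r = r') ∨
      ∃ r ∈ s, ∃ x, Var.path x ∈ r.vars ∧ c.valueRule r x = r' := by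
  simp [stratum, mem_pathVars]

theorem safe_of_limited_ulit {r : Rule dom} {R : RelName} (hR : R.arity = 1) {e : PathExpr dom}
    (he : ulit R e ∈ r.body) (h : ∀ e' ∈ r.exprs, PathExpr.vars e' ⊆ PathExpr.vars e) : r.Safe :=
  fun e' he' x hx => .pred _ he e (mem_exprs_unaryPred hR e) x (h e' he' hx)

theorem ulit_exprs {R : RelName} {e e' : PathExpr dom} (h : e' ∈ (ulit R e).atom.exprs) : e' = e :=
  eq_of_mem_exprs_unaryPred h

theorem structRules_exprs {r : Rule dom} (hr : r ∈ c.structRules) : r.Safe ∧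
    ∀ e ∈ r.exprs, ¬ PathExpr.HasPack e := by
  simp only [structRules, List.mem_cons, List.not_mem_nil, or_false] at hr
  rcases hr with rfl | rfl | rfl | rfl
  · refine ⟨safe_of_limited_ulit (R := c.sub) rfl (e := [pv 0, pv 1, pv 2]) (by simp) ?_, ?_⟩
    all_goals
      rintro e (he | ⟨L, hL, he⟩)
      · obtain rfl := eq_of_mem_exprs_unaryPred he
        simp [PathExpr.HasPack]
      · simp only [List.mem_cons, List.not_mem_nil, or_false] at hL
        obtain rfl := hL
        obtain rfl := ulit_exprs he
        simp [PathExpr.HasPack]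
  · refine ⟨safe_of_limited_ulit (R := c.sub) rfl (e := []) (by simp) ?_, ?_⟩
    all_goals
      rintro e (he | ⟨L, hL, he⟩)
      · obtain rfl := eq_of_mem_exprs_unaryPred he
        simp [PathExpr.HasPack]
      · simp only [List.mem_cons, List.not_mem_nil, or_false] at hL
        obtain rfl := hL
        obtain rfl := ulit_exprs he
        simp [PathExpr.HasPack]
  · refine ⟨safe_of_limited_ulit (R := c.sub) rfl (e := [.const c.a, av 0, pv 0])
      (by simp) ?_, ?_⟩
    all_goals
      rintro e (he | ⟨L, hL, he⟩)
      · obtain rfl := eq_of_mem_exprs_unaryPred he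
        simp [PathExpr.HasPack]
      · simp only [List.mem_cons, List.not_mem_nil, or_false] at hL
        rcases hL with rfl | rfl <;> obtain rfl := ulit_exprs he <;> simp [PathExpr.HasPack]
  · refine ⟨safe_of_limited_ulit (R := c.sub) rfl
      (e := [.const c.b, .const c.a, pv 0, .const c.b, .const c.b, pv 1]) (by simp) ?_, ?_⟩
    all_goals
      rintro e (he | ⟨L, hL, he⟩)
      · obtain rfl := eq_of_mem_exprs_unaryPred he
        simp [PathExpr.HasPack]
      · simp only [List.mem_cons, List.not_mem_nil, or_false] at hL
        rcases hL with rfl | rfl | rfl <;> obtain rfl := ulit_exprs he <;>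
          simp [PathExpr.HasPack]

theorem body_exprs {r : Rule dom} {e' : PathExpr dom}
    (h : ∃ L ∈ r.body.map c.lit, e' ∈ L.atom.exprs) :
    ¬ PathExpr.HasPack e' ∧ ∀ x ∈ PathExpr.vars e', x ∈ r.vars := by
  obtain ⟨L', hL', he'⟩ := h
  obtain ⟨L, hL, rfl⟩ := List.mem_map.1 hL'
  rw [lit_atom] at he'
  refine ⟨(c.exprs_atom he').1, fun x hx => ?_⟩
  obtain ⟨e, he, hx⟩ := (c.exprs_atom he').2 x hx
  exact ⟨e, .inr ⟨L, hL, he⟩, hx⟩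

theorem rule_exprs {r : Rule dom} {e' : PathExpr dom} (he' : e' ∈ (c.rule r).exprs) :
    ¬ PathExpr.HasPack e' ∧ ∀ x ∈ PathExpr.vars e', x ∈ r.vars := by
  rcases he' with he' | ⟨L', hL', he'⟩
  · have := c.exprs_atom (A := .pred r.head) he'
    refine ⟨this.1, fun x hx => ?_⟩
    obtain ⟨e, he, hx⟩ := this.2 x hx
    exact ⟨e, .inl he, hx⟩
  · rcases List.mem_append.1 hL' with hL' | hL'
    · exact c.body_exprs ⟨L', hL', he'⟩
    · obtain ⟨y, hy, rfl⟩ := List.mem_map.1 hL'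
      obtain rfl := ulit_exprs he'
      simpa [PathExpr.HasPack] using mem_pathVars.1 hy

theorem valueRule_exprs {r : Rule dom} {y : ℕ} (hy : Var.path y ∈ r.vars) {e' : PathExpr dom}
    (he' : e' ∈ (c.valueRule r y).exprs) :
    ¬ PathExpr.HasPack e' ∧ ∀ x ∈ PathExpr.vars e', x ∈ r.vars := by
  rcases he' with he' | h
  · obtain rfl := eq_of_mem_exprs_unaryPred he'
    simpa [PathExpr.HasPack] using hy
  · exact c.body_exprs h

theorem stratum_exprs {s : Stratum dom} {r' : Rule dom} (hr' : r' ∈ c.stratum s) :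
    ∀ e ∈ r'.exprs, ¬ PathExpr.HasPack e := by
  rcases c.mem_stratum.1 hr' with h | ⟨r, _, rfl⟩ | ⟨r, _, x, hx, rfl⟩
  · exact (c.structRules_exprs h).2
  · exact fun e he => (c.rule_exprs he).1
  · exact fun e he => (c.valueRule_exprs hx he).1

theorem stratum_safe {s : Stratum dom} (hs : ∀ r ∈ s, r.Safe) {r' : Rule dom}
    (hr' : r' ∈ c.stratum s) : r'.Safe := by
  have hlim : ∀ r ∈ s, ∀ x ∈ r.vars, r.Limited x := fun r hr x ⟨e, he, hx⟩ => hs r hr e he x hx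
  rcases c.mem_stratum.1 hr' with h | ⟨r, hr, rfl⟩ | ⟨r, hr, x, hx, rfl⟩
  · exact (c.structRules_exprs h).1
  · exact fun e he y hy => c.limited_of_lit_mem
      (fun L hL => List.mem_append_left _ (List.mem_map_of_mem hL))
      (hlim r hr y ((c.rule_exprs he).2 y hy))
  · exact fun e he y hy => c.limited_of_lit_mem (fun L hL => List.mem_map_of_mem hL)
      (hlim r hr y ((c.valueRule_exprs hx he).2 y hy))

theorem stratum_head {s : Stratum dom} {r' : Rule dom} (hr' : r' ∈ c.stratum s) :
    r'.head.rel = c.sub ∨ r'.head.rel = c.wf ∨ ∃ r ∈ s, r'.head.rel = c.name r.head.rel := by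
  rcases c.mem_stratum.1 hr' with h | ⟨r, hr, rfl⟩ | ⟨r, _, x, hx, rfl⟩
  · simp only [structRules, List.mem_cons, List.not_mem_nil, or_false] at h
    rcases h with rfl | rfl | rfl | rfl <;> simp [unaryPred]
  · exact .inr (.inr ⟨r, hr, rfl⟩)
  · exact .inl rfl

-- Correctness of the coded strata

/-- Membership of facts in the codes of an instance, together with subpaths of codes. -/
def state (C J : Set (Fact dom)) (A : Set (Path dom)) : Set (Fact dom) :=
  C ∪ c.fact '' J ∪ unaryFact c.sub '' A ∪ unaryFact c.wf '' (A ∩ Set.range c.enc)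

/-- The facts in `C` are not among those that the translated strata deal with. -/
def Foreign (C : Set (Fact dom)) : Prop :=
  ∀ f ∈ C, f.rel ≠ c.sub ∧ f.rel ≠ c.wf ∧ ∀ R, f.rel ≠ c.name R

variable {C J : Set (Fact dom)} {A : Set (Path dom)}

theorem mem_state_of_name (hC : c.Foreign C) {g : Fact dom} {R : RelName}
    (hg : g.rel = c.name R) : g ∈ c.state C J A ↔ g ∈ c.fact '' J := by
  refine ⟨?_, fun h => .inl (.inl (.inr h))⟩
  rintro (((h | h) | ⟨p, _, rfl⟩) | ⟨p, _, rfl⟩)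
  · exact absurd hg ((hC g h).2.2 R)
  · exact h
  · exact absurd hg.symm (c.name_ne_sub R)
  · exact absurd hg.symm (c.name_ne_wf R)

theorem fact_mem_state (hC : c.Foreign C) {f : Fact dom} : c.fact f ∈ c.state C J A ↔ f ∈ J := by
  rw [c.mem_state_of_name hC (c.fact_rel f), c.fact_injective.mem_set_image]

theorem sub_mem_state (hC : c.Foreign C) {p : Path dom} :
    unaryFact c.sub p ∈ c.state C J A ↔ p ∈ A := by
  refine ⟨?_, fun h => .inl (.inr ⟨p, h, rfl⟩)⟩
  rintro (((h | ⟨f, _, h⟩) | ⟨q, hq, h⟩) | ⟨q, _, h⟩)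
  · exact absurd rfl (hC _ h).1
  · exact absurd (congrArg Fact.rel h) (c.name_ne_sub _)
  · rwa [← unaryFact_inj rfl h]
  · exact absurd (congrArg Fact.rel h).symm c.sub_ne_wf

theorem wf_mem_state (hC : c.Foreign C) {p : Path dom} :
    unaryFact c.wf p ∈ c.state C J A ↔ p ∈ A ∧ p ∈ Set.range c.enc := by
  refine ⟨?_, fun h => .inr ⟨p, h, rfl⟩⟩
  rintro (((h | ⟨f, _, h⟩) | ⟨q, hq, h⟩) | ⟨q, hq, h⟩)
  · exact absurd rfl (hC _ h).2.1
  · exact absurd (congrArg Fact.rel h) (c.name_ne_wf _)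
  · exact absurd (congrArg Fact.rel h) c.sub_ne_wf
  · rwa [← unaryFact_inj rfl h]

/-- The values of the path variables of the rules of `s`, coded. -/
def values (s : Stratum dom) (J : Set (Fact dom)) : Set (Path dom) :=
  {p | ∃ r ∈ s, ∃ x, Var.path x ∈ r.vars ∧ ∃ ν : Valuation dom,
    (∀ L ∈ r.body, (c.lit L).Sat (c.fact '' J) ν) ∧ p = ν.path x}

/-- Unguarded valuations may also take non-codes as values, but the translated body contains no
packing and so still limits its variables to finitely many values. This makes `sub`, and with it
`wf`, finite. -/
theorem finite_values {s : Stratum dom} (hs : ∀ r ∈ s, r.Safe) (hJ : J.Finite) :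
    (c.values s J).Finite := by
  refine ((List.finite_toSet s).biUnion (t := fun r => ⋃ x ∈ {x | Var.path x ∈ r.vars},
    {p | ∃ ν : Valuation dom, (∀ L ∈ (c.valueRule r x).body, L.Sat (c.fact '' J) ν) ∧
      p = ν.val (.path x)}) fun r hr => ?_).subset ?_
  · refine (finite_pathVars r).biUnion fun x hx => ?_
    refine Rule.Limited.finite (fun e he => (c.valueRule_exprs hx he).1) (hJ.image _) ?_
    obtain ⟨e, he, hxe⟩ := hx
    exact c.limited_of_lit_mem (fun L hL => List.mem_map_of_mem hL) (hs r hr e he _ hxe)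
  · rintro p ⟨r, hr, x, hx, ν, hν, rfl⟩
    simp only [Set.mem_iUnion]
    refine ⟨r, hr, x, hx, ν, fun L' hL' => ?_, rfl⟩
    obtain ⟨L, hL, rfl⟩ := List.mem_map.1 hL'
    exact hν L hL

theorem finite_state (hC : C.Finite) (hJ : J.Finite) (hA : A.Finite) :
    (c.state C J A).Finite :=
  ((hC.union (hJ.image _)).union (hA.image _)).union ((hA.inter_of_left _).image _)

/-- In models of the structural rules, the recognized codes include all codes among subpaths. -/
theorem wf_mem_of_sub_mem {K : Set (Fact dom)} (hK : ∀ r ∈ c.structRules, r.SatisfiedIn K)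
    (hinf : ∀ p q, unaryFact c.sub q ∈ K → p <:+: q → unaryFact c.sub p ∈ K) (p : Path dom) :
    unaryFact c.sub (c.enc p) ∈ K → unaryFact c.wf (c.enc p) ∈ K := by
  induction p using Path.induct with
  | nil =>
    intro h
    have := hK _ (by simp [structRules]; right; left; rfl) ⟨fun _ => c.a, fun _ => []⟩
      (by simpa [ulit_sat] using h)
    simpa [unaryPred_eval] using this
  | atom x t ih =>
    intro h
    rw [enc_atom] at h ⊢
    -- The code of the tail is a contiguous part of the given code, hence it is among the subpaths
    -- as well.
    have ht := ih (hinf _ _ h ⟨[.atom c.a, .atom x], [], by simp⟩)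
    have := hK _ (by simp [structRules]; right; right; left; rfl)
      ⟨fun _ => x, fun _ => c.enc t⟩
      (by simpa [ulit_sat, Valuation.val] using ⟨ht, h⟩)
    simpa [unaryPred_eval, Valuation.val] using this
  | pack p t ihp iht =>
    intro h
    rw [enc_pack] at h ⊢
    have hp := ihp (hinf _ _ h ⟨[.atom c.b, .atom c.a], .atom c.b :: .atom c.b :: c.enc t,
      by simp⟩)
    have ht := iht (hinf _ _ h ⟨.atom c.b :: .atom c.a :: (c.enc p ++ [.atom c.b, .atom c.b]), [],
      by simp⟩)
    have := hK _ (by simp [structRules]; right; right; right; rfl)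
      ⟨fun _ => c.a, fun n => if n = 0 then c.enc p else c.enc t⟩
      (by simpa [ulit_sat, Valuation.val] using ⟨hp, ht, h⟩)
    simpa [unaryPred_eval, Valuation.val] using this

/-- Closure of `A` under subpaths takes care of the first rule; the others hold because prefixing a
coded letter, or bracketing a code, again gives a code. -/
theorem structRules_satisfied (hC : c.Foreign C) (hA : ∀ p q, q ∈ A → p <:+: q → p ∈ A) :
    ∀ r ∈ c.structRules, r.SatisfiedIn (c.state C J A) := by
  intro r hr ν hν
  simp only [structRules, List.mem_cons, List.not_mem_nil, or_false] at hr
  rcases hr with rfl | rfl | rfl | rfl <;>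
    simp only [List.mem_cons, List.not_mem_nil, or_false, forall_eq_or_imp, forall_eq, ulit_sat,
      c.sub_mem_state hC, c.wf_mem_state hC, unaryPred_eval] at hν ⊢
  · exact hA _ _ hν ⟨ν.path 0, ν.path 2, by simp [Valuation.val]⟩
  · exact ⟨hν, [], by simp⟩
  · obtain ⟨⟨_, p, hp⟩, h⟩ := hν
    refine ⟨h, .atom (ν.atomic 0) :: p, ?_⟩
    simpa [Valuation.val] using hp
  · obtain ⟨⟨_, p, hp⟩, ⟨_, q, hq⟩, h⟩ := hν
    refine ⟨h, .pack p :: q, ?_⟩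
    simp only [PathExpr.eval_cons, Item.eval_var, Valuation.val, PathExpr.eval_nil,
      List.append_nil] at hp hq
    simp [Valuation.val, hp, hq]

/-- The translated stratum computes the codes of the result. -/
theorem stratumResult {s : Stratum dom} {I : Set (Fact dom)} (hs : s.NegDisjoint)
    (hsafe : ∀ r ∈ s, r.Safe) (h : StratumResult s I J) (hC : c.Foreign C) (hCfin : C.Finite)
    (hAfin : A.Finite) :
    ∃ A' : Set (Path dom), A'.Finite ∧
      StratumResult (c.stratum s) (c.state C I A) (c.state C J A') := by
  obtain ⟨⟨hfin, hIJ, hag, hsat⟩, hleast⟩ := h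
  have hvars : ∀ (r : Rule dom) i, PathExpr.vars (r.head.args i) ⊆ r.vars :=
    fun r i x hx => ⟨_, .inl ⟨i, rfl⟩, hx⟩
  have hLvars : ∀ (r : Rule dom), ∀ L ∈ r.body, ∀ e ∈ L.atom.exprs, PathExpr.vars e ⊆ r.vars :=
    fun r L hL e he x hx => ⟨e, .inr ⟨L, hL, he⟩, hx⟩
  -- The values are taken with respect to the final `J`, since the collecting rules run together
  -- with the translated ones.
  set A' : Set (Path dom) := {p | ∃ q ∈ A ∪ c.values s J, p <:+: q} with hA'
  have hA'fin : A'.Finite := by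
    refine ((hAfin.union (c.finite_values hsafe hfin)).biUnion fun q _ =>
      finite_setOf_isInfix q).subset ?_
    rintro p ⟨q, hq, hp⟩
    simp only [Set.mem_iUnion]
    exact ⟨q, hq, hp⟩
  have hA'inf : ∀ p q, q ∈ A' → p <:+: q → p ∈ A' := by
    rintro p q ⟨q', hq', h⟩ hp
    exact ⟨q', hq', hp.trans h⟩
  have hAA' : A ⊆ A' := fun p hp => ⟨p, .inl hp, List.infix_rfl⟩
  refine ⟨A', hA'fin, ⟨c.finite_state hCfin hfin hA'fin, ?_, ?_, ?_⟩, ?_⟩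
  · exact Set.union_subset_union (Set.union_subset_union (Set.union_subset_union_right _
      (Set.image_mono hIJ)) (Set.image_mono hAA'))
      (Set.image_mono (Set.inter_subset_inter_left _ hAA'))
  · rintro g (((hg | ⟨f, hf, rfl⟩) | ⟨p, hp, rfl⟩) | ⟨p, hp, rfl⟩) hhead
    · exact .inl (.inl (.inl hg))
    · refine .inl (.inl (.inr ⟨f, hag f hf fun r hr heq => ?_, rfl⟩))
      exact hhead (c.rule r) (c.mem_stratum.2 (.inr (.inl ⟨r, hr, rfl⟩)))
        (congrArg c.name heq)
    · exact absurd rfl (hhead _ (c.mem_stratum.2 (.inl (List.mem_cons_self))))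
    · exact absurd rfl (hhead _ (c.mem_stratum.2
        (.inl (List.mem_cons_of_mem _ List.mem_cons_self))))
  · intro r' hr'
    rcases c.mem_stratum.1 hr' with h | ⟨r, hr, rfl⟩ | ⟨r, hr, x, hx, rfl⟩
    · exact c.structRules_satisfied hC hA'inf r' h
    · intro ν' hν'
      -- The guards make every path variable of the rule take a code, so the valuation can be
      -- decoded to one of the original rule.
      have hwf : ∀ x, ∃ p : Path dom, Var.path x ∈ r.vars → ν'.path x = c.enc p := fun x => by
        by_cases hx : Var.path x ∈ r.vars
        · have := hν' (ulit c.wf [pv x]) (List.mem_append_right _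
            (List.mem_map.2 ⟨x, mem_pathVars.2 hx, rfl⟩))
          rw [ulit_sat, c.wf_mem_state hC] at this
          obtain ⟨_, p, hp⟩ := this
          exact ⟨p, fun _ => by simpa [Valuation.val] using hp.symm⟩
        · exact ⟨[], fun h => absurd h hx⟩
      choose p hp using hwf
      have hm : c.Matches r.vars ⟨ν'.atomic, p⟩ ν' := ⟨rfl, hp⟩
      rw [show (c.rule r).head = c.pred r.head from rfl, c.eval_pred hm (hvars r),
        c.fact_mem_state hC]
      refine hsat r hr _ fun L hL => (c.lit_sat hm (hLvars r L hL) fun P _ => ?_).2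
        (hν' _ (List.mem_append_left _ (List.mem_map_of_mem hL)))
      exact (c.fact_mem_state hC).symm
    · intro ν' hν'
      rw [show (c.valueRule r x).head = unaryPred c.sub [pv x] from rfl, unaryPred_eval,
        c.sub_mem_state hC]
      refine ⟨_, .inr ⟨r, hr, x, hx, ν', fun L hL => ?_, rfl⟩, by simp [Valuation.val]⟩
      refine (c.lit_sat_congr fun P _ => ?_).1 (hν' _ (List.mem_map_of_mem hL))
      exact c.mem_state_of_name hC rfl
  · rintro K ⟨_, hIK, hagK, hsatK⟩
    have hstruct : ∀ r ∈ c.structRules, r.SatisfiedIn K :=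
      fun r hr => hsatK r (c.mem_stratum.2 (.inl hr))
    have hinf : ∀ p q, unaryFact c.sub q ∈ K → p <:+: q → unaryFact c.sub p ∈ K := by
      rintro p _ hq ⟨t, u, rfl⟩
      have := hstruct _ List.mem_cons_self
        ⟨fun _ => c.a, fun n => if n = 0 then t else if n = 1 then p else u⟩
        (by simpa [ulit_sat, Valuation.val] using hq)
      simpa [unaryPred_eval, Valuation.val] using this
    -- Coded negated names are in no head of the translated stratum, so a competing model `K` cannot
    -- add facts with these names.
    have hneg : ∀ r ∈ s, ∀ P : Pred dom, Literal.neg (.pred P) ∈ r.body → ∀ g : Fact dom,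
        g.rel = c.name P.rel → g ∈ K → g ∈ c.fact '' I := by
      intro r hr P hP g hg hgK
      refine (c.mem_state_of_name hC hg).1 (hagK g hgK fun r' hr' heq => ?_)
      rw [hg] at heq
      rcases c.stratum_head hr' with h | h | ⟨r₁, hr₁, h⟩
      · exact c.name_ne_sub _ (heq.symm.trans h)
      · exact c.name_ne_wf _ (heq.symm.trans h)
      · exact hs r hr P hP r₁ hr₁ (c.name_injective (h.symm.trans heq))
    have hJK : J ⊆ {f ∈ J | c.fact f ∈ K} := by
      have hIK' : ∀ f ∈ I, c.fact f ∈ K := fun f hf => hIK (.inl (.inl (.inr ⟨f, hf, rfl⟩)))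
      refine hleast ⟨hfin.subset (Set.sep_subset _ _), fun f hf => ⟨hIJ hf, hIK' f hf⟩,
        fun f hf => hag f hf.1, fun r hr ν hν => ?_⟩
      have hνJ : ∀ L ∈ r.body, L.Sat J ν := fun L hL =>
        hs.sat_mono (Set.sep_subset _ _) (fun f hf hf' =>
          ⟨hf, hIK' f (hag f hf hf')⟩) hr hL (hν L hL)
      refine ⟨hsat r hr ν hνJ, ?_⟩
      have hm : c.Matches r.vars ν ⟨ν.atomic, fun x => c.enc (ν.path x)⟩ := ⟨rfl, fun _ _ => rfl⟩
      have hbody : ∀ L ∈ r.body, (c.lit L).Sat K ⟨ν.atomic, fun x => c.enc (ν.path x)⟩ := by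
        intro L hL
        refine (c.lit_sat hm (hLvars r L hL) fun P hP => ?_).1 (hν L hL)
        refine ⟨fun h => h.2, fun h => ?_⟩
        rcases L with L | L
        · obtain rfl : L = .pred P := hP
          exact hν _ hL
        · obtain rfl : L = .pred P := hP
          have := c.fact_injective.mem_set_image.1 (hneg r hr P hL _ rfl h)
          exact ⟨hIJ this, h⟩
      rw [← c.eval_pred hm (hvars r)]
      refine hsatK (c.rule r) (c.mem_stratum.2 (.inr (.inl ⟨r, hr, rfl⟩))) _ fun L' hL' => ?_
      rcases List.mem_append.1 hL' with hL' | hL'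
      · obtain ⟨L, hL, rfl⟩ := List.mem_map.1 hL'
        exact hbody L hL
      · obtain ⟨x, hx, rfl⟩ := List.mem_map.1 hL'
        have hx := mem_pathVars.1 hx
        -- The guard holds in `K`: the collecting rule puts the coded value into `sub`, and the
        -- structural rules then recognize it.
        have := hsatK (c.valueRule r x) (c.mem_stratum.2 (.inr (.inr ⟨r, hr, x, hx, rfl⟩)))
          ⟨ν.atomic, fun x => c.enc (ν.path x)⟩ fun L' hL' => by
            obtain ⟨L, hL, rfl⟩ := List.mem_map.1 hL'
            exact hbody L hL
        have := c.wf_mem_of_sub_mem hstruct hinf (ν.path x)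
          (by simpa [valueRule, unaryPred_eval, Valuation.val] using this)
        simpa [ulit_sat, Valuation.val] using this
    have hAK : ∀ p ∈ A', unaryFact c.sub p ∈ K := by
      rintro p ⟨q, hq | ⟨r, hr, x, hx, ν, hν, rfl⟩, hp⟩
      · exact hinf p q (hIK (.inl (.inr ⟨q, hq, rfl⟩))) hp
      · refine hinf _ _ ?_ hp
        have := hsatK (c.valueRule r x) (c.mem_stratum.2 (.inr (.inr ⟨r, hr, x, hx, rfl⟩))) ν
          fun L' hL' => by
            obtain ⟨L, hL, rfl⟩ := List.mem_map.1 hL'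
            have hL₀ := hν L hL
            rcases L with (P | ⟨e₁, e₂⟩) | (P | ⟨e₁, e₂⟩)
            · obtain ⟨f, hf, h⟩ := hL₀
              change (c.pred P).eval ν ∈ K
              rw [← h]
              exact (hJK hf).2
            · exact hL₀
            · exact fun h => hL₀ (Set.image_mono hIJ (hneg r hr P hL _ rfl h))
            · exact hL₀
        simpa [valueRule, unaryPred_eval, Valuation.val] using this
    rintro g (((hg | ⟨f, hf, rfl⟩) | ⟨p, hp, rfl⟩) | ⟨p, ⟨hp, q, rfl⟩, rfl⟩)
    · exact hIK (.inl (.inl (.inl hg)))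
    · exact (hJK hf).2
    · exact hAK p hp
    · exact c.wf_mem_of_sub_mem hstruct hinf q (hAK _ hp)

/-- The names `sub` and `wf` are shared by all strata, so collected subpaths accumulate. This is
harmless, as `wf` still contains only codes. -/
theorem strataResult (hC : c.Foreign C) (hCfin : C.Finite) : ∀ {ss : List (Stratum dom)}
    {I J : Set (Fact dom)} {A : Set (Path dom)}, Stratified ss →
    (∀ s ∈ ss, ∀ r ∈ s, r.Safe) → StrataResult ss I J → A.Finite → ∃ A' : Set (Path dom),
      A'.Finite ∧ StrataResult (ss.map c.stratum) (c.state C I A) (c.state C J A')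
  | [], I, J, A, _, _, h, hA => by
    obtain rfl : J = I := h
    exact ⟨A, hA, rfl⟩
  | s :: ss, I, J, A, hss, hsafe, ⟨K, hK, hKJ⟩, hA => by
    obtain ⟨A₁, hA₁, h₁⟩ := c.stratumResult (hss.negDisjoint s (by simp)) (hsafe s (by simp)) hK
      hC hCfin hA
    obtain ⟨A₂, hA₂, h₂⟩ := strataResult hC hCfin hss.2 (fun s hs => hsafe s (by simp [hs])) hKJ
      hA₁
    exact ⟨A₂, hA₂, _, h₁, h₂⟩

end CodeContext

namespace CodeContext

variable (c : CodeContext dom)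

/-! ### Coding the input and decoding the output -/

/-- The code of a pair of path expressions. -/
abbrev pairExpr (e₁ e₂ : PathExpr dom) : PathExpr dom := tupleExpr c.a c.b [e₁, e₂]

/-- The fact that relates a path to its code. -/
def encFact (p : Path dom) : Fact dom := unaryFact c.en (tuplePath c.a c.b [p, c.enc p])

/-- The rule that extends the coding relation by one atomic value, as far as `R(e)` requires. -/
def scanRule (R : RelName) (e : PathExpr dom) : Rule dom :=
  ⟨unaryPred c.en (c.pairExpr [pv 0, av 0] [pv 1, .const c.a, av 0]),
    [ulit c.en (c.pairExpr [pv 0] [pv 1]), ulit R e]⟩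

/-- The rule that codes the facts of `R`. -/
def encodeRule (R : RelName) : Rule dom :=
  ⟨unaryPred (c.name R) (tupleExpr c.a c.b (List.replicate R.arity [pv 1])),
    [ulit R [pv 0], ulit c.en (c.pairExpr [pv 0] [pv 1])]⟩

/-- The rule that decodes the facts of `S`. -/
def decodeRule (S : RelName) : Rule dom :=
  ⟨unaryPred S [pv 0],
    [ulit (c.name S) (tupleExpr c.a c.b (List.replicate S.arity [pv 1])),
     ulit c.en (c.pairExpr [pv 0] [pv 1])]⟩

/-- The rule that relates the empty path to its code. -/
def emptyRule : Rule dom := ⟨unaryPred c.en (c.pairExpr [] []), []⟩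

/-- The stratum that codes the input. -/
noncomputable def encodeStratum (Γ : Schema) : Stratum dom :=
  c.emptyRule ::
    ((Γ.toList.filter fun R => R.arity = 1).map fun R => c.scanRule R [pv 0, av 0, pv 2]) ++
    Γ.toList.map c.encodeRule

/-- The stratum that decodes the output. -/
def decodeStratum (S : RelName) : Stratum dom :=
  [c.scanRule (c.name S) (tupleExpr c.a c.b [[pv 1, .const c.a, av 0, pv 2]]), c.decodeRule S]

theorem mem_encodeStratum {Γ : Schema} {r : Rule dom} : r ∈ c.encodeStratum Γ ↔ r = c.emptyRule ∨
    (∃ R ∈ Γ, R.arity = 1 ∧ r = c.scanRule R [pv 0, av 0, pv 2]) ∨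
    ∃ R ∈ Γ, r = c.encodeRule R := by
  simp [encodeStratum, and_assoc, eq_comm (a := r)]

theorem mem_decodeStratum {S : RelName} {r : Rule dom} : r ∈ c.decodeStratum S ↔
    r = c.scanRule (c.name S) (tupleExpr c.a c.b [[pv 1, .const c.a, av 0, pv 2]]) ∨
      r = c.decodeRule S := by
  simp [decodeStratum]

/-- For a nullary name the path in `unaryFact` is a dummy; fixing it to be empty lets arities zero
and one be treated together. -/
theorem exists_unaryFact {f : Fact dom} (h : f.rel.arity ≤ 1) :
    ∃ p, f = unaryFact f.rel p ∧ (f.rel.arity = 0 → p = []) := by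
  obtain ⟨⟨i, n⟩, x⟩ := f
  change n ≤ 1 at h
  rcases Nat.le_one_iff_eq_zero_or_eq_one.1 h with rfl | rfl
  · exact ⟨[], Fact.ext_getElem rfl fun k hk => absurd hk (Nat.not_lt_zero k), fun _ => rfl⟩
  · refine ⟨x ⟨0, Nat.one_pos⟩, Fact.ext_getElem rfl fun k hk _ => ?_, fun h => by simp at h⟩
    obtain rfl : k = 0 := Nat.lt_one_iff.1 hk
    rfl

theorem fact_unaryFact (R : RelName) (p : Path dom) : c.fact (unaryFact R p) =
    unaryFact (c.name R) (tuplePath c.a c.b (List.replicate R.arity (c.enc p))) := by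
  simp only [fact, unaryFact]
  rw [List.ofFn_const]

theorem eval_pairExpr (ν : Valuation dom) (e₁ e₂ : PathExpr dom) :
    PathExpr.eval ν (c.pairExpr e₁ e₂) =
      tuplePath c.a c.b [PathExpr.eval ν e₁, PathExpr.eval ν e₂] := by
  rw [pairExpr, eval_tupleExpr]; rfl

theorem mem_encFact_image {X : Set (Path dom)} {p q : Path dom}
    (h : unaryFact c.en (tuplePath c.a c.b [p, q]) ∈ c.encFact '' X) : p ∈ X ∧ q = c.enc p := by
  obtain ⟨p', hp', h⟩ := h
  have := tupleCode_inj c.value_ne (by simp) (unaryFact_inj rfl h)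
  simp only [List.cons.injEq, and_true] at this
  obtain ⟨rfl, rfl⟩ := this
  exact ⟨hp', rfl⟩

theorem id_lt_ne {R : RelName} (h : R.id < c.fresh) :
    R ≠ c.sub ∧ R ≠ c.wf ∧ R ≠ c.en ∧ ∀ R', R ≠ c.name R' := by
  refine ⟨?_, ?_, ?_, fun R' => ?_⟩
  all_goals
    rintro rfl
    simp [sub, wf, en, name] at h
  omega

theorem scan_step {K : Set (Fact dom)} {R : RelName} {e : PathExpr dom}
    (h : (c.scanRule R e).SatisfiedIn K) {p z : Path dom} {x : dom} (hp : c.encFact p ∈ K)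
    (hR : unaryFact R (PathExpr.eval
      ⟨fun _ => x, fun n => if n = 0 then p else if n = 1 then c.enc p else z⟩ e) ∈ K) :
    c.encFact (p ++ [.atom x]) ∈ K := by
  have := h ⟨fun _ => x, fun n => if n = 0 then p else if n = 1 then c.enc p else z⟩ (by
    simp only [scanRule, List.mem_cons, List.not_mem_nil, or_false, forall_eq_or_imp, forall_eq,
      ulit_sat]
    refine ⟨?_, hR⟩
    rw [eval_pairExpr]
    simpa [encFact, Valuation.val] using hp)
  simp only [scanRule, unaryPred_eval, eval_pairExpr] at this
  simpa [encFact, Valuation.val] using this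

/-- The paths whose codes are computed from the input. -/
def inputPrefixes (I : Set (Fact dom)) : Set (Path dom) :=
  {p | p = [] ∨ ∃ R q, R.arity = 1 ∧ unaryFact R q ∈ I ∧ p <+: q}

theorem finite_prefixes {I : Set (Fact dom)} (hI : I.Finite) :
    (inputPrefixes I).Finite := by
  refine ((Set.finite_singleton []).union (hI.biUnion fun f _ =>
    finite_setOf_isInfix ((List.ofFn f.args).getD 0 []))).subset ?_
  rintro p (rfl | ⟨R, q, hR, hq, hp⟩)
  · exact .inl rfl
  · refine .inr ?_
    simp only [Set.mem_iUnion]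
    refine ⟨_, hq, ?_⟩
    have : (List.ofFn (unaryFact R q).args).getD 0 [] = q := by
      obtain ⟨i, n⟩ := R
      obtain rfl : n = 1 := hR
      rfl
    rw [this]
    exact hp.isInfix

/-- The facts that remain from the coding of the input. -/
def residue (I : Set (Fact dom)) : Set (Fact dom) := I ∪ c.encFact '' inputPrefixes I

theorem state_residue (I J : Set (Fact dom)) :
    c.state (c.residue I) J ∅ = I ∪ c.encFact '' inputPrefixes I ∪ c.fact '' J := by
  simp [state, residue]

/-- The scan advances along `q` by one atomic value at a time, starting from the empty prefix. -/
theorem encFact_mem {K : Set (Fact dom)} (h₀ : c.encFact [] ∈ K) {q : Path dom}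
    (hq : IsFlatPath q)
    (hstep : ∀ p x z, q = p ++ .atom x :: z → c.encFact p ∈ K → c.encFact (p ++ [.atom x]) ∈ K)
    (p : Path dom) : p <+: q → c.encFact p ∈ K := by
  induction p using List.reverseRecOn with
  | nil => exact fun _ => h₀
  | append_singleton p v ih =>
    rintro ⟨z, rfl⟩
    obtain ⟨x, rfl⟩ := hq v (by simp)
    exact hstep p x z (by simp) (ih ⟨.atom x :: z, by simp⟩)

variable {Γ : Schema} {S : RelName}

/-- The scan rule extends a path and its code in parallel, so only correct pairs arise. It extends
them only along prefixes of input paths, so finitely many arise. The simulation then starts with no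
collected subpaths. -/
theorem encodeStratum_result (hΓ : Γ.Monadic) (hfresh : ∀ R ∈ Γ, R.id < c.fresh)
    {I : Set (Fact dom)} (hI : IsInstance Γ I) (hflat : IsFlat I) :
    StratumResult (c.encodeStratum Γ) I (c.state (c.residue I) I ∅) := by
  rw [state_residue]
  have hmemI : ∀ g ∈ I ∪ c.encFact '' inputPrefixes I ∪ c.fact '' I, g.rel ∈ Γ → g ∈ I := by
    rintro g ((hg | ⟨p, _, rfl⟩) | ⟨f, _, rfl⟩) hR
    · exact hg
    · exact absurd rfl (c.id_lt_ne (hfresh _ hR)).2.2.1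
    · exact absurd rfl ((c.id_lt_ne (hfresh _ hR)).2.2.2 _)
  have hmemE : ∀ g ∈ I ∪ c.encFact '' inputPrefixes I ∪ c.fact '' I, g.rel = c.en →
      g ∈ c.encFact '' inputPrefixes I := by
    rintro g ((hg | hg) | ⟨f, _, rfl⟩) hR
    · exact absurd hR (c.id_lt_ne (hfresh _ (hI.2 g hg))).2.2.1
    · exact hg
    · exact absurd hR (c.name_ne_en _)
  refine ⟨⟨?_, ?_, ?_, ?_⟩, ?_⟩
  · exact (hI.1.union ((finite_prefixes hI.1).image _)).union (hI.1.image _)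
  · exact fun f hf => .inl (.inl hf)
  · rintro g ((hg | ⟨p, _, rfl⟩) | ⟨f, hf, rfl⟩) hhead
    · exact hg
    · exact absurd rfl (hhead _ (c.mem_encodeStratum.2 (.inl rfl)))
    · exact absurd rfl (hhead _ (c.mem_encodeStratum.2 (.inr (.inr ⟨f.rel, hI.2 f hf, rfl⟩))))
  · intro r hr ν hν
    rcases c.mem_encodeStratum.1 hr with rfl | ⟨R, hR, hR1, rfl⟩ | ⟨R, hR, rfl⟩
    · refine .inl (.inr ⟨[], .inl rfl, ?_⟩)
      simp [emptyRule, unaryPred_eval, encFact, eval_pairExpr]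
    · simp only [scanRule, List.mem_cons, List.not_mem_nil, or_false, forall_eq_or_imp, forall_eq,
        ulit_sat, eval_pairExpr] at hν
      have h₁ := c.mem_encFact_image (hmemE _ hν.1 rfl)
      have h₂ := hmemI _ hν.2 hR
      simp only [PathExpr.eval_cons, Item.eval_var, Valuation.val, PathExpr.eval_nil,
        List.append_nil] at h₁ h₂
      refine .inl (.inr ⟨ν.path 0 ++ [.atom (ν.atomic 0)], .inr ⟨R, _, hR1, h₂, ν.path 2, by simp⟩,
        ?_⟩)
      simp [scanRule, unaryPred_eval, eval_pairExpr, encFact, Valuation.val, h₁.2]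
    · simp only [encodeRule, List.mem_cons, List.not_mem_nil, or_false, forall_eq_or_imp,
        forall_eq, ulit_sat, eval_pairExpr] at hν
      have h₁ := c.mem_encFact_image (hmemE _ hν.2 rfl)
      have h₂ := hmemI _ hν.1 hR
      simp only [PathExpr.eval_cons, Item.eval_var, Valuation.val, PathExpr.eval_nil,
        List.append_nil] at h₁ h₂
      refine .inr ⟨_, h₂, ?_⟩
      rw [fact_unaryFact, encodeRule, unaryPred_eval, eval_tupleExpr]
      simp [Valuation.val, h₁.2]
  · rintro K ⟨_, hIK, _, hsat⟩
    have h₀ : c.encFact [] ∈ K := by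
      have := hsat _ (c.mem_encodeStratum.2 (.inl rfl)) ⟨fun _ => c.a, fun _ => []⟩
        (by simp [emptyRule])
      simpa [emptyRule, unaryPred_eval, encFact, eval_pairExpr] using this
    have hE : ∀ p ∈ inputPrefixes I, c.encFact p ∈ K := by
      rintro p (rfl | ⟨R, q, hR, hq, hp⟩)
      · exact h₀
      · have hqf : IsFlatPath q := hflat _ hq ⟨0, by simp [unaryFact, hR]⟩
        refine c.encFact_mem h₀ hqf ?_ p hp
        rintro p x z rfl hpK
        refine c.scan_step (z := z)
          (hsat _ (c.mem_encodeStratum.2 (.inr (.inl ⟨R, hI.2 _ hq, hR, rfl⟩)))) hpK ?_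
        simpa [Valuation.val] using hIK hq
    rintro g ((hg | ⟨p, hp, rfl⟩) | ⟨f, hf, rfl⟩)
    · exact hIK hg
    · exact hE p hp
    · obtain ⟨p, hfp, hp0⟩ := exists_unaryFact (hΓ _ (hI.2 f hf))
      -- For a nullary fact the dummy path is empty, and the code of the empty path is available on
      -- every input.
      have hp : p ∈ inputPrefixes I := by
        rcases Nat.le_one_iff_eq_zero_or_eq_one.1 (hΓ _ (hI.2 f hf)) with h | h
        · exact .inl (hp0 h)
        · exact .inr ⟨f.rel, p, h, hfp ▸ hf, List.prefix_rfl⟩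
      have := hsat _ (c.mem_encodeStratum.2 (.inr (.inr ⟨f.rel, hI.2 f hf, rfl⟩)))
        ⟨fun _ => c.a, fun n => if n = 0 then p else c.enc p⟩ (by
          simp only [encodeRule, List.mem_cons, List.not_mem_nil, or_false, forall_eq_or_imp,
            forall_eq, ulit_sat, eval_pairExpr]
          refine ⟨?_, ?_⟩
          · simpa [Valuation.val] using hfp ▸ hIK hf
          · simpa [Valuation.val, encFact] using hE p hp)
      rw [encodeRule, unaryPred_eval, eval_tupleExpr] at this
      rw [hfp, fact_unaryFact]
      simpa [Valuation.val] using this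

theorem foreign_residue (hfresh : ∀ R ∈ Γ, R.id < c.fresh) {I : Set (Fact dom)}
    (hI : IsInstance Γ I) : c.Foreign (c.residue I) := by
  rintro f (hf | ⟨p, _, rfl⟩)
  · have := c.id_lt_ne (hfresh _ (hI.2 f hf))
    exact ⟨this.1, this.2.1, this.2.2.2⟩
  · exact ⟨c.sub_ne_en.symm, c.wf_ne_en.symm, fun R => (c.name_ne_en R).symm⟩

/-- Decoding runs the same scan, now driven by codes: each step reads the next block `a x` of a
coded output path. It relies on the output being flat. -/
theorem decodeStratum_result (hfresh : ∀ R ∈ Γ, R.id < c.fresh) (hSfresh : S.id < c.fresh)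
    (hS : S.arity ≤ 1) (hSΓ : S ∉ Γ) {I J : Set (Fact dom)} (hI : IsInstance Γ I) {A : Set (Path dom)}
    (hfin : J.Finite) (hA : A.Finite) (hflat : ∀ f ∈ J, f.rel = S → ∀ i, IsFlatPath (f.args i)) :
    ∃ K, StratumResult (c.decodeStratum S) (c.state (c.residue I) J A) K ∧
      {f ∈ K | f.rel = S} = {f ∈ J | f.rel = S} := by
  have hC := c.foreign_residue hfresh hI
  set Y : Set (Path dom) := {p | ∃ q, S.arity = 1 ∧ unaryFact S q ∈ J ∧ p <+: q} with hY
  set K : Set (Fact dom) :=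
    c.state (c.residue I) J A ∪ c.encFact '' Y ∪ {f ∈ J | f.rel = S} with hK
  have hSne := c.id_lt_ne hSfresh
  have hYfin : Y.Finite := (finite_prefixes hfin).subset fun p ⟨q, h⟩ => .inr ⟨S, q, h⟩
  have hmemN : ∀ g ∈ K, ∀ f : Fact dom, g = c.fact f → f ∈ J := by
    rintro g ((hg | ⟨p, _, rfl⟩) | hg) f hf
    · rw [hf] at hg
      exact (c.fact_mem_state hC).1 hg
    · exact absurd (congrArg Fact.rel hf).symm (c.name_ne_en _)
    · rw [hf] at hg
      exact absurd hg.2.symm (hSne.2.2.2 _)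
  have hmemN' : ∀ g ∈ K, g.rel = c.name S → ∃ f ∈ J, f.rel = S ∧ g = c.fact f := by
    rintro g ((hg | ⟨p, _, rfl⟩) | hg) hR
    · obtain ⟨f, hf, rfl⟩ := (c.mem_state_of_name hC hR).1 hg
      exact ⟨f, hf, c.name_injective hR, rfl⟩
    · exact absurd hR.symm (c.name_ne_en _)
    · exact absurd (hg.2.symm.trans hR) (hSne.2.2.2 _)
  -- Pairs left over from coding the input are still present; being correct pairs, they cannot
  -- mislead the decoding.
  have hmemE : ∀ g ∈ K, g.rel = c.en → g ∈ c.encFact '' (inputPrefixes I ∪ Y) := by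
    rintro g ((hg | hg) | hg) hR
    · rcases hg with (((hg | hg) | ⟨f, _, rfl⟩) | ⟨p, _, rfl⟩) | ⟨p, _, rfl⟩
      · exact absurd hR (c.id_lt_ne (hfresh _ (hI.2 g hg))).2.2.1
      · exact Set.image_mono Set.subset_union_left hg
      · exact absurd hR (c.name_ne_en _)
      · exact absurd hR c.sub_ne_en
      · exact absurd hR c.wf_ne_en
    · exact Set.image_mono Set.subset_union_right hg
    · exact absurd (hg.2.symm.trans hR) hSne.2.2.1
  refine ⟨K, ⟨⟨?_, ?_, ?_, ?_⟩, ?_⟩, ?_⟩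
  · exact ((c.finite_state (hI.1.union ((finite_prefixes hI.1).image _)) hfin hA).union
      (hYfin.image _)).union (hfin.subset (Set.sep_subset _ _))
  · exact fun f hf => .inl (.inl hf)
  · rintro g ((hg | ⟨p, _, rfl⟩) | hg) hhead
    · exact hg
    · exact absurd rfl (hhead _ (c.mem_decodeStratum.2 (.inl rfl)))
    · exact absurd hg.2.symm (hhead _ (c.mem_decodeStratum.2 (.inr rfl)))
  · intro r hr ν hν
    rcases c.mem_decodeStratum.1 hr with rfl | rfl
    · simp only [scanRule, List.mem_cons, List.not_mem_nil, or_false, forall_eq_or_imp, forall_eq,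
        ulit_sat, eval_tupleExpr, List.map_cons, List.map_nil] at hν
      have h₁ := c.mem_encFact_image (hmemE _ hν.1 rfl)
      obtain ⟨f, hf, hfS, h₂⟩ := hmemN' _ hν.2 rfl
      obtain ⟨q, hfq, -⟩ := exists_unaryFact (f := f) (hfS ▸ hS)
      rw [hfS] at hfq
      subst hfq
      rw [fact_unaryFact] at h₂
      have h₃ := unaryFact_inj rfl h₂
      simp only [PathExpr.eval_cons, Item.eval_var, Item.eval_const, Valuation.val,
        PathExpr.eval_nil, List.append_nil] at h₁ h₃
      rcases Nat.le_one_iff_eq_zero_or_eq_one.1 hS with h | h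
      -- For nullary `S` the coded output fact carries the empty path, which the nonempty tuple in
      -- the scan rule cannot match.
      · rw [h] at h₃
        simp [tupleCode, pairCode] at h₃
      · rw [h] at h₃
        have h₄ := tupleCode_inj c.value_ne (by simp) h₃
        simp only [List.replicate_one, List.cons.injEq, and_true] at h₄
        rw [h₁.2] at h₄
        have hqf : IsFlatPath q := hflat _ hf rfl ⟨0, by simp [unaryFact, h]⟩
        -- The code already scanned is a prefix of the code of `q`, so the path already decoded is a
        -- prefix of `q` and the next atomic value is that of `q`.
        obtain ⟨t', rfl, ht'⟩ := c.eq_append_of_enc hqf h₄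
        cases t' with
        | nil => simp at ht'
        | cons v t' =>
          obtain ⟨y, rfl⟩ := hqf v (by simp)
          simp only [List.singleton_append, enc_atom, List.cons.injEq, true_and] at ht'
          refine .inl (.inr ⟨ν.path 0 ++ [.atom (ν.atomic 0)], ⟨_, h, hf, t', ?_⟩, ?_⟩)
          · simp [ht'.1]
          · simp [scanRule, unaryPred_eval, eval_pairExpr, encFact, Valuation.val, h₁.2]
    · simp only [decodeRule, List.mem_cons, List.not_mem_nil, or_false, forall_eq_or_imp,
        forall_eq, ulit_sat, eval_tupleExpr, List.map_replicate] at hν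
      have h₁ := c.mem_encFact_image (hmemE _ hν.2 rfl)
      simp only [PathExpr.eval_cons, Item.eval_var, Valuation.val, PathExpr.eval_nil,
        List.append_nil] at h₁ hν
      rw [h₁.2, ← fact_unaryFact] at hν
      refine .inr ⟨?_, rfl⟩
      have := hmemN _ hν.1 _ rfl
      simpa [decodeRule, unaryPred_eval, Valuation.val] using this
  · rintro K' ⟨_, hIK, _, hsat⟩
    -- The starting pair of the scan is inherited from the stratum that codes the input.
    have h₀ : c.encFact [] ∈ K' := hIK (.inl (.inl (.inl (.inr ⟨[], .inl rfl, rfl⟩))))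
    have hE : ∀ p ∈ Y, c.encFact p ∈ K' := by
      rintro p ⟨q, hS1, hq, hp⟩
      have hqf : IsFlatPath q := hflat _ hq rfl ⟨0, by simp [unaryFact, hS1]⟩
      refine c.encFact_mem h₀ hqf ?_ p hp
      rintro p x z rfl hpK
      refine c.scan_step (z := c.enc z) (hsat _ (c.mem_decodeStratum.2 (.inl rfl))) hpK ?_
      have : c.fact (unaryFact S (p ++ .atom x :: z)) ∈ K' :=
        hIK ((c.fact_mem_state hC).2 hq)
      rw [fact_unaryFact, hS1] at this
      rw [eval_tupleExpr]
      simpa [Valuation.val] using this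
    rintro g ((hg | ⟨p, hp, rfl⟩) | ⟨hg, hgS⟩)
    · exact hIK hg
    · exact hE p hp
    · obtain ⟨p, hgp, hp0⟩ := exists_unaryFact (f := g) (hgS ▸ hS)
      rw [hgS] at hgp hp0
      have hpE : c.encFact p ∈ K' := by
        rcases Nat.le_one_iff_eq_zero_or_eq_one.1 hS with h | h
        · rw [hp0 h]; exact h₀
        · exact hE p ⟨p, h, hgp ▸ hg, List.prefix_rfl⟩
      have := hsat _ (c.mem_decodeStratum.2 (.inr rfl))
        ⟨fun _ => c.a, fun n => if n = 0 then p else c.enc p⟩ (by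
          simp only [decodeRule, List.mem_cons, List.not_mem_nil, or_false, forall_eq_or_imp,
            forall_eq, ulit_sat, eval_tupleExpr, List.map_replicate]
          refine ⟨?_, ?_⟩
          · have : c.fact g ∈ K' := hIK ((c.fact_mem_state hC).2 hg)
            rw [hgp, fact_unaryFact] at this
            simpa [Valuation.val] using this
          · simpa [Valuation.val, encFact] using hpE)
      rw [hgp]
      simpa [decodeRule, unaryPred_eval, Valuation.val] using this
  · ext g
    constructor
    · rintro ⟨(hg | ⟨p, _, rfl⟩) | hg, hgS⟩
      · rcases hg with (((hg | ⟨p, _, rfl⟩) | ⟨f, _, rfl⟩) | ⟨p, _, rfl⟩) | ⟨p, _, rfl⟩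
        · exact absurd (hgS ▸ hI.2 g hg) hSΓ
        · exact absurd hgS.symm hSne.2.2.1
        · exact absurd hgS.symm (hSne.2.2.2 _)
        · exact absurd hgS.symm hSne.1
        · exact absurd hgS.symm hSne.2.1
      · exact absurd hgS.symm hSne.2.2.1
      · exact hg
    · intro hg
      exact ⟨.inr hg, hg.2⟩

end CodeContext

theorem StrataResult.finite : ∀ {ss : List (Stratum dom)} {I J : Set (Fact dom)},
    StrataResult ss I J → I.Finite → J.Finite
  | [], I, J, h, hI => by
    obtain rfl : J = I := h
    exact hI
  | s :: ss, I, J, ⟨K, hK, hJ⟩, _ => StrataResult.finite hJ hK.1.1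

theorem StrataResult.append : ∀ {ss : List (Stratum dom)} {s : Stratum dom}
    {I J K : Set (Fact dom)}, StrataResult ss I J → StratumResult s J K →
    StrataResult (ss ++ [s]) I K
  | [], s, I, J, K, h, hs => by
    obtain rfl : J = I := h
    exact ⟨K, hs, rfl⟩
  | t :: ss, s, I, J, K, ⟨L, hL, hJ⟩, hs => ⟨L, hL, StrataResult.append hJ hs⟩

/-! ### The program that works on codes -/

namespace CodeContext

variable (c : CodeContext dom) {Γ : Schema} {S : RelName}

theorem safe_of_ulits {r : Rule dom} (h : ∀ e ∈ r.exprs, ∀ x ∈ PathExpr.vars e,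
    ∃ R e', R.arity = 1 ∧ ulit R e' ∈ r.body ∧ x ∈ PathExpr.vars e') : r.Safe := by
  intro e he x hx
  obtain ⟨R, e', hR, hb, hx⟩ := h e he x hx
  exact .pred _ hb e' (mem_exprs_unaryPred hR e') x hx

theorem scanRule_safe {R : RelName} (hR : R.arity = 1) {e : PathExpr dom}
    (he : Var.atomic 0 ∈ PathExpr.vars e) (hpack : ¬ PathExpr.HasPack e) :
    (c.scanRule R e).Safe ∧ ∀ e' ∈ (c.scanRule R e).exprs, ¬ PathExpr.HasPack e' := by
  constructor
  · apply safe_of_ulits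
    rintro e' (he' | ⟨L, hL, he'⟩) x hx
    · obtain rfl := eq_of_mem_exprs_unaryPred he'
      obtain ⟨e₁, he₁, hx⟩ := (mem_vars_tupleExpr _ _ _ _).1 hx
      have hx' : x = .path 0 ∨ x = .path 1 ∨ x = .atomic 0 := by
        simp only [List.mem_cons, List.not_mem_nil, or_false] at he₁
        rcases he₁ with rfl | rfl <;> simp at hx <;> tauto
      rcases hx' with rfl | rfl | rfl
      · exact ⟨c.en, _, rfl, List.mem_cons_self, by simp [mem_vars_tupleExpr]⟩
      · exact ⟨c.en, _, rfl, List.mem_cons_self, by simp [mem_vars_tupleExpr]⟩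
      · exact ⟨R, e, hR, by simp [scanRule], he⟩
    · simp only [scanRule, List.mem_cons, List.not_mem_nil, or_false] at hL
      rcases hL with rfl | rfl
      · obtain rfl := ulit_exprs he'
        exact ⟨c.en, _, rfl, List.mem_cons_self, hx⟩
      · obtain rfl := ulit_exprs he'
        exact ⟨R, e', hR, by simp [scanRule], hx⟩
  · rintro e' (he' | ⟨L, hL, he'⟩)
    · obtain rfl := eq_of_mem_exprs_unaryPred he'
      simp [tupleCode, pairCode, PathExpr.HasPack]
    · simp only [scanRule, List.mem_cons, List.not_mem_nil, or_false] at hL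
      rcases hL with rfl | rfl
      · obtain rfl := ulit_exprs he'
        simp [tupleCode, pairCode, PathExpr.HasPack]
      · obtain rfl := ulit_exprs he'
        exact hpack

theorem not_hasPack_replicate (n : ℕ) :
    ¬ PathExpr.HasPack (tupleExpr c.a c.b (List.replicate n [pv 1])) :=
  not_hasPack_tupleExpr _ _ fun e he => by
    obtain rfl := List.eq_of_mem_replicate he
    simp [PathExpr.HasPack]

theorem mem_vars_replicate {n : ℕ} {x : Var}
    (h : x ∈ PathExpr.vars (tupleExpr c.a c.b (List.replicate n [pv 1]))) : x = .path 1 := by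
  obtain ⟨e, he, hx⟩ := (mem_vars_tupleExpr _ _ _ _).1 h
  obtain rfl := List.eq_of_mem_replicate he
  simpa using hx

theorem safe_of_en {r : Rule dom} (hen : ulit c.en (c.pairExpr [pv 0] [pv 1]) ∈ r.body)
    (h : ∀ e ∈ r.exprs, ∀ x ∈ PathExpr.vars e, x = .path 0 ∨ x = .path 1) : r.Safe := by
  refine safe_of_ulits fun e he x hx => ⟨c.en, _, rfl, hen, ?_⟩
  rcases h e he x hx with rfl | rfl <;> simp [mem_vars_tupleExpr]

theorem encodeRule_safe (R : RelName) :
    (c.encodeRule R).Safe ∧ ∀ e' ∈ (c.encodeRule R).exprs, ¬ PathExpr.HasPack e' := by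
  have : ∀ e' ∈ (c.encodeRule R).exprs,
      (∀ x ∈ PathExpr.vars e', x = .path 0 ∨ x = .path 1) ∧ ¬ PathExpr.HasPack e' := by
    rintro e' (he' | ⟨L, hL, he'⟩)
    · obtain rfl := eq_of_mem_exprs_unaryPred he'
      exact ⟨fun x hx => .inr (c.mem_vars_replicate hx), c.not_hasPack_replicate _⟩
    · simp only [encodeRule, List.mem_cons, List.not_mem_nil, or_false] at hL
      rcases hL with rfl | rfl
      · obtain rfl := ulit_exprs he'
        simp [PathExpr.HasPack]
      · obtain rfl := ulit_exprs he'
        simp [tupleCode, pairCode, PathExpr.HasPack]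
  exact ⟨c.safe_of_en (by simp [encodeRule]) fun e he => (this e he).1, fun e he => (this e he).2⟩

theorem decodeRule_safe (R : RelName) :
    (c.decodeRule R).Safe ∧ ∀ e' ∈ (c.decodeRule R).exprs, ¬ PathExpr.HasPack e' := by
  have : ∀ e' ∈ (c.decodeRule R).exprs,
      (∀ x ∈ PathExpr.vars e', x = .path 0 ∨ x = .path 1) ∧ ¬ PathExpr.HasPack e' := by
    rintro e' (he' | ⟨L, hL, he'⟩)
    · obtain rfl := eq_of_mem_exprs_unaryPred he'
      simp [PathExpr.HasPack]
    · simp only [decodeRule, List.mem_cons, List.not_mem_nil, or_false] at hL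
      rcases hL with rfl | rfl
      · obtain rfl := ulit_exprs he'
        exact ⟨fun x hx => .inr (c.mem_vars_replicate hx), c.not_hasPack_replicate _⟩
      · obtain rfl := ulit_exprs he'
        simp [tupleCode, pairCode, PathExpr.HasPack]
  exact ⟨c.safe_of_en (by simp [decodeRule]) fun e he => (this e he).1, fun e he => (this e he).2⟩

theorem emptyRule_safe :
    c.emptyRule.Safe ∧ ∀ e' ∈ c.emptyRule.exprs, ¬ PathExpr.HasPack e' := by
  have : ∀ e' ∈ c.emptyRule.exprs, PathExpr.vars e' = ∅ ∧ ¬ PathExpr.HasPack e' := by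
    rintro e' (he' | ⟨L, hL, he'⟩)
    · obtain rfl := eq_of_mem_exprs_unaryPred he'
      simp [tupleCode, pairCode, PathExpr.HasPack]
    · simp [emptyRule] at hL
  exact ⟨fun e he x hx => by simp [(this e he).1] at hx, fun e he => (this e he).2⟩

theorem encodeStratum_safe {r : Rule dom} (hr : r ∈ c.encodeStratum Γ) :
    r.Safe ∧ ∀ e ∈ r.exprs, ¬ PathExpr.HasPack e := by
  rcases c.mem_encodeStratum.1 hr with rfl | ⟨R, _, hR, rfl⟩ | ⟨R, _, rfl⟩
  · exact c.emptyRule_safe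
  · exact c.scanRule_safe hR (by simp) (by simp [PathExpr.HasPack])
  · exact c.encodeRule_safe R

theorem decodeStratum_safe {r : Rule dom} (hr : r ∈ c.decodeStratum S) :
    r.Safe ∧ ∀ e ∈ r.exprs, ¬ PathExpr.HasPack e := by
  rcases c.mem_decodeStratum.1 hr with rfl | rfl
  · exact c.scanRule_safe rfl (by simp [mem_vars_tupleExpr])
      (by simp [tupleCode, pairCode, PathExpr.HasPack])
  · exact c.decodeRule_safe S

theorem encodeStratum_body {r : Rule dom} (hr : r ∈ c.encodeStratum Γ) :
    (r.head.rel = c.en ∨ ∃ R ∈ Γ, r.head.rel = c.name R) ∧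
    ∀ L ∈ r.body, ∃ R e, L = ulit R e ∧ (R = c.en ∨ R ∈ Γ) := by
  rcases c.mem_encodeStratum.1 hr with rfl | ⟨R, hRΓ, hR, rfl⟩ | ⟨R, hRΓ, rfl⟩
  · exact ⟨.inl rfl, by simp [emptyRule]⟩
  · refine ⟨.inl rfl, fun L hL => ?_⟩
    simp only [scanRule, List.mem_cons, List.not_mem_nil, or_false] at hL
    rcases hL with rfl | rfl
    · exact ⟨_, _, rfl, .inl rfl⟩
    · exact ⟨_, _, rfl, .inr hRΓ⟩
  · refine ⟨.inr ⟨R, hRΓ, rfl⟩, fun L hL => ?_⟩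
    simp only [encodeRule, List.mem_cons, List.not_mem_nil, or_false] at hL
    rcases hL with rfl | rfl
    · exact ⟨_, _, rfl, .inr hRΓ⟩
    · exact ⟨_, _, rfl, .inl rfl⟩

theorem decodeStratum_body {r : Rule dom} (hr : r ∈ c.decodeStratum S) :
    (r.head.rel = c.en ∨ r.head.rel = S) ∧
    ∀ L ∈ r.body, ∃ R e, L = ulit R e ∧ (R = c.en ∨ R = c.name S) := by
  rcases c.mem_decodeStratum.1 hr with rfl | rfl
  · refine ⟨.inl rfl, fun L hL => ?_⟩
    simp only [scanRule, List.mem_cons, List.not_mem_nil, or_false] at hL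
    rcases hL with rfl | rfl
    · exact ⟨_, _, rfl, .inl rfl⟩
    · exact ⟨_, _, rfl, .inr rfl⟩
  · refine ⟨.inr rfl, fun L hL => ?_⟩
    simp only [decodeRule, List.mem_cons, List.not_mem_nil, or_false] at hL
    rcases hL with rfl | rfl
    · exact ⟨_, _, rfl, .inr rfl⟩
    · exact ⟨_, _, rfl, .inl rfl⟩

theorem stratum_body {s : Stratum dom} {r' : Rule dom} (hr' : r' ∈ c.stratum s) :
    ∀ L' ∈ r'.body, (∃ R e, L' = ulit R e ∧ (R = c.sub ∨ R = c.wf)) ∨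
      ∃ r ∈ s, ∃ L ∈ r.body, L' = c.lit L := by
  intro L' hL'
  rcases c.mem_stratum.1 hr' with h | ⟨r, hr, rfl⟩ | ⟨r, hr, x, hx, rfl⟩
  · left
    simp only [structRules, List.mem_cons, List.not_mem_nil, or_false] at h
    rcases h with rfl | rfl | rfl | rfl <;>
      simp only [List.mem_cons, List.not_mem_nil, or_false] at hL'
    · exact ⟨_, _, hL', .inl rfl⟩
    · exact ⟨_, _, hL', .inl rfl⟩
    · rcases hL' with h | h
      · exact ⟨_, _, h, .inr rfl⟩
      · exact ⟨_, _, h, .inl rfl⟩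
    · rcases hL' with h | h | h
      · exact ⟨_, _, h, .inr rfl⟩
      · exact ⟨_, _, h, .inr rfl⟩
      · exact ⟨_, _, h, .inl rfl⟩
  · rcases List.mem_append.1 hL' with h | h
    · obtain ⟨L, hL, rfl⟩ := List.mem_map.1 h
      exact .inr ⟨r, hr, L, hL, rfl⟩
    · obtain ⟨x, _, rfl⟩ := List.mem_map.1 h
      exact .inl ⟨_, _, rfl, .inr rfl⟩
  · obtain ⟨L, hL, rfl⟩ := List.mem_map.1 hL'
    exact .inr ⟨r, hr, L, hL, rfl⟩

theorem stratum_neg {s : Stratum dom} {r' : Rule dom} (hr' : r' ∈ c.stratum s) {A' : Atom dom}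
    (h : Literal.neg A' ∈ r'.body) :
    ∃ r ∈ s, ∃ A, Literal.neg A ∈ r.body ∧ A' = c.atom A := by
  rcases c.stratum_body hr' _ h with ⟨R, e, h, _⟩ | ⟨r, hr, L, hL, h⟩
  · cases h
  · cases L with
    | pos A => cases h
    | neg A => exact ⟨r, hr, A, hL, Literal.neg.inj h⟩

/-- The added rules contain no negation, and all negated names are codes of names; the heads `sub`,
`wf`, `en` and `S` are not. -/
theorem stratified_strata (hSfresh : S.id < c.fresh) : ∀ {ss : List (Stratum dom)},
    Stratified ss → Stratified (ss.map c.stratum ++ [c.decodeStratum S])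
  | [], _ => by
    refine ⟨fun r hr P hP => ?_, trivial⟩
    obtain ⟨R, e, h, _⟩ := (c.decodeStratum_body hr).2 _ hP
    cases h
  | s :: ss, h => by
    refine ⟨fun r' hr' P' hP' s₁ hs₁ r₁ hr₁ heq => ?_, stratified_strata hSfresh h.2⟩
    obtain ⟨r, hr, A, hA, hPA⟩ := c.stratum_neg hr' hP'
    cases A with
    | eq e₁ e₂ => cases hPA
    | pred P =>
      obtain rfl : P' = c.pred P := Atom.pred.inj hPA
      have heq : r₁.head.rel = c.name P.rel := heq
      have hs₁ : s₁ ∈ (s :: ss).map c.stratum ++ [c.decodeStratum S] := hs₁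
      rw [List.mem_append, List.mem_map, List.mem_singleton] at hs₁
      rcases hs₁ with ⟨s₂, hs₂, rfl⟩ | rfl
      · rcases c.stratum_head hr₁ with h' | h' | ⟨r₂, hr₂, h'⟩
        · exact c.name_ne_sub _ (heq.symm.trans h')
        · exact c.name_ne_wf _ (heq.symm.trans h')
        · exact h.1 r hr P hA s₂ hs₂ r₂ hr₂ (c.name_injective (h'.symm.trans heq))
      · rcases (c.decodeStratum_body hr₁).1 with h' | h'
        · exact c.name_ne_en _ (heq.symm.trans h')
        · exact (c.id_lt_ne hSfresh).2.2.2 _ (h'.symm.trans heq)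

/-- Translation of programs. -/
noncomputable def program (Γ : Schema) (hSfresh : S.id < c.fresh) (P : Program dom) :
    Program dom where
  strata := c.encodeStratum Γ :: (P.strata.map c.stratum ++ [c.decodeStratum S])
  safe := by
    intro s hs r hr
    rw [List.mem_cons, List.mem_append, List.mem_map, List.mem_singleton] at hs
    rcases hs with rfl | ⟨s, hs, rfl⟩ | rfl
    · exact (c.encodeStratum_safe hr).1
    · exact c.stratum_safe (P.safe s hs) hr
    · exact (c.decodeStratum_safe hr).1
  stratified := by
    refine ⟨fun r hr P hP => ?_, c.stratified_strata hSfresh P.stratified⟩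
    obtain ⟨R, e, h, _⟩ := (c.encodeStratum_body hr).2 _ hP
    cases h

theorem mem_program_rules (hSfresh : S.id < c.fresh) {P : Program dom} {r : Rule dom} :
    r ∈ (c.program Γ hSfresh P).rules ↔ r ∈ c.encodeStratum Γ ∨
      (∃ s ∈ P.strata, r ∈ c.stratum s) ∨ r ∈ c.decodeStratum S := by
  simp [Program.rules, program, or_and_right, exists_or]

end CodeContext

-- Elimination of packing with intermediate names and recursion

/-- In the presence of intermediate names and recursion, packing can be eliminated. -/
theorem computableIn_of_recursion [Infinite dom] {Γ : Schema} {S : RelName} {Q : Query dom Γ S}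
    {F : Fragment} {P : Program dom} (hPF : P.BelongsTo F) (hP : P.Computes Q)
    (hI : Feature.intermediate ∈ F) (hR : Feature.recursion ∈ F) :
    ComputableIn (F \ {Feature.packing}) Q := by
  classical
  obtain ⟨a, b, hab⟩ := exists_pair_ne dom
  obtain ⟨M, hM⟩ : ∃ M, ∀ R ∈ insert S Γ, R.id < M := by
    obtain ⟨M, hM⟩ := exists_uniform_bound (insert S Γ : Finset RelName).finite_toSet
      (p := fun R b => R.id < b) (fun _ _ _ h h' => h'.trans_le h)
      fun R _ => ⟨R.id + 1, by omega⟩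
    exact ⟨M, fun R hR => hM R (by exact_mod_cast hR)⟩
  let c : CodeContext dom := ⟨a, b, hab, M⟩
  have hSfresh : S.id < c.fresh := hM S (Finset.mem_insert_self _ _)
  have hfresh : ∀ R ∈ Γ, R.id < c.fresh := fun R hR => hM R (Finset.mem_insert_of_mem hR)
  obtain ⟨hover, hSidb, hres⟩ := hP
  have hrules := fun r => c.mem_program_rules (Γ := Γ) hSfresh (P := P) (r := r)
  have hen : c.en ∈ (c.program Γ hSfresh P).idb :=
    ⟨c.emptyRule, (hrules _).2 (.inl (c.mem_encodeStratum.2 (.inl rfl))), rfl⟩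
  have hnameΓ : ∀ R ∈ Γ, c.name R ∈ (c.program Γ hSfresh P).idb := fun R hR =>
    ⟨c.encodeRule R, (hrules _).2 (.inl (c.mem_encodeStratum.2 (.inr (.inr ⟨R, hR, rfl⟩)))), rfl⟩
  have hnameI : ∀ R ∈ P.idb, c.name R ∈ (c.program Γ hSfresh P).idb := by
    rintro _ ⟨r, ⟨s, hs, hr⟩, rfl⟩
    exact ⟨c.rule r, (hrules _).2 (.inr (.inl ⟨s, hs, c.mem_stratum.2 (.inr (.inl ⟨r, hr, rfl⟩))⟩)),
      rfl⟩
  -- A coded name is defined by translated rules if the original is an IDB name, and by the rule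
  -- that codes the input otherwise.
  have hname : ∀ r ∈ P.rules, ∀ A ∈ r.preds, c.name A.rel ∈ (c.program Γ hSfresh P).idb := by
    intro r hr A hA
    by_cases h : A.rel ∈ P.idb
    · exact hnameI _ h
    · exact hnameΓ _ (hover.1 _ ⟨⟨r, hr, A, hA, rfl⟩, h⟩)
  have hSidb' : S ∈ (c.program Γ hSfresh P).idb :=
    ⟨c.decodeRule S, (hrules _).2 (.inr (.inr (c.mem_decodeStratum.2 (.inr rfl)))), rfl⟩
  have hpreds : ∀ r ∈ (c.program Γ hSfresh P).rules, ∀ A ∈ r.preds,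
      (A.rel ∈ Γ ∨ A.rel ∈ (c.program Γ hSfresh P).idb) ∧ A.rel.arity ≤ 1 := by
    intro r' hr' A hA
    rcases hA with rfl | ⟨L', hL', hA⟩
    · refine ⟨.inr ⟨r', hr', rfl⟩, ?_⟩
      rcases (hrules _).1 hr' with h | ⟨s, hs, h⟩ | h
      · rcases (c.encodeStratum_body h).1 with h | ⟨R, _, h⟩ <;> rw [h] <;> exact le_rfl
      · rcases c.stratum_head h with h | h | ⟨R, _, h⟩ <;> rw [h] <;> exact le_rfl
      · rcases (c.decodeStratum_body h).1 with h | h <;> rw [h]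
        · exact le_rfl
        · exact Q.arity_le
    · rcases (hrules _).1 hr' with h | ⟨s, hs, h⟩ | h
      · obtain ⟨R, e, rfl, h⟩ := (c.encodeStratum_body h).2 L' hL'
        obtain rfl := Atom.pred.inj hA
        rcases h with rfl | h
        · exact ⟨.inr hen, le_rfl⟩
        · exact ⟨.inl h, Q.monadic R h⟩
      · rcases c.stratum_body h L' hL' with ⟨R, e, rfl, h'⟩ | ⟨r, hr, L, hL, rfl⟩
        · obtain rfl := Atom.pred.inj hA
          have hmem : ∀ r ∈ c.structRules, r ∈ (c.program Γ hSfresh P).rules := fun r hr =>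
            (hrules _).2 (.inr (.inl ⟨s, hs, c.mem_stratum.2 (.inl hr)⟩))
          rcases h' with rfl | rfl
          · exact ⟨.inr ⟨_, hmem _ List.mem_cons_self, rfl⟩, le_rfl⟩
          · exact ⟨.inr ⟨_, hmem _ (List.mem_cons_of_mem _ List.mem_cons_self), rfl⟩, le_rfl⟩
        · rw [c.lit_atom] at hA
          cases hLA : L.atom with
          | eq e₁ e₂ => rw [hLA] at hA; cases hA
          | pred B =>
            rw [hLA] at hA
            obtain rfl := Atom.pred.inj hA
            exact ⟨.inr (hname r ⟨s, hs, hr⟩ B (.inr ⟨L, hL, hLA⟩)), le_rfl⟩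
      · obtain ⟨R, e, rfl, h⟩ := (c.decodeStratum_body h).2 L' hL'
        obtain rfl := Atom.pred.inj hA
        rcases h with rfl | rfl
        · exact ⟨.inr hen, le_rfl⟩
        · exact ⟨.inr (hnameI _ hSidb), le_rfl⟩
  have hlits : ∀ r' ∈ (c.program Γ hSfresh P).rules, ∀ L' ∈ r'.body,
      (∃ R e, L' = CodeContext.ulit R e) ∨ ∃ r ∈ P.rules, ∃ L ∈ r.body, L' = c.lit L := by
    intro r' hr' L' hL'
    rcases (hrules _).1 hr' with h | ⟨s, hs, h⟩ | h
    · obtain ⟨R, e, h, _⟩ := (c.encodeStratum_body h).2 L' hL'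
      exact .inl ⟨R, e, h⟩
    · rcases c.stratum_body h L' hL' with ⟨R, e, h, _⟩ | ⟨r, hr, h⟩
      · exact .inl ⟨R, e, h⟩
      · exact .inr ⟨r, ⟨s, hs, hr⟩, h⟩
    · obtain ⟨R, e, h, _⟩ := (c.decodeStratum_body h).2 L' hL'
      exact .inl ⟨R, e, h⟩
  refine ⟨c.program Γ hSfresh P, ?_, ⟨?_, ?_⟩, hSidb', fun I => ?_⟩
  · intro X hX
    have hXP : X ≠ Feature.packing := by
      rintro rfl
      obtain ⟨r, hr, e, he, h⟩ := hX
      rcases (hrules _).1 hr with h' | ⟨s, hs, h'⟩ | h'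
      · exact (c.encodeStratum_safe h').2 e he h
      · exact c.stratum_exprs h' e he h
      · exact (c.decodeStratum_safe h').2 e he h
    refine ⟨?_, hXP⟩
    cases X with
    | arity =>
      obtain ⟨r, hr, A, hA, h⟩ := hX
      exact absurd (hpreds r hr A hA).2 (not_le.2 h)
    | equations =>
      obtain ⟨r', hr', L', hL', e₁, e₂, h⟩ := hX
      apply hPF Feature.equations
      rcases hlits r' hr' L' hL' with ⟨R, e, rfl⟩ | ⟨r, hr, L, hL, rfl⟩
      · cases h
      · rw [c.lit_atom] at h
        cases hLA : L.atom with
        | eq e₁ e₂ => exact ⟨r, hr, L, hL, e₁, e₂, hLA⟩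
        | pred B => rw [hLA] at h; cases h
    | intermediate => exact hI
    | negation =>
      obtain ⟨r', hr', A, hA⟩ := hX
      apply hPF Feature.negation
      rcases hlits r' hr' _ hA with ⟨R, e, h⟩ | ⟨r, hr, L, hL, h⟩
      · cases h
      · cases L with
        | pos A => cases h
        | neg A => exact ⟨r, hr, A, hL⟩
    | packing => exact absurd rfl hXP
    | recursion => exact hR
  · rintro R ⟨⟨r, hr, A, hA, rfl⟩, h⟩
    exact (hpreds r hr A hA).1.resolve_right h
  · rintro _ ⟨r, hr, rfl⟩ hΓ
    have hne := c.id_lt_ne (hfresh _ hΓ)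
    rcases (hrules _).1 hr with h | ⟨s, hs, h⟩ | h
    · rcases (c.encodeStratum_body h).1 with h | ⟨R, _, h⟩
      · exact hne.2.2.1 h
      · exact hne.2.2.2 _ h
    · rcases c.stratum_head h with h | h | ⟨R, _, h⟩
      · exact hne.1 h
      · exact hne.2.1 h
      · exact hne.2.2.2 _ h
    · rcases (c.decodeStratum_body h).1 with h | h
      · exact hne.2.2.1 h
      · exact Q.not_mem (h ▸ hΓ)
  · obtain ⟨J, hJ, hQ⟩ := hres I
    have hJfin : J.Finite := StrataResult.finite hJ I.2.1.1
    obtain ⟨A, hA, hmid⟩ := c.strataResult (c.foreign_residue hfresh I.2.1)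
      (I.2.1.1.union ((CodeContext.finite_prefixes I.2.1.1).image _)) P.stratified P.safe hJ
      Set.finite_empty
    obtain ⟨K, hK, hKS⟩ := c.decodeStratum_result hfresh hSfresh Q.arity_le Q.not_mem I.2.1 hJfin hA
      (fun f hf hfS => (Q.map I).2.2 f (by rw [← hQ]; exact ⟨hf, hfS⟩))
    refine ⟨K, ⟨_, c.encodeStratum_result Q.monadic hfresh I.2.1 I.2.2, ?_⟩, hKS.trans hQ⟩
    exact StrataResult.append hmid hK

/-! ### The constantly empty query -/

theorem stratumResult_self {s : Stratum dom} {I : Set (Fact dom)} (hI : I.Finite)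
    (h : ∀ r ∈ s, r.SatisfiedIn I) : StratumResult s I I :=
  ⟨⟨hI, subset_rfl, fun _ hf _ => hf, h⟩, fun _ hK => hK.2.1⟩

/-- A single rule that never adds a fact computes the constantly empty query. -/
theorem computableIn_of_inert_rule {Γ : Schema} {S : RelName} {Q : Query dom Γ S} {F : Fragment}
    (hQ : Q.IsConstEmpty) (r : Rule dom) (hhead : r.head.rel = S) (hsafe : r.Safe)
    (hpack : ∀ e ∈ r.exprs, ¬ PathExpr.HasPack e)
    (hpred : ∀ L ∈ r.body, ∀ A, L.atom = .pred A →
      A.rel ∈ Γ ∨ (A.rel = S ∧ Feature.recursion ∈ F ∧ L = .pos (.pred A)))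
    (hE : ∀ L ∈ r.body, ∀ e₁ e₂, L.atom = .eq e₁ e₂ → Feature.equations ∈ F)
    (hN : ∀ A, Literal.neg A ∈ r.body → Feature.negation ∈ F)
    (hsat : ∀ I : FlatInstance dom Γ, r.SatisfiedIn I.1) :
    ComputableIn (F \ {Feature.packing}) Q := by
  let P : Program dom :=
    { strata := [[r]]
      safe := by simpa using hsafe
      stratified := by
        refine ⟨?_, trivial⟩
        simp only [List.mem_singleton, forall_eq, hhead]
        rintro A hA rfl
        rcases hpred _ hA A rfl with h | ⟨_, _, h⟩
        · exact Q.not_mem h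
        · cases h }
  have hrules : ∀ r', r' ∈ P.rules ↔ r' = r := by simp [Program.rules, P]
  have hidb : ∀ R, R ∈ P.idb ↔ R = S := fun R => by
    simp [Program.idb, hrules, hhead, eq_comm]
  have hpreds : ∀ r' ∈ P.rules, ∀ A ∈ r'.preds, A.rel = S ∨ A.rel ∈ Γ := by
    intro r' hr' A hA
    obtain rfl := (hrules r').1 hr'
    rcases hA with rfl | ⟨L, hL, hA⟩
    · exact .inl hhead
    · exact (hpred L hL A hA).symm.imp_left fun h => h.1
  refine ⟨P, ?_, ⟨?_, ?_⟩, (hidb S).2 rfl, fun I => ⟨I.1, ?_, ?_⟩⟩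
  · intro X hX
    cases X with
    | arity =>
      obtain ⟨r', hr', A, hA, h⟩ := hX
      refine absurd h (not_lt.2 ?_)
      rcases hpreds r' hr' A hA with h | h
      · rw [h]; exact Q.arity_le
      · exact Q.monadic _ h
    | equations =>
      obtain ⟨r', hr', L, hL, e₁, e₂, h⟩ := hX
      obtain rfl := (hrules r').1 hr'
      exact ⟨hE L hL e₁ e₂ h, by simp⟩
    | intermediate =>
      obtain ⟨R₁, h₁, R₂, h₂, h⟩ := hX
      exact absurd (((hidb _).1 h₁).trans ((hidb _).1 h₂).symm) h
    | negation =>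
      obtain ⟨r', hr', A, hA⟩ := hX
      obtain rfl := (hrules r').1 hr'
      exact ⟨hN A hA, by simp⟩
    | packing =>
      obtain ⟨r', hr', e, he, h⟩ := hX
      obtain rfl := (hrules r').1 hr'
      exact absurd h (hpack e he)
    | recursion =>
      obtain ⟨R, hR⟩ := hX
      have : ∃ R', P.DependsOn R R' := by
        cases Relation.TransGen.head'_iff.1 hR with
        | intro R' h => exact ⟨R', h.1⟩
      obtain ⟨R', _, hR', r', hr', _, L, hL, A, hA, rfl⟩ := this
      obtain rfl := (hrules r').1 hr'
      rcases hpred L hL A hA with h | h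
      · rw [(hidb _).1 hR'] at h
        exact absurd h Q.not_mem
      · exact ⟨h.2.1, by simp⟩
  · rintro R ⟨⟨r', hr', A, hA, rfl⟩, h⟩
    exact (hpreds r' hr' A hA).resolve_left fun h' => h ((hidb _).2 h')
  · intro R hR
    rw [(hidb R).1 hR]
    exact Q.not_mem
  · exact ⟨I.1, stratumResult_self I.2.1.1 (by simpa using hsat I), rfl⟩
  · rw [hQ I]
    ext f
    simp only [Set.mem_ofPred_eq, Set.mem_empty_iff_false, iff_false, not_and]
    intro hf hfS
    exact Q.not_mem (hfS ▸ I.2.1.2 f hf)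

theorem exprs_of_head_nil {S : RelName} {body : List (Literal dom)} {e : PathExpr dom}
    (he : e ∈ (⟨unaryPred S [], body⟩ : Rule dom).exprs) :
    e = [] ∨ ∃ L ∈ body, e ∈ L.atom.exprs :=
  he.imp_left eq_of_mem_exprs_unaryPred

/-- With intermediate names, the constantly empty query is computable. -/
theorem computableIn_of_intermediate [Nonempty dom] {Γ : Schema} {S : RelName} {Q : Query dom Γ S}
    {F : Fragment} (hQ : Q.IsConstEmpty) (hI : Feature.intermediate ∈ F) :
    ComputableIn (F \ {Feature.packing}) Q := by
  classical
  obtain ⟨a⟩ := ‹Nonempty dom›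
  obtain ⟨M, hM⟩ := exists_uniform_bound (insert S Γ : Finset RelName).finite_toSet
    (p := fun R b => R.id < b) (fun _ _ _ h h' => h'.trans_le h)
    fun R _ => ⟨R.id + 1, by omega⟩
  let Z : RelName := ⟨M, 1⟩
  have hZ : Z ∉ insert S Γ := fun h => absurd (hM Z (by exact_mod_cast h)) (by simp [Z])
  have hZS : Z ≠ S := fun h => hZ (by simp [h])
  have hZΓ : Z ∉ Γ := fun h => hZ (by simp [h])
  -- The auxiliary relation contains only the path `a`, so the second rule, which asks for the empty
  -- path, never fires.
  let r₁ : Rule dom := ⟨unaryPred Z [.const a], []⟩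
  let r₂ : Rule dom := ⟨unaryPred S [], [.pos (.pred (unaryPred Z []))]⟩
  have hexprs : ∀ r ∈ [r₁, r₂], ∀ e ∈ r.exprs, PathExpr.vars e = ∅ ∧ ¬ PathExpr.HasPack e := by
    intro r hr e he
    simp only [List.mem_cons, List.not_mem_nil, or_false] at hr
    rcases hr with rfl | rfl
    · rcases he with he | ⟨L, hL, _⟩
      · obtain rfl := eq_of_mem_exprs_unaryPred he
        simp [PathExpr.HasPack]
      · simp [r₁] at hL
    · rcases exprs_of_head_nil he with rfl | ⟨L, hL, he⟩
      · simp [PathExpr.HasPack]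
      · obtain rfl := List.mem_singleton.1 hL
        obtain rfl := eq_of_mem_exprs_unaryPred he
        simp [PathExpr.HasPack]
  let P : Program dom :=
    { strata := [[r₁, r₂]]
      safe := by
        intro s hs r hr e he x hx
        obtain rfl := List.mem_singleton.1 hs
        simp [(hexprs r hr e he).1] at hx
      stratified := by
        refine ⟨?_, trivial⟩
        simp [r₁, r₂] }
  have hrules : ∀ r, r ∈ P.rules ↔ r = r₁ ∨ r = r₂ := by simp [Program.rules, P]
  have hidb : ∀ R, R ∈ P.idb ↔ R = Z ∨ R = S := fun R => by
    simp [Program.idb, hrules, r₁, r₂, unaryPred, eq_comm]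
  have hpreds : ∀ r ∈ P.rules, ∀ A ∈ r.preds, A.rel = Z ∨ A.rel = S := by
    intro r hr A hA
    rcases (hrules r).1 hr with rfl | rfl
    · rcases hA with rfl | ⟨L, hL, _⟩
      · exact .inl rfl
      · simp [r₁] at hL
    · rcases hA with rfl | ⟨L, hL, hA⟩
      · exact .inr rfl
      · obtain rfl := List.mem_singleton.1 hL
        obtain rfl := Atom.pred.inj hA
        exact .inl rfl
  refine ⟨P, ?_, ⟨?_, ?_⟩, (hidb S).2 (.inr rfl), fun I =>
    ⟨insert (unaryFact Z [.atom a]) I.1, ?_, ?_⟩⟩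
  · intro X hX
    cases X with
    | arity =>
      obtain ⟨r, hr, A, hA, h⟩ := hX
      refine absurd h (not_lt.2 ?_)
      rcases hpreds r hr A hA with h | h
      · rw [h]
      · rw [h]; exact Q.arity_le
    | equations =>
      obtain ⟨r, hr, L, hL, e₁, e₂, h⟩ := hX
      rcases (hrules r).1 hr with rfl | rfl
      · simp [r₁] at hL
      · obtain rfl := List.mem_singleton.1 hL
        cases h
    | intermediate => exact ⟨hI, by simp⟩
    | negation =>
      obtain ⟨r, hr, A, hA⟩ := hX
      rcases (hrules r).1 hr with rfl | rfl
      · simp [r₁] at hA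
      · simp [r₂] at hA
    | packing =>
      obtain ⟨r, hr, e, he, h⟩ := hX
      exact absurd h (hexprs r (by simpa using (hrules r).1 hr) e he).2
    | recursion =>
      obtain ⟨R, hR⟩ := hX
      have hdep : ∀ R₁ R₂, P.DependsOn R₁ R₂ → R₁ = S ∧ R₂ = Z := by
        rintro _ _ ⟨_, _, r, hr, rfl, L, hL, A, hA, rfl⟩
        rcases (hrules r).1 hr with rfl | rfl
        · simp [r₁] at hL
        · obtain rfl := List.mem_singleton.1 hL
          obtain rfl := Atom.pred.inj hA
          exact ⟨rfl, rfl⟩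
      obtain ⟨R₁, h₁, _⟩ := Relation.TransGen.head'_iff.1 hR
      obtain ⟨R₂, _, h₂⟩ := Relation.TransGen.tail'_iff.1 hR
      exact absurd ((hdep _ _ h₂).2.symm.trans (hdep _ _ h₁).1) hZS
  · rintro R ⟨⟨r, hr, A, hA, rfl⟩, h⟩
    exact absurd ((hidb _).2 (hpreds r hr A hA)) h
  · intro R hR
    rcases (hidb R).1 hR with rfl | rfl
    · exact hZΓ
    · exact Q.not_mem
  · refine ⟨_, ⟨⟨I.2.1.1.insert _, Set.subset_insert _ _, ?_, ?_⟩, ?_⟩, rfl⟩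
    · rintro f (rfl | hf) h
      · exact absurd rfl (h r₁ (by simp))
      · exact hf
    · intro r hr ν hν
      simp only [List.mem_cons, List.not_mem_nil, or_false] at hr
      rcases hr with rfl | rfl
      · left
        simp [r₁, unaryPred_eval]
      · exfalso
        rcases hν (.pos (.pred (unaryPred Z []))) (by simp [r₂]) with h | h
        · have := unaryFact_inj rfl h
          simp at this
        · exact hZΓ (I.2.1.2 _ h)
    · rintro K ⟨_, hIK, _, hsat⟩
      refine Set.insert_subset ?_ hIK
      simpa [r₁, unaryPred_eval] using
        hsat r₁ (by simp) ⟨fun _ => a, fun _ => []⟩ (by simp [r₁])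
  · rw [hQ I]
    ext f
    simp only [Set.mem_ofPred_eq, Set.mem_empty_iff_false, iff_false, not_and]
    rintro (rfl | hf) hfS
    · exact hZS hfS
    · exact Q.not_mem (hfS ▸ I.2.1.2 f hf)

/-- If a fragment offers more than arity and packing, then packing is not needed for the constantly
empty query. -/
theorem computableIn_of_isConstEmpty [Nonempty dom] {Γ : Schema} {S : RelName} {Q : Query dom Γ S}
    {F : Fragment} (hF : ¬ F ⊆ {Feature.arity, Feature.packing}) (hQ : Q.IsConstEmpty)
    (h : ComputableIn F Q) : ComputableIn (F \ {Feature.packing}) Q := by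
  by_cases hI : Feature.intermediate ∈ F
  · exact computableIn_of_intermediate hQ hI
  by_cases hE : Feature.equations ∈ F
  · obtain ⟨a⟩ := ‹Nonempty dom›
    have hexprs : ∀ e ∈ (⟨unaryPred S [], [.pos (.eq [] [.const a])]⟩ : Rule dom).exprs,
        PathExpr.vars e = ∅ ∧ ¬ PathExpr.HasPack e := by
      intro e he
      rcases exprs_of_head_nil he with rfl | ⟨L, hL, he⟩
      · simp [PathExpr.HasPack]
      · obtain rfl := List.mem_singleton.1 hL
        rcases he with rfl | rfl <;> simp [PathExpr.HasPack]
    refine computableIn_of_inert_rule hQ ⟨unaryPred S [], [.pos (.eq [] [.const a])]⟩ rfl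
      (fun e he x hx => by simp [(hexprs e he).1] at hx) (fun e he => (hexprs e he).2) ?_
      (fun _ _ _ _ _ => hE) (by simp) ?_
    · intro L hL A hA
      obtain rfl := List.mem_singleton.1 hL
      cases hA
    · intro I ν hν
      have := hν _ (List.mem_singleton.2 rfl)
      simp [Literal.Sat, Atom.Sat] at this
  by_cases hR : Feature.recursion ∈ F
  · have hexprs : ∀ e ∈ (⟨unaryPred S [], [.pos (.pred (unaryPred S []))]⟩ : Rule dom).exprs,
        e = [] := by
      intro e he
      rcases exprs_of_head_nil he with rfl | ⟨L, hL, he⟩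
      · rfl
      · obtain rfl := List.mem_singleton.1 hL
        exact eq_of_mem_exprs_unaryPred he
    refine computableIn_of_inert_rule hQ ⟨unaryPred S [], [.pos (.pred (unaryPred S []))]⟩ rfl
      (fun e he x hx => by simp [hexprs e he] at hx)
      (fun e he => by simp [hexprs e he, PathExpr.HasPack]) ?_ ?_ (by simp) ?_
    · intro L hL A hA
      obtain rfl := List.mem_singleton.1 hL
      obtain rfl := Atom.pred.inj hA
      exact .inr ⟨rfl, hR, rfl⟩
    · intro L hL _ _ h
      obtain rfl := List.mem_singleton.1 hL
      cases h
    · intro I ν hν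
      exact hν _ (List.mem_singleton.2 rfl)
  have hN : Feature.negation ∈ F := by
    obtain ⟨X, hX, h⟩ := Set.not_subset.1 hF
    cases X <;> simp_all
  -- A contradictory body needs some name to negate safely. If `Γ` were empty, the features still
  -- allowed would force the given rule for `S` to have an empty body, and it would produce a fact.
  obtain ⟨R, hRΓ⟩ : Γ.Nonempty := by
    by_contra hΓ
    rw [Finset.not_nonempty_iff_eq_empty] at hΓ
    obtain ⟨P, hPF, hover, ⟨r, hr, hrS⟩, hres⟩ := h
    have hbody : r.body = [] := by
      rw [List.eq_nil_iff_forall_not_mem]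
      intro L hL
      cases hA : L.atom with
      | eq e₁ e₂ => exact hE (hPF .equations ⟨r, hr, L, hL, e₁, e₂, hA⟩)
      | pred A =>
        have hidb : A.rel ∈ P.idb := by
          by_contra h
          have := hover.1 A.rel ⟨⟨r, hr, A, .inr ⟨L, hL, hA⟩, rfl⟩, h⟩
          simp [hΓ] at this
        have hAS : A.rel = S := by
          by_contra h
          exact hI (hPF .intermediate ⟨_, hidb, S, ⟨r, hr, hrS⟩, h⟩)
        exact hR (hPF .recursion ⟨S, .single ⟨⟨r, hr, hrS⟩, hAS ▸ hidb, r, hr, hrS, L, hL, A, hA,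
          hAS⟩⟩)
    let I : FlatInstance dom Γ := ⟨∅, ⟨Set.finite_empty, by simp⟩, by simp [IsFlat]⟩
    obtain ⟨J, hJ, hJQ⟩ := hres I
    obtain ⟨a⟩ := ‹Nonempty dom›
    have hfire : ∀ {ss : List (Stratum dom)} {I J : Set (Fact dom)}, StrataResult ss I J →
        (∃ s ∈ ss, r ∈ s) → r.head.eval ⟨fun _ => a, fun _ => []⟩ ∈ J := by
      intro ss
      induction ss with
      | nil => simp
      | cons s ss ih =>
        rintro I J ⟨K, hK, hKJ⟩ ⟨s', hs', hr'⟩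
        rcases List.mem_cons.1 hs' with rfl | hs'
        · exact hKJ.subset (hK.1.2.2.2 r hr' _ (by simp [hbody]))
        · exact ih hKJ ⟨s', hs', hr'⟩
    have hmem : r.head.eval ⟨fun _ => a, fun _ => []⟩ ∈ {f ∈ J | f.rel = S} := ⟨hfire hJ hr, hrS⟩
    rw [hJQ, hQ I] at hmem
    exact hmem
  have hexprs : ∀ e ∈ (⟨unaryPred S [], [.pos (.pred (unaryPred R [pv 0])),
      .neg (.pred (unaryPred R [pv 0]))]⟩ : Rule dom).exprs,
      e = [] ∨ e ∈ (unaryPred R [pv 0]).exprs := by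
    intro e he
    rcases exprs_of_head_nil he with rfl | ⟨L, hL, he⟩
    · exact .inl rfl
    · simp only [List.mem_cons, List.not_mem_nil, or_false] at hL
      rcases hL with rfl | rfl <;> exact .inr he
  refine computableIn_of_inert_rule hQ ⟨unaryPred S [], [.pos (.pred (unaryPred R [pv 0])),
      .neg (.pred (unaryPred R [pv 0]))]⟩ rfl ?_ ?_ ?_ ?_ (fun _ _ => hN) ?_
  · intro e he x hx
    rcases hexprs e he with rfl | he
    · simp at hx
    · exact .pred _ (by simp) e he x hx
  · intro e he
    rcases hexprs e he with rfl | he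
    · simp [PathExpr.HasPack]
    · obtain rfl := eq_of_mem_exprs_unaryPred he
      simp [PathExpr.HasPack]
  · intro L hL A hA
    left
    simp only [List.mem_cons, List.not_mem_nil, or_false] at hL
    rcases hL with rfl | rfl <;> obtain rfl := Atom.pred.inj hA <;> exact hRΓ
  · intro L hL _ _ h
    simp only [List.mem_cons, List.not_mem_nil, or_false] at hL
    rcases hL with rfl | rfl <;> cases h
  · intro I ν hν
    have h₁ := hν (.pos (.pred (unaryPred R [pv 0]))) (by simp)
    exact absurd h₁ (hν (.neg (.pred (unaryPred R [pv 0]))) (by simp))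

-- Combining the cases

/-- Packing is not needed for queries that are not constantly empty. -/
theorem computableIn_of_not_isConstEmpty [Infinite dom] {Γ : Schema} {S : RelName}
    {Q : Query dom Γ S} {F : Fragment} (hQ : ¬ Q.IsConstEmpty) (h : ComputableIn F Q) :
    ComputableIn (F \ {Feature.packing}) Q := by
  obtain ⟨P, hPF, hP⟩ := h
  obtain ⟨hover, hS, hres⟩ := id hP
  choose J hJ hJQ using hres
  by_cases hI : Feature.intermediate ∈ F
  · by_cases hR : Feature.recursion ∈ F
    · exact computableIn_of_recursion hPF hP hI hR
    · exact computableIn_of_finite_shapes hPF hover hJ hJQ hQ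
        (finite_shapes_of_not_recursion hover hJ fun h => hR (hPF _ h)) (.inl hI)
  -- Recursion needs no separate treatment here: it can only pass through `S`, whose final relation
  -- is flat, so the shapes remain bounded.
  · have hidb : P.idb ⊆ {S} := fun R hR => by
      by_contra h
      exact hI (hPF .intermediate ⟨R, hR, S, hS, h⟩)
    exact computableIn_of_finite_shapes hPF hover hJ hJQ hQ
      (finite_shapes_of_idb_subset hJ hJQ hidb) (.inr hidb)

end SeqDatalog

theorem mainTheorem2 {dom : Type*} [Countable dom] [Infinite dom] :
    (∀ F : SeqDatalog.Fragment,
      ¬ F ⊆ {SeqDatalog.Feature.arity, SeqDatalog.Feature.packing} →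
        SeqDatalog.Subsumed dom F (F \ {SeqDatalog.Feature.packing})) ∧
    (∀ (F : SeqDatalog.Fragment) (Γ : SeqDatalog.Schema) (S : SeqDatalog.RelName)
      (Q : SeqDatalog.Query dom Γ S), ¬ Q.IsConstEmpty →
        SeqDatalog.ComputableIn F Q →
          SeqDatalog.ComputableIn (F \ {SeqDatalog.Feature.packing}) Q) := by
  refine ⟨fun F hF Γ S Q h => ?_, fun F Γ S Q hQ h =>
    SeqDatalog.computableIn_of_not_isConstEmpty hQ h⟩
  by_cases hQ : Q.IsConstEmpty
  · exact SeqDatalog.computableIn_of_isConstEmpty hF hQ h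
  · exact SeqDatalog.computableIn_of_not_isConstEmpty hQ h
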